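/- Algorithms are finite programs for a probabilistic random access machine over a fixed finite field $\mathbb F$ (index registers, field registers, resizable arrays of indices and of field elements, fresh uniformly random bits and field elements). Running time is measured with logarithmic cost and is a worst-case bound over all inputs of the given dimension $n$ and all random choices. $f(n)=\tilde O(g(n))$ means $f(n)=O(g(n)\log^k n)$ for some constant $k$. A trapdoored matrix family over $\mathbb F$ is a sequence $(\mathcal D_n)_n$ of distributions over pairs $(M,C)$, where $M\in\mathbb F^{n\times n}$ and $C$ is an arithmetic circuit over $\mathbb F$, such that: (i) some probabilistic polynomial-time algorithm, given $n$, outputs a pair distributed according to $\mathcal D_n$; (ii) for every $(M,C)$ in the support of $\mathcal D_n$ and every $v\in\mathbb F^n$, $C(v)=Mv$; (iii) the circuits in the support of $\mathcal D_n$ have size at most $S(n)$ for some $S(n)=\tilde O(n)$; (iv) for every probabilistic polynomial-time algorithm $\mathcal A$, $$\Big|\Pr_{M\sim \mathbb F^{n\times n}}[\mathcal A(M)=1]-\Pr_{(M,C)\sim\mathcal D_n}[\mathcal A(M)=1]\Big|$$ vanishes faster than any inverse polynomial in $n$. **Theorem.** Let $\mathbb F$ be a finite field over which a trapdoored matrix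 family exists, and let $\varepsilon>0$. Let $\mathcal M$ be a (possibly randomized) algorithm that, given $n$ and $A,B\in\mathbb F^{n\times n}$, halts within time $T(n)$, and suppose that for every sufficiently large $n$ $$\Pr\big[\mathcal M(A,B)=AB\big]\ \ge\ \varepsilon ,$$ where the probability is over independent uniformly random $A,B\in\mathbb F^{n\times n}$ and the random choices of $\mathcal M$. Then for every constant $c\in\mathbb N$ there is a randomized algorithm with running time $\tilde O(T(n))$ that, for every $n\ge 1$ and for **all** matrices $A,B\in\mathbb F^{n\times n}$, outputs $AB$ with probability at least $1-n^{-c}$ over its own random choices. -/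

import Mathlib

open Filter Asymptotics

/-! ## Random access machines over a finite field

The machine has index registers (natural numbers), field registers, resizable arrays of natural
numbers and resizable arrays of field elements, each named by a natural number (a program mentions
finitely many). It is probabilistic and uniform: one finite program serves all input sizes.
Time is measured by the logarithmic cost criterion: an instruction costs one plus the bit lengths
of the natural numbers that it handles; a field element of the fixed finite field has cost one. -/

namespace RAM

/-- The contents of the memory. -/
structure State (F : Type*) where
  idx : ℕ → ℕ
  fld : ℕ → F
  idxArr : ℕ → List ℕ
  fldArr : ℕ → List F

/-- Blank memory: all registers are zero, all arrays are empty. -/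
def State.blank (F : Type*) [Zero F] : State F where
  idx := fun _ => 0
  fld := fun _ => 0
  idxArr := fun _ => []
  fldArr := fun _ => []

/-- Arithmetic on natural numbers (truncated subtraction, rounded division). -/
inductive IdxOp
  | plus
  | minus
  | times
  | quot

def IdxOp.eval : IdxOp → ℕ → ℕ → ℕ
  | .plus, a, b => a + b
  | .minus, a, b => a - b
  | .times, a, b => a * b
  | .quot, a, b => a / b

/-- Arithmetic in the field (division by zero gives zero). -/
inductive FldOp
  | plus
  | minus
  | times
  | quot

def FldOp.eval {F : Type*} [Field F] : FldOp → F → F → F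
  | .plus, a, b => a + b
  | .minus, a, b => a - b
  | .times, a, b => a * b
  | .quot, a, b => a / b

/-- Elementary instructions. Here `r i j` name index registers, `x y z` name field registers and
`a` names an array. -/
inductive Instr (F : Type*)
  /-- `r := k` -/
  | idxConst (r k : ℕ)
  /-- `r := i` -/
  | idxMove (r i : ℕ)
  /-- `r := i op j` -/
  | idxArith (op : IdxOp) (r i j : ℕ)
  /-- `r := length of the index array a` -/
  | idxLen (r a : ℕ)
  /-- `r := a[i]`, or `0` beyond the end of `a` -/
  | idxGet (r a i : ℕ)
  /-- `a[i] := r`, no effect beyond the end of `a` -/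
  | idxSet (a i r : ℕ)
  /-- append the content of `r` to `a` -/
  | idxPush (a r : ℕ)
  /-- remove the last element of `a` -/
  | idxPop (a : ℕ)
  /-- `x := k` -/
  | fldConst (x : ℕ) (k : F)
  /-- `x := y` -/
  | fldMove (x y : ℕ)
  /-- `x := y op z` -/
  | fldArith (op : FldOp) (x y z : ℕ)
  /-- `r := length of the field array a` -/
  | fldLen (r a : ℕ)
  /-- `x := a[i]`, or `0` beyond the end of `a` -/
  | fldGet (x a i : ℕ)
  /-- `a[i] := x`, no effect beyond the end of `a` -/
  | fldSet (a i x : ℕ)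
  /-- append the content of `x` to `a` -/
  | fldPush (a x : ℕ)
  /-- remove the last element of `a` -/
  | fldPop (a : ℕ)
  /-- `r := a fresh uniformly random bit` -/
  | flip (r : ℕ)
  /-- `x := a fresh uniformly random field element` -/
  | sample (x : ℕ)

/-- The effect of an instruction. The pair `coin` is the fresh randomness available in this step;
only `flip` and `sample` use it. -/
def Instr.exec {F : Type*} [Field F] (coin : F × Bool) (s : State F) : Instr F → State F
  | .idxConst r k => { s with idx := Function.update s.idx r k }
  | .idxMove r i => { s with idx := Function.update s.idx r (s.idx i) }
  | .idxArith op r i j =>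
      { s with idx := Function.update s.idx r (op.eval (s.idx i) (s.idx j)) }
  | .idxLen r a => { s with idx := Function.update s.idx r (s.idxArr a).length }
  | .idxGet r a i => { s with idx := Function.update s.idx r ((s.idxArr a).getD (s.idx i) 0) }
  | .idxSet a i r =>
      { s with idxArr := Function.update s.idxArr a ((s.idxArr a).set (s.idx i) (s.idx r)) }
  | .idxPush a r => { s with idxArr := Function.update s.idxArr a (s.idxArr a ++ [s.idx r]) }
  | .idxPop a => { s with idxArr := Function.update s.idxArr a (s.idxArr a).dropLast }
  | .fldConst x k => { s with fld := Function.update s.fld x k }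
  | .fldMove x y => { s with fld := Function.update s.fld x (s.fld y) }
  | .fldArith op x y z =>
      { s with fld := Function.update s.fld x (op.eval (s.fld y) (s.fld z)) }
  | .fldLen r a => { s with idx := Function.update s.idx r (s.fldArr a).length }
  | .fldGet x a i => { s with fld := Function.update s.fld x ((s.fldArr a).getD (s.idx i) 0) }
  | .fldSet a i x =>
      { s with fldArr := Function.update s.fldArr a ((s.fldArr a).set (s.idx i) (s.fld x)) }
  | .fldPush a x => { s with fldArr := Function.update s.fldArr a (s.fldArr a ++ [s.fld x]) }
  | .fldPop a => { s with fldArr := Function.update s.fldArr a (s.fldArr a).dropLast }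
  | .flip r => { s with idx := Function.update s.idx r coin.2.toNat }
  | .sample x => { s with fld := Function.update s.fld x coin.1 }

/-- The logarithmic cost of an instruction; `Nat.size` is the bit length. -/
def Instr.cost {F : Type*} (s : State F) : Instr F → ℕ
  | .idxConst _ k => 1 + k.size
  | .idxMove _ i => 1 + (s.idx i).size
  | .idxArith op _ i j =>
      1 + (s.idx i).size + (s.idx j).size + (op.eval (s.idx i) (s.idx j)).size
  | .idxLen _ a => 1 + (s.idxArr a).length.size
  | .idxGet _ a i => 1 + (s.idx i).size + ((s.idxArr a).getD (s.idx i) 0).size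
  | .idxSet _ i r => 1 + (s.idx i).size + (s.idx r).size
  | .idxPush _ r => 1 + (s.idx r).size
  | .fldLen _ a => 1 + (s.fldArr a).length.size
  | .fldGet _ _ i => 1 + (s.idx i).size
  | .fldSet _ i _ => 1 + (s.idx i).size
  | _ => 1

/-- Conditions for branching: comparison of index registers, equality of field registers,
emptiness of an array. -/
inductive Test
  | idxLt (i j : ℕ)
  | fldEq (x y : ℕ)
  | idxEmpty (a : ℕ)
  | fldEmpty (a : ℕ)

def Test.holds {F : Type*} [DecidableEq F] (s : State F) : Test → Bool
  | .idxLt i j => decide (s.idx i < s.idx j)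
  | .fldEq x y => decide (s.fld x = s.fld y)
  | .idxEmpty a => (s.idxArr a).isEmpty
  | .fldEmpty a => (s.fldArr a).isEmpty

def Test.cost {F : Type*} (s : State F) : Test → ℕ
  | .idxLt i j => 1 + (s.idx i).size + (s.idx j).size
  | _ => 1

/-- Programs. -/
inductive Prog (F : Type*)
  | skip
  | instr (i : Instr F)
  | seq (p q : Prog F)
  | cond (b : Test) (p q : Prog F)
  | loop (b : Test) (p : Prog F)

/-- A configuration: the programs that remain to be executed (first one first), the memory and
the time used so far. -/
structure Config (F : Type*) where
  todo : List (Prog F)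
  state : State F
  clock : ℕ

/-- The configuration has halted if nothing remains to be executed. -/
def Config.Halted {F : Type*} (c : Config F) : Prop := c.todo = []

/-- One step of the machine, with the fresh randomness `coin`. -/
def Config.next {F : Type*} [Field F] [DecidableEq F] (coin : F × Bool) (c : Config F) :
    Config F :=
  match c.todo with
  | [] => c
  | .skip :: l => ⟨l, c.state, c.clock + 1⟩
  | .instr i :: l => ⟨l, i.exec coin c.state, c.clock + i.cost c.state⟩
  | .seq p q :: l => ⟨p :: q :: l, c.state, c.clock + 1⟩
  | .cond b p q :: l =>
      ⟨(if b.holds c.state then p else q) :: l, c.state, c.clock + b.cost c.state⟩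
  | .loop b p :: l =>
      ⟨if b.holds c.state then p :: .loop b p :: l else l, c.state, c.clock + b.cost c.state⟩

/-- The distribution of the configuration after `t` steps from `c`, where every step draws
independent uniform randomness. -/
noncomputable def run {F : Type*} [Field F] [Fintype F] [DecidableEq F] :
    ℕ → Config F → PMF (Config F)
  | 0, c => PMF.pure c
  | t + 1, c => (PMF.uniformOfFintype (F × Bool)).bind fun coin => run t (c.next coin)

/-- Started with memory `s`, the program `p` halts within time `t`, whatever its random choices.
(Every step costs at least one, so `t` steps suffice.) -/
def HaltsWithin {F : Type*} [Field F] [Fintype F] [DecidableEq F] (p : Prog F) (s : State F)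
    (t : ℕ) : Prop :=
  ∀ c ∈ (run t ⟨[p], s, 0⟩).support, c.Halted ∧ c.clock ≤ t

/-- The probability that the program `p`, started with memory `s`, halts with a memory content
in `E`. -/
noncomputable def haltProb {F : Type*} [Field F] [Fintype F] [DecidableEq F] (p : Prog F)
    (s : State F) (E : Set (State F)) : ENNReal :=
  ⨆ t : ℕ, (run t ⟨[p], s, 0⟩).toOuterMeasure {c | c.Halted ∧ c.state ∈ E}

end RAM

/-! ## Input and output conventions -/

/-- The list of the entries of a matrix, row by row. -/
def matrixEntries {F : Type*} {n : ℕ} (M : Matrix (Fin n) (Fin n) F) : List F :=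
  (List.ofFn fun i : Fin n => List.ofFn fun j : Fin n => M i j).flatten

/-- Input `n`: index register `0` holds `n`. -/
def sizeInput (F : Type*) [Zero F] (n : ℕ) : RAM.State F :=
  { RAM.State.blank F with idx := Function.update (fun _ => 0) 0 n }

/-- Input `(n, M)`: moreover field array `0` holds `M`. -/
def matrixInput {F : Type*} [Zero F] {n : ℕ} (M : Matrix (Fin n) (Fin n) F) : RAM.State F :=
  { sizeInput F n with fldArr := Function.update (fun _ => []) 0 (matrixEntries M) }

/-- Input `(n, A, B)`: moreover field arrays `0` and `1` hold `A` and `B`. -/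
def pairInput {F : Type*} [Zero F] {n : ℕ} (A B : Matrix (Fin n) (Fin n) F) : RAM.State F :=
  { sizeInput F n with
    fldArr := Function.update (Function.update (fun _ => []) 0 (matrixEntries A))
      1 (matrixEntries B) }

/-- The output is the matrix `M`: field array `2`, which is empty at the start, holds `M`. -/
def outputsMatrix {F : Type*} {n : ℕ} (M : Matrix (Fin n) (Fin n) F) : Set (RAM.State F) :=
  {s | s.fldArr 2 = matrixEntries M}

/-- The output is the bit `1`, in index register `0`. -/
def outputsOne (F : Type*) : Set (RAM.State F) :=
  {s | s.idx 0 = 1}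

/-! ## Arithmetic circuits -/

/-- Gates of an arithmetic circuit; `i` and `j` are input numbers (`input`) or the numbers of
earlier gates (`plus`, `times`). -/
inductive Gate (F : Type*)
  | input (i : ℕ)
  | const (k : F)
  | plus (i j : ℕ)
  | times (i j : ℕ)

/-- An arithmetic circuit: its gates in the order of evaluation and the numbers of the gates
whose values are the outputs. -/
structure Circuit (F : Type*) where
  gates : List (Gate F)
  outputs : List ℕ

/-- The value of a gate, given the inputs `v` and the values `w` of the earlier gates. -/
def Gate.value {F : Type*} [Field F] (v w : List F) : Gate F → F
  | .input i => v.getD i 0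
  | .const k => k
  | .plus i j => w.getD i 0 + w.getD j 0
  | .times i j => w.getD i 0 * w.getD j 0

/-- The outputs of the circuit on the inputs `v`. -/
def Circuit.eval {F : Type*} [Field F] (C : Circuit F) (v : List F) : List F :=
  let w := C.gates.foldl (fun w g => w ++ [g.value v w]) []
  C.outputs.map fun k => w.getD k 0

/-- The size of a circuit: its number of gates and outputs. -/
def Circuit.size {F : Type*} (C : Circuit F) : ℕ :=
  C.gates.length + C.outputs.length

/-- The natural numbers that describe a gate in the encoding of a circuit. -/
def Gate.code {F : Type*} : Gate F → List ℕ
  | .input i => [0, i, 0]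
  | .const _ => [1, 0, 0]
  | .plus i j => [2, i, j]
  | .times i j => [3, i, j]

/-- The field element that belongs to a gate in the encoding of a circuit. -/
def Gate.constant {F : Type*} [Zero F] : Gate F → F
  | .const k => k
  | _ => 0

/-- The output is the pair `(M, C)`: field array `0` holds `M`, and index array `0`, field
array `1` and index array `1` hold the description of `C`. -/
def outputsTrapdoored {F : Type*} [Zero F] {n : ℕ} (M : Matrix (Fin n) (Fin n) F)
    (C : Circuit F) : Set (RAM.State F) :=
  {s | s.fldArr 0 = matrixEntries M ∧ s.idxArr 0 = C.gates.flatMap Gate.code ∧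
    s.fldArr 1 = C.gates.map Gate.constant ∧ s.idxArr 1 = C.outputs}

/-! ## Asymptotics and probability -/

/-- `f(n) = Õ(g(n))`: equality up to constant and polylogarithmic (in `n`) factors. -/
def SoftO (f g : ℕ → ℕ) : Prop :=
  ∃ k : ℕ, (fun n => (f n : ℝ)) =O[atTop] fun n => (g n : ℝ) * Real.log n ^ k

/-- `f` is bounded by a polynomial. -/
def PolyBounded (f : ℕ → ℕ) : Prop :=
  ∃ k : ℕ, ∀ n, f n ≤ k * n ^ k + k

/-- The expectation of `f` under the distribution `μ` on a finite set. -/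
noncomputable def expectation {α : Type*} [Fintype α] (μ : PMF α) (f : α → ℝ) : ℝ :=
  ∑ a, (μ a).toReal * f a

/-! ## Trapdoored matrices -/

/-- The distributions `D n` can be sampled by a probabilistic polynomial-time algorithm. -/
def EfficientlySamplable {F : Type*} [Field F] [Fintype F] [DecidableEq F]
    (D : (n : ℕ) → PMF (Matrix (Fin n) (Fin n) F × Circuit F)) : Prop :=
  ∃ (p : RAM.Prog F) (t : ℕ → ℕ), PolyBounded t ∧
    (∀ n, RAM.HaltsWithin p (sizeInput F n) (t n)) ∧
    ∀ n M C, RAM.haltProb p (sizeInput F n) (outputsTrapdoored M C) = D n (M, C)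

/-- A matrix drawn from `D n` is computationally indistinguishable from a uniform one: every
probabilistic polynomial-time algorithm has negligible distinguishing advantage. -/
def IndistinguishableFromUniform {F : Type*} [Field F] [Fintype F] [DecidableEq F]
    (D : (n : ℕ) → PMF (Matrix (Fin n) (Fin n) F)) : Prop :=
  ∀ (p : RAM.Prog F) (t : ℕ → ℕ), PolyBounded t →
    (∀ n (M : Matrix (Fin n) (Fin n) F), RAM.HaltsWithin p (matrixInput M) (t n)) →
    SuperpolynomialDecay atTop (fun n : ℕ => (n : ℝ)) fun n : ℕ =>
      |expectation (PMF.uniformOfFintype (Matrix (Fin n) (Fin n) F))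
          (fun M => (RAM.haltProb p (matrixInput M) (outputsOne F)).toReal) -
        expectation (D n)
          (fun M => (RAM.haltProb p (matrixInput M) (outputsOne F)).toReal)|

/-- A trapdoored matrix family over the finite field `F`: efficiently samplable distributions
over pairs of an `n × n` matrix `M` and a circuit of size `Õ(n)` that computes `v ↦ M v`, such
that `M` is computationally indistinguishable from a uniformly random matrix. -/
structure IsTrapdooredFamily {F : Type*} [Field F] [Fintype F] [DecidableEq F]
    (D : (n : ℕ) → PMF (Matrix (Fin n) (Fin n) F × Circuit F)) : Prop where
  samplable : EfficientlySamplable D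
  correct : ∀ n, ∀ MC ∈ (D n).support, ∀ v : Fin n → F,
    MC.2.eval (List.ofFn v) = List.ofFn (MC.1.mulVec v)
  efficient : ∃ S : ℕ → ℕ, SoftO S (fun n => n) ∧ ∀ n, ∀ MC ∈ (D n).support, MC.2.size ≤ S n
  indistinguishable : IndistinguishableFromUniform fun n => (D n).map Prod.fst

/-! The proof is a worst-case to average-case reduction by hiding and splitting. A square window of
`A * B` depends only on a strip of rows of `A` and a strip of columns of `B`. Choose a constant `k`
with `(7/8)^k ≤ ε/4`, put `m = n / k`, and consider the `k` disjoint places at which `m` rows of one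
random matrix and `m` columns of another can be replaced by a given pair of strips. The product of
the two modified matrices contains the product of the strips as a diagonal window.

Call a pair of strips good if, hidden at some place in a uniformly random pair of matrices, it is
multiplied correctly by the given program with probability at least `δ = ε/(4k)`. At most one eighth
of all pairs of strips are bad (`expect_bad_le`). A random pair of matrices carries `k` independent
uniform pairs of strips. If more than one eighth were bad, then with probability at least `1 -
(7/8)^k` some place would carry a bad pair; by a union bound over the places, those matrices
contribute at most `k * δ = ε/4` to the success probability and the others at most `ε/4`, which is
less than `ε` in total.

For arbitrary `A` and `B`, split `A = A₁ + A₂` and `B = B₁ + B₂` at random. Each of the four pairs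
`(Aᵢ, Bⱼ)` is uniform, so all four have good strips with probability at least `1/2`
(`half_le_expect_split`). Guessing a place costs a factor `2^k`, so a window of `A * B` is obtained
with probability at least `1/2 * (2^(-k) * δ)^4`. At most `(k + 1)^2` windows cover the product if
`n` is large, so an attempt succeeds with a constant probability. The finitely many small `n` are
treated by guessing the product. In total there is a constant `γ > 0` for all `n`
(`succeeds_attempt`).

Freivalds' check (`expect_mulVec_eq_zero_le`), repeated `L = Θ(log n)` times, recognizes wrong
results up to an error `2^(-L)`. With up to `L` attempts the failure probability is at most `(1 -
γ)^L + L * 2^(-L)` (`one_sub_retryProb_le`), hence at most `n^(-c)`. An attempt makes a constant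
number of calls, and everything else takes time `Õ(n²)`. This is `Õ(T(n))`, because a program that
writes a product with positive probability needs time `n²` (`sq_le_of_mulProb_pos`).

Programs are analysed by a calculus of expected values: `Achieves` combines sure termination within
a time bound with a lower bound for an expectation, and `Achieves.seq` composes such statements.
`HaltsWithin.succeeds` allows the given program to run as a subroutine in a larger memory. -/

open scoped BigOperators
set_option linter.unusedSectionVars false

/-! ### Expected values of runs and a calculus for programs -/

namespace RAM

variable {F : Type*} [Field F] [Fintype F] [DecidableEq F]

/-- Started from the given configuration, the machine surely reaches configurations that are
accepted by `G`, each together with a value, and the expectation of these values is at least the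
given number. -/
inductive Attains (G : Config F → ℝ → Prop) : Config F → ℝ → Prop
  | here {c : Config F} {v w : ℝ} : G c w → v ≤ w → Attains G c v
  | step {c : Config F} {v : ℝ} (u : F × Bool → ℝ) : ¬ c.Halted →
      (∀ coin, Attains G (c.next coin) (u coin)) → v ≤ 𝔼 coin, u coin → Attains G c v

namespace Attains

variable {G G' : Config F → ℝ → Prop} {c : Config F} {v : ℝ}

/-- Derivation trees are grafted: every leaf of the first tree is replaced by a tree from that
configuration. This is the source of sequential composition. -/
theorem bind (h : Attains G c v) (hG : ∀ c w, G c w → Attains G' c w) :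
    Attains G' c v := by
  induction h with
  | here hg hv =>
    have := hG _ _ hg
    cases this with
    | here hg' hv' => exact .here hg' (hv.trans hv')
    | step u hc hu hv' => exact .step u hc hu (hv.trans hv')
  | step u hc _ hv ih => exact .step u hc ih hv

theorem mono (h : Attains G c v) (hG : ∀ c w, G c w → G' c w) : Attains G' c v :=
  h.bind fun _ _ hg => .here (hG _ _ hg) le_rfl

theorem anti (h : Attains G c v) {v' : ℝ} (hv : v' ≤ v) : Attains G c v' := by
  cases h with
  | here hg hv' => exact .here hg (hv.trans hv')
  | step u hc hu hv' => exact .step u hc hu (hv.trans hv')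

theorem scale (h : Attains G c v) {x : ℝ} (hx : 0 ≤ x) :
    Attains (fun c w => ∃ w', G c w' ∧ w = w' * x) c (v * x) := by
  induction h with
  | here hg hv => exact .here ⟨_, hg, rfl⟩ (mul_le_mul_of_nonneg_right hv hx)
  | step u hc _ hv ih =>
    refine .step (fun coin => u coin * x) hc ih ?_
    rw [← Finset.expect_mul]
    exact mul_le_mul_of_nonneg_right hv hx

/-- The shape of a tree does not depend on its values, so sure termination is retained when the
values are replaced by a constant. -/
theorem sure (h : Attains G c v) (x : ℝ) : Attains (fun c w => (∃ w', G c w') ∧ w = x) c x := by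
  induction h with
  | here hg hv => exact .here ⟨⟨_, hg⟩, rfl⟩ le_rfl
  | step u hc _ hv ih => exact .step (fun _ => x) hc ih (by simp)

end Attains

theorem Instr.cost_pos (s : State F) (i : Instr F) : 1 ≤ i.cost s := by
  cases i <;> simp only [Instr.cost] <;> omega

theorem Test.cost_pos (s : State F) (b : Test) : 1 ≤ b.cost s := by
  cases b <;> simp only [Test.cost] <;> omega

theorem Config.clock_lt_next {c : Config F} (hc : ¬ c.Halted) (coin : F × Bool) :
    c.clock < (c.next coin).clock := by
  obtain ⟨todo, s, k⟩ := c
  match todo with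
  | [] => exact absurd rfl hc
  | .skip :: l => simp [Config.next]
  | .instr i :: l => have := i.cost_pos s; simp [Config.next]; omega
  | .seq p q :: l => simp [Config.next]
  | .cond b p q :: l => have := b.cost_pos s; simp [Config.next]; omega
  | .loop b p :: l => have := b.cost_pos s; simp [Config.next]; omega

theorem Config.next_of_halted {c : Config F} (hc : c.Halted) (coin : F × Bool) :
    c.next coin = c := by
  obtain ⟨todo, s, k⟩ := c
  obtain rfl : todo = [] := hc
  rfl

theorem run_of_halted {c : Config F} (hc : c.Halted) (t : ℕ) : run t c = PMF.pure c := by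
  induction t with
  | zero => rfl
  | succ t ih => simp [run, Config.next_of_halted hc, ih]

theorem mem_support_run_succ {c c' : Config F} {t : ℕ} :
    c' ∈ (run (t + 1) c).support ↔ ∃ coin, c' ∈ (run t (c.next coin)).support := by
  simp [run]

/-- The probability of an event after `t` steps. -/
noncomputable def runProb (t : ℕ) (c : Config F) (E : Set (Config F)) : ℝ :=
  ((run t c).toOuterMeasure E).toReal

theorem run_toOuterMeasure_le_one (t : ℕ) (c : Config F) (E : Set (Config F)) :
    (run t c).toOuterMeasure E ≤ 1 := by
  rw [PMF.toOuterMeasure_apply]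
  refine le_trans (ENNReal.tsum_le_tsum fun a => Set.indicator_le_self _ _ a) ?_
  simp [PMF.tsum_coe]

theorem runProb_succ (t : ℕ) (c : Config F) (E : Set (Config F)) :
    runProb (t + 1) c E = 𝔼 coin, runProb t (c.next coin) E := by
  simp only [runProb, run, PMF.toOuterMeasure_bind_apply, tsum_fintype,
    PMF.uniformOfFintype_apply]
  rw [← Finset.mul_sum, ENNReal.toReal_mul, ENNReal.toReal_sum, Fintype.expect_eq_sum_div_card,
    div_eq_inv_mul]
  · simp
  · intro a _
    exact ((run_toOuterMeasure_le_one _ _ _).trans_lt ENNReal.one_lt_top).ne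

open Classical in
theorem runProb_of_halted {c : Config F} (hc : c.Halted) (t : ℕ) (E : Set (Config F)) :
    runProb t c E = if c ∈ E then 1 else 0 := by
  rw [runProb, run_of_halted hc, PMF.toOuterMeasure_pure_apply]
  split_ifs <;> simp

theorem haltProb_le_one (p : Prog F) (s : State F) (E : Set (State F)) : haltProb p s E ≤ 1 :=
  iSup_le fun _ => run_toOuterMeasure_le_one _ _ _

theorem runProb_le_haltProb (t : ℕ) (p : Prog F) (s : State F) (E : Set (State F)) :
    runProb t ⟨[p], s, 0⟩ {c | c.Halted ∧ c.state ∈ E} ≤ (haltProb p s E).toReal :=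
  ENNReal.toReal_mono ((haltProb_le_one p s E).trans_lt ENNReal.one_lt_top).ne
    (le_iSup (fun t => (run t ⟨[p], s, 0⟩).toOuterMeasure {c | c.Halted ∧ c.state ∈ E}) t)

-- The clock increases strictly in every step, so a tree whose leaves have clock at most `T` has
-- depth at most `T - c.clock`. Hence `N` steps of the actual machine reach the leaves.
open Classical in
theorem Attains.support_run {c : Config F} {v : ℝ} {T : ℕ} {E : Set (State F)}
    (h : Attains (fun c w => c.Halted ∧ c.clock ≤ T ∧ w ≤ if c.state ∈ E then 1 else 0) c v) :
    c.clock ≤ T ∧ ∀ N, T ≤ N + c.clock →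
      (∀ c' ∈ (run N c).support, c'.Halted ∧ c'.clock ≤ T) ∧
      v ≤ runProb N c {c | c.Halted ∧ c.state ∈ E} := by
  induction h with
  | @here c v w hg hv =>
    refine ⟨hg.2.1, fun N _ => ⟨?_, ?_⟩⟩
    · rw [run_of_halted hg.1]
      simp [hg.1, hg.2.1]
    · rw [runProb_of_halted hg.1]
      simpa [hg.1] using hv.trans hg.2.2
  | @step c v u hc _ hv ih =>
    have hclock (coin) := c.clock_lt_next hc coin
    have hle : c.clock < T := (hclock (0, false)).trans_le (ih (0, false)).1
    refine ⟨hle.le, fun N hN => ?_⟩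
    obtain ⟨N, rfl⟩ : ∃ N', N = N' + 1 := ⟨N - 1, by omega⟩
    refine ⟨fun c' hc' => ?_, ?_⟩
    · obtain ⟨coin, hcoin⟩ := mem_support_run_succ.1 hc'
      exact ((ih coin).2 N (by have := hclock coin; omega)).1 c' hcoin
    · rw [runProb_succ]
      exact hv.trans (Finset.expect_le_expect fun coin _ =>
        ((ih coin).2 N (by have := hclock coin; omega)).2)

-- The converse passage: unrolling `N` steps of the machine gives a tree whose value is the exact
-- probability of the event.
open Classical in
theorem attains_of_support_run {T : ℕ} (E : Set (State F)) :
    ∀ (N : ℕ) (c : Config F), (∀ c' ∈ (run N c).support, c'.Halted ∧ c'.clock ≤ T) →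
      Attains (fun c w => c.Halted ∧ c.clock ≤ T ∧ w = if c.state ∈ E then 1 else 0) c
        (runProb N c {c | c.Halted ∧ c.state ∈ E}) := by
  intro N
  induction N with
  | zero =>
    intro c h
    have hc := h c (by simp [run])
    refine .here ⟨hc.1, hc.2, rfl⟩ ?_
    rw [runProb_of_halted hc.1]
    simp [hc.1]
  | succ N ih =>
    intro c h
    by_cases hc : c.Halted
    · refine .here ⟨hc, (h c (by simp [run_of_halted hc])).2, rfl⟩ ?_
      rw [runProb_of_halted hc]
      simp [hc]
    · refine .step _ hc (fun coin => ih _ fun c' hc' => h c' ?_) (runProb_succ _ _ _).le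
      exact mem_support_run_succ.2 ⟨coin, hc'⟩

/-- The supremum in `haltProb` is attained at `t`: after all runs have halted, further steps change
nothing, and fewer steps can only miss runs. -/
theorem runProb_eq_haltProb {p : Prog F} {s : State F} {t : ℕ} (h : HaltsWithin p s t)
    (E : Set (State F)) :
    runProb t ⟨[p], s, 0⟩ {c | c.Halted ∧ c.state ∈ E} = (haltProb p s E).toReal := by
  classical
  refine le_antisymm (runProb_le_haltProb _ _ _ _) ?_
  rw [haltProb, ENNReal.toReal_iSup fun t =>
    ((run_toOuterMeasure_le_one t _ _).trans_lt ENNReal.one_lt_top).ne]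
  refine ciSup_le fun N => ?_
  change runProb N _ _ ≤ _
  have key : ∀ (t : ℕ) (c : Config F), (∀ c' ∈ (run t c).support, c'.Halted) → ∀ N,
      runProb N c {c | c.Halted ∧ c.state ∈ E} ≤ runProb t c {c | c.Halted ∧ c.state ∈ E} := by
    intro t
    induction t with
    | zero =>
      intro c hc N
      have := hc c (by simp [run])
      rw [runProb_of_halted this, runProb_of_halted this]
    | succ t ih =>
      intro c hc N
      by_cases hh : c.Halted
      · rw [runProb_of_halted hh, runProb_of_halted hh]
      cases N with
      | zero => simp [runProb, run, hh, ENNReal.toReal_nonneg]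
      | succ N =>
        rw [runProb_succ, runProb_succ]
        exact Finset.expect_le_expect fun coin _ =>
          ih _ (fun c' hc' => hc c' (mem_support_run_succ.2 ⟨coin, hc'⟩)) N
  exact key t _ (fun c' hc' => (h c' hc').1) N

/-- Started with memory `s`, the program `p` surely halts within time `t` and the expectation of
the values that `P` allows for the final memory is at least `v`. -/
def Achieves (p : Prog F) (s : State F) (t : ℕ) (P : State F → ℝ → Prop) (v : ℝ) : Prop :=
  -- Arbitrary remaining programs `l` and an arbitrary initial clock `k` make the statement
  -- composable.
  ∀ l k, Attains (fun c w => c.todo = l ∧ c.clock ≤ k + t ∧ P c.state w) ⟨p :: l, s, k⟩ v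

open Classical in
theorem Achieves.haltsWithin {p : Prog F} {s : State F} {t : ℕ} {E : Set (State F)} {v : ℝ}
    (h : Achieves p s t (fun s' w => w ≤ if s' ∈ E then 1 else 0) v) :
    HaltsWithin p s t ∧ v ≤ (haltProb p s E).toReal := by
  have h' := ((h [] 0).mono (G' := fun c w => c.Halted ∧ c.clock ≤ t ∧
    w ≤ if c.state ∈ E then 1 else 0) (by
      rintro c w ⟨h1, h2, h3⟩; exact ⟨h1, by simpa using h2, h3⟩)).support_run.2 t (by simp)
  exact ⟨h'.1, h'.2.trans (runProb_le_haltProb _ _ _ _)⟩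

/-- Started with memory `s`, the program `p` surely halts within time `t` with memory in `Q`. -/
def Ensures (p : Prog F) (s : State F) (t : ℕ) (Q : State F → Prop) : Prop :=
  -- The value `v` is arbitrary, so an expectation can be carried unchanged through a program about
  -- which only sure facts are known.
  ∀ v, Achieves p s t (fun s' w => Q s' ∧ w = v) v

namespace Achieves

variable {p q : Prog F} {s : State F} {t t' t₁ t₂ : ℕ} {P Q : State F → ℝ → Prop} {v : ℝ}

theorem mono (h : Achieves p s t P v) (ht : t ≤ t') (hP : ∀ s w, P s w → Q s w) :
    Achieves p s t' Q v :=
  fun l k => (h l k).mono fun _ _ hc => ⟨hc.1, by omega, hP _ _ hc.2.2⟩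

theorem anti (h : Achieves p s t P v) {v' : ℝ} (hv : v' ≤ v) : Achieves p s t P v' :=
  fun l k => (h l k).anti hv

theorem scale (h : Achieves p s t P v) {x : ℝ} (hx : 0 ≤ x) :
    Achieves p s t (fun s w => ∃ w', P s w' ∧ w = w' * x) (v * x) :=
  fun l k => ((h l k).scale hx).mono fun _ _ ⟨w', hc, hw⟩ => ⟨hc.1, hc.2.1, w', hc.2.2, hw⟩

theorem ensures (h : Achieves p s t P v) : Ensures p s t fun s => ∃ w, P s w :=
  fun x l k => ((h l k).sure x).mono fun _ _ ⟨⟨w', hc⟩, hw⟩ => ⟨hc.1, hc.2.1, ⟨w', hc.2.2⟩, hw⟩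

theorem skip (h : P s v) : Achieves .skip s 1 P v := fun l k =>
  .step (fun _ => v) (by simp [Config.Halted])
    (fun _ => .here ⟨rfl, le_rfl, h⟩ le_rfl) (by simp)

theorem instr {i : Instr F} (u : F × Bool → ℝ) (h : ∀ coin, P (i.exec coin s) (u coin))
    (hu : v ≤ 𝔼 coin, u coin) : Achieves (.instr i) s (i.cost s) P v := fun _ _ =>
  .step u (by simp [Config.Halted]) (fun coin => .here ⟨rfl, le_rfl, h coin⟩ le_rfl) hu

theorem seq (hp : Achieves p s t₁ P v) (hq : ∀ s w, P s w → Achieves q s t₂ Q w) :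
    Achieves (.seq p q) s (t₁ + t₂ + 1) Q v := fun l k =>
  .step (fun _ => v) (by simp [Config.Halted]) (fun _ => by
    refine (hp (q :: l) (k + 1)).bind ?_
    rintro ⟨todo, s', k'⟩ w ⟨rfl, h1, h2⟩
    refine (hq s' w h2 l k').mono ?_
    rintro c w ⟨h3, h4, h5⟩
    exact ⟨h3, by simp at h1 h4; omega, h5⟩) (by simp)

theorem cond {b : Test} (h₁ : b.holds s = true → Achieves p s t P v)
    (h₂ : b.holds s = false → Achieves q s t P v) :
    Achieves (.cond b p q) s (b.cost s + t) P v := fun l k =>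
  .step (fun _ => v) (by simp [Config.Halted]) (fun _ => by
    have : Achieves (if b.holds s then p else q) s t P v := by
      cases h : b.holds s <;> simp [h, h₁, h₂]
    refine (this l (k + b.cost s)).mono ?_
    rintro c w ⟨h3, h4, h5⟩
    exact ⟨h3, by omega, h5⟩) (by simp)

theorem loop_false {b : Test} (h : b.holds s = false) (hP : P s v) :
    Achieves (.loop b p) s (b.cost s) P v := fun l k =>
  .step (fun _ => v) (by simp [Config.Halted])
    (fun _ => .here ⟨by simp [Config.next, h], le_rfl, hP⟩ le_rfl) (by simp)

theorem loop_true {b : Test} (h : b.holds s = true) (hp : Achieves p s t₁ P v)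
    (hq : ∀ s w, P s w → Achieves (.loop b p) s t₂ Q w) :
    Achieves (.loop b p) s (b.cost s + t₁ + t₂) Q v := fun l k =>
  .step (fun _ => v) (by simp [Config.Halted]) (fun _ => by
    simp only [Config.next, h, if_true]
    refine (hp _ _).bind ?_
    rintro ⟨todo, s', k'⟩ w ⟨rfl, h1, h2⟩
    refine (hq s' w h2 l k').mono ?_
    rintro c w ⟨h3, h4, h5⟩
    exact ⟨h3, by simp at h1 h4; omega, h5⟩) (by simp)

end Achieves

namespace Ensures

variable {p q : Prog F} {s : State F} {t t' t₁ t₂ : ℕ} {P Q : State F → Prop}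

theorem mono (h : Ensures p s t P) (ht : t ≤ t') (hP : ∀ s, P s → Q s) : Ensures p s t' Q :=
  fun v => (h v).mono ht fun _ _ hs => ⟨hP _ hs.1, hs.2⟩

theorem seq_achieves {R : State F → ℝ → Prop} {v : ℝ} (hp : Ensures p s t₁ P)
    (hq : ∀ s, P s → Achieves q s t₂ R v) : Achieves (.seq p q) s (t₁ + t₂ + 1) R v :=
  (hp v).seq fun s _ hs => hs.2 ▸ hq s hs.1

theorem seq (hp : Ensures p s t₁ P) (hq : ∀ s, P s → Ensures q s t₂ Q) :
    Ensures (.seq p q) s (t₁ + t₂ + 1) Q :=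
  fun v => hp.seq_achieves fun s hs => hq s hs v

theorem achieves {R : State F → ℝ → Prop} {v : ℝ} (hp : Ensures p s t P)
    (hR : ∀ s, P s → R s v) : Achieves p s t R v :=
  (hp v).mono le_rfl fun s _ hs => hs.2 ▸ hR s hs.1

theorem skip (h : P s) : Ensures .skip s 1 P := fun _ => Achieves.skip ⟨h, rfl⟩

theorem instr {i : Instr F} (h : ∀ coin, P (i.exec coin s)) :
    Ensures (.instr i) s (i.cost s) P :=
  fun v => Achieves.instr (fun _ => v) (fun coin => ⟨h coin, rfl⟩) (by simp)

theorem cond {b : Test} (h₁ : b.holds s = true → Ensures p s t P)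
    (h₂ : b.holds s = false → Ensures q s t P) :
    Ensures (.cond b p q) s (b.cost s + t) P :=
  fun v => Achieves.cond (fun h => h₁ h v) (fun h => h₂ h v)

end Ensures

open Classical in
/-- `p` surely halts within time `t` in `Inv`, and in `Good` with probability at least `v`. -/
def Succeeds (p : Prog F) (s : State F) (t : ℕ) (Inv Good : State F → Prop) (v : ℝ) : Prop :=
  Achieves p s t (fun s' w => Inv s' ∧ w = if Good s' then 1 else 0) v

namespace Succeeds

variable {p q : Prog F} {s : State F} {t t' t₁ t₂ : ℕ} {I I' G G' : State F → Prop} {v v' : ℝ}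

theorem ensures (h : Succeeds p s t I G v) : Ensures p s t I :=
  (Achieves.ensures h).mono le_rfl fun _ ⟨_, hs, _⟩ => hs

theorem mono (h : Succeeds p s t I G v) (ht : t ≤ t') (hI : ∀ s, I s → I' s)
    (hG : ∀ s, I s → G s → G' s) : Succeeds p s t' I' G' v := by
  classical
  intro l k
  refine (h l k).bind ?_
  rintro c w ⟨h1, h2, h3, h4⟩
  refine .here ⟨h1, by omega, hI _ h3, rfl⟩ ?_
  rw [h4]
  split_ifs with ha hb hb
  · exact le_rfl
  · exact absurd (hG _ h3 ha) hb
  · exact zero_le_one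
  · exact le_rfl

theorem anti (h : Succeeds p s t I G v) (hv : v' ≤ v) : Succeeds p s t I G v' :=
  Achieves.anti h hv

/-- Used on branches where success is hopeless or unknown, but the time and the invariant still have
to be controlled. -/
theorem of_ensures (h : Ensures p s t I) (hv : v ≤ 0) : Succeeds p s t I G v := by
  classical
  intro l k
  refine ((h v) l k).bind ?_
  rintro c w ⟨h1, h2, h3, h4⟩
  refine .here ⟨h1, by omega, h3, rfl⟩ ?_
  rw [h4]
  split_ifs <;> linarith

theorem of_ensures_good (h : Ensures p s t fun s => I s ∧ G s) : Succeeds p s t I G 1 :=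
  h.achieves fun s hs => ⟨hs.1, by simp [hs.2]⟩

/-- If `p` misses `G`, then `q` must still halt in `I'` but is credited with probability zero;
otherwise it contributes `v'`. The expected value is thus at least `v * v'`. -/
theorem seq (hp : Succeeds p s t₁ I G v) (hq : ∀ s, I s → Ensures q s t₂ I')
    (hq' : ∀ s, I s → G s → Succeeds q s t₂ I' G' v') (hv' : 0 ≤ v') :
    Succeeds (.seq p q) s (t₁ + t₂ + 1) I' G' (v * v') := by
  classical
  refine Achieves.seq (Achieves.scale hp hv') ?_
  rintro s w ⟨w', ⟨hI, rfl⟩, rfl⟩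
  split_ifs with hG
  · rw [one_mul]; exact hq' s hI hG
  · exact of_ensures (hq s hI) (by simp)

theorem _root_.RAM.Ensures.seq_succeeds (hp : Ensures p s t₁ I)
    (hq : ∀ s, I s → Succeeds q s t₂ I' G' v) :
    Succeeds (.seq p q) s (t₁ + t₂ + 1) I' G' v :=
  hp.seq_achieves hq

end Succeeds

/-! ### Running a given program inside a larger memory -/

/-- A bound for the names of registers and arrays in an instruction. -/
def Instr.names : Instr F → ℕ
  | .idxConst r _ => r + 1
  | .idxMove r i => r + i + 1
  | .idxArith _ r i j => r + i + j + 1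
  | .idxLen r a => r + a + 1
  | .idxGet r a i => r + a + i + 1
  | .idxSet a i r => a + i + r + 1
  | .idxPush a r => a + r + 1
  | .idxPop a => a + 1
  | .fldConst x _ => x + 1
  | .fldMove x y => x + y + 1
  | .fldArith _ x y z => x + y + z + 1
  | .fldLen r a => r + a + 1
  | .fldGet x a i => x + a + i + 1
  | .fldSet a i x => a + i + x + 1
  | .fldPush a x => a + x + 1
  | .fldPop a => a + 1
  | .flip r => r + 1
  | .sample x => x + 1

/-- A bound for the names of registers and arrays in a test. -/
def Test.names : Test → ℕ
  | .idxLt i j => i + j + 1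
  | .fldEq x y => x + y + 1
  | .idxEmpty a => a + 1
  | .fldEmpty a => a + 1

/-- A bound for the names of registers and arrays in a program. -/
def Prog.names : Prog F → ℕ
  | .skip => 0
  | .instr i => i.names
  | .seq p q => p.names + q.names
  | .cond b p q => b.names + p.names + q.names
  | .loop b p => b.names + p.names

/-- The memories agree on all names below `b`. -/
structure AgreeBelow (b : ℕ) (s₀ s : State F) : Prop where
  idx : ∀ r < b, s.idx r = s₀.idx r
  fld : ∀ r < b, s.fld r = s₀.fld r
  idxArr : ∀ a < b, s.idxArr a = s₀.idxArr a
  fldArr : ∀ a < b, s.fldArr a = s₀.fldArr a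

/-- The index registers from name `d` on and the field arrays from name `e` on are the same. -/
structure SameFrom (d e : ℕ) (s s' : State F) : Prop where
  idx : ∀ r, d ≤ r → s'.idx r = s.idx r
  arr : ∀ a, e ≤ a → s'.fldArr a = s.fldArr a

theorem SameFrom.refl (d e : ℕ) (s : State F) : SameFrom d e s s := ⟨fun _ _ => rfl, fun _ _ => rfl⟩

theorem SameFrom.trans {d e d' e' : ℕ} {s s' s'' : State F} (h : SameFrom d e s s')
    (h' : SameFrom d' e' s' s'') : SameFrom (max d d') (max e e') s s'' :=
  ⟨fun r hr => (h'.idx r (by omega)).trans (h.idx r (by omega)),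
    fun r hr => (h'.arr r (by omega)).trans (h.arr r (by omega))⟩

theorem SameFrom.mono {d e d' e' : ℕ} {s s' : State F} (h : SameFrom d e s s')
    (hd : d ≤ d') (he : e ≤ e') : SameFrom d' e' s s' :=
  ⟨fun r hr => h.idx r (by omega), fun r hr => h.arr r (by omega)⟩

/-- All arrays with names below `b` have length at most `t`. -/
def ShortBelow (b t : ℕ) (s : State F) : Prop :=
  ∀ a < b, (s.idxArr a).length ≤ t ∧ (s.fldArr a).length ≤ t

theorem update_agree {α : Type*} {b : ℕ} {f g : ℕ → α} (h : ∀ r < b, g r = f r) {x y : α} {a : ℕ}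
    (hxy : y = x) : ∀ r < b, Function.update g a y r = Function.update f a x r := by
  intro r hr
  subst hxy
  by_cases hra : r = a
  · subst hra; simp
  · simp [hra, h r hr]

theorem update_same {α : Type*} {b : ℕ} {f : ℕ → α} {x : α} {a : ℕ}
    (ha : a < b) : ∀ r, b ≤ r → Function.update f a x r = f r := by
  intro r hr
  rw [Function.update_of_ne (by omega)]

theorem Instr.exec_agree {b : ℕ} {i : Instr F} (hi : i.names ≤ b) {s₀ s : State F}
    (h : AgreeBelow b s₀ s) (coin : F × Bool) :
    AgreeBelow b (i.exec coin s₀) (i.exec coin s) ∧ i.cost s = i.cost s₀ ∧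
      SameFrom b b s (i.exec coin s) := by
  obtain ⟨h1, h2, h3, h4⟩ := h
  cases i <;> simp only [Instr.names] at hi <;>
    (refine ⟨⟨?_, ?_, ?_, ?_⟩, ?_, ⟨?_, ?_⟩⟩ <;> simp only [Instr.exec, Instr.cost] <;>
      first
      | assumption
      | exact fun _ _ => rfl
      | exact update_same (by omega)
      | (refine update_agree (by assumption) ?_
         first | rfl | simp (disch := omega) only [h1, h2, h3, h4])
      | (simp (disch := omega) only [h1, h2, h3, h4]; done)
      | exact fun _ _ => trivial)

theorem Test.holds_agree {b : ℕ} {e : Test} (he : e.names ≤ b) {s₀ s : State F}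
    (h : AgreeBelow b s₀ s) : e.holds s = e.holds s₀ ∧ e.cost s = e.cost s₀ := by
  obtain ⟨h1, h2, h3, h4⟩ := h
  cases e <;> simp only [Test.names] at he <;> simp only [Test.holds, Test.cost] <;>
    simp (disch := omega) only [h1, h2, h3, h4, and_self]

theorem update_length {α : Type*} {t t' b : ℕ} (ht : t ≤ t') {f : ℕ → List α}
    (h : ∀ a < b, (f a).length ≤ t) {a : ℕ} {l : List α}
    (hl : l.length ≤ (f a).length + (t' - t)) :
    ∀ r < b, (Function.update f a l r).length ≤ t' := by
  intro r hr
  have := h r hr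
  by_cases hra : r = a
  · subst hra; simp only [Function.update_self]; omega
  · simp only [ne_eq, hra, not_false_eq_true, Function.update_of_ne]; omega

/-- An instruction lengthens an array by at most one element and costs at least one. Hence the
running time bounds what a call leaves behind, and so the time for clearing it. -/
theorem Instr.exec_short {b t : ℕ} (i : Instr F) {s : State F} (h : ShortBelow b t s)
    (coin : F × Bool) : ShortBelow b (t + i.cost s) (i.exec coin s) := by
  have h1 : ∀ a < b, (s.idxArr a).length ≤ t := fun a ha => (h a ha).1
  have h2 : ∀ a < b, (s.fldArr a).length ≤ t := fun a ha => (h a ha).2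
  have hc := i.cost_pos s
  generalize i.cost s = x at hc
  suffices (∀ a < b, ((i.exec coin s).idxArr a).length ≤ t + x) ∧
      ∀ a < b, ((i.exec coin s).fldArr a).length ≤ t + x from
    fun a ha => ⟨this.1 a ha, this.2 a ha⟩
  cases i <;> simp only [Instr.exec] <;> constructor <;>
    first
    | exact fun a ha => (h1 a ha).trans (by omega)
    | exact fun a ha => (h2 a ha).trans (by omega)
    | (refine update_length (Nat.le_add_right t x) (by assumption) ?_
       simp
       try omega)

/-- The configuration `c` simulates `c₀`: it behaves like `c₀` on names below `b`, does not change
anything else, and has the programs `l` still to execute afterwards. -/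
structure Simulates (b : ℕ) (l : List (Prog F)) (k B : ℕ) (s : State F) (c₀ c : Config F) :
    Prop where
  todo : c.todo = c₀.todo ++ l
  names : ∀ p ∈ c₀.todo, p.names ≤ b
  clock : c.clock = k + c₀.clock
  agree : AgreeBelow b c₀.state c.state
  same : SameFrom b b s c.state
  short : ShortBelow b (B + c₀.clock) c.state

/-- Both configurations proceed in lockstep: tests and costs depend only on names below `b`, on
which the memories agree, and the remaining programs `l` are never inspected before `c₀` halts. -/
theorem Simulates.next {b k B : ℕ} {l : List (Prog F)} {s : State F} {c₀ c : Config F}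
    (h : Simulates b l k B s c₀ c) (hc : ¬ c₀.Halted) (coin : F × Bool) :
    ¬ c.Halted ∧ Simulates b l k B s (c₀.next coin) (c.next coin) := by
  obtain ⟨todo₀, s₀, k₀⟩ := c₀
  obtain ⟨todo, s', k'⟩ := c
  obtain ⟨h1, h2, h3, h4, h5, h6⟩ := h
  simp only at h1 h2 h3 h4 h5 h6
  subst h1 h3
  have hlen : ∀ x, ShortBelow b (B + (k₀ + x)) s' := fun x a ha =>
    ⟨(h6 a ha).1.trans (by omega), (h6 a ha).2.trans (by omega)⟩
  match todo₀ with
  | [] => exact absurd rfl hc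
  | p :: m =>
    have hp : p.names ≤ b := h2 p (by simp)
    have hm : ∀ p ∈ m, p.names ≤ b := fun p hp => h2 p (by simp [hp])
    refine ⟨by simp [Config.Halted], ?_⟩
    cases p with
    | skip => exact ⟨rfl, hm, by simp [Config.next]; omega, h4, h5, hlen 1⟩
    | instr i =>
      obtain ⟨h7, h8, h9⟩ := i.exec_agree hp h4 coin
      refine ⟨rfl, hm, ?_, h7, ?_, ?_⟩
      · simp only [Config.next, List.cons_append, h8]; omega
      · exact (h5.trans h9).mono (by omega) (by omega)
      · simp only [Config.next, ← h8, ← Nat.add_assoc, List.cons_append]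
        exact i.exec_short h6 coin
    | seq p q =>
      simp only [Prog.names] at hp
      refine ⟨rfl, ?_, by simp [Config.next]; omega, h4, h5, hlen 1⟩
      intro r hr
      simp only [Config.next, List.mem_cons] at hr
      rcases hr with rfl | rfl | hr
      · omega
      · omega
      · exact hm r hr
    | cond e p q =>
      simp only [Prog.names] at hp
      obtain ⟨h7, h8⟩ := e.holds_agree (by omega) h4
      refine ⟨?_, ?_, ?_, h4, h5, hlen _⟩
      · simp [Config.next, h7]
      · intro r hr
        simp only [Config.next, List.mem_cons] at hr
        rcases hr with rfl | hr
        · split_ifs <;> omega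
        · exact hm r hr
      · simp only [Config.next, List.cons_append, h8]; omega
    | loop e p =>
      have hp' := hp
      simp only [Prog.names] at hp
      obtain ⟨h7, h8⟩ := e.holds_agree (by omega) h4
      refine ⟨?_, ?_, ?_, h4, h5, hlen _⟩
      · simp only [Config.next, h7, List.cons_append]
        split_ifs <;> simp
      · intro r hr
        simp only [Config.next] at hr
        split_ifs at hr
        · simp only [List.mem_cons] at hr
          rcases hr with rfl | rfl | hr
          · omega
          · exact hp'
          · exact hm r hr
        · exact hm r hr
      · simp only [Config.next, List.cons_append, h8]; omega

theorem Attains.simulate {b k B : ℕ} {l : List (Prog F)} {s : State F} {c₀ c : Config F}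
    {G : Config F → ℝ → Prop} {v : ℝ} (h : Attains G c₀ v) (hc : Simulates b l k B s c₀ c) :
    Attains (fun c w => ∃ c₀, G c₀ w ∧ Simulates b l k B s c₀ c) c v := by
  induction h generalizing c with
  | here hg hv => exact .here ⟨_, hg, hc⟩ hv
  | step u hu _ hv ih =>
    exact .step u (hc.next hu (0, false)).1 (fun coin => ih coin (hc.next hu coin).2) hv

/-- A program that halts from `s₀` behaves in the same way from a memory `s` that agrees with `s₀`
on the names in the program. -/
theorem HaltsWithin.succeeds {p : Prog F} {s₀ s : State F} {t b B : ℕ} (h : HaltsWithin p s₀ t)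
    (hb : p.names ≤ b) (hs : AgreeBelow b s₀ s) (hB : ShortBelow b B s) (E : Set (State F)) :
    Succeeds p s t (fun s' => SameFrom b b s s' ∧ ShortBelow b (B + t) s' ∧
        ∃ s₀', AgreeBelow b s₀' s')
      (fun s' => ∃ s₀' ∈ E, AgreeBelow b s₀' s') (haltProb p s₀ E).toReal := by
  classical
  intro l k
  have h1 := (attains_of_support_run E t ⟨[p], s₀, 0⟩ h).simulate (c := ⟨p :: l, s, k⟩)
    (b := b) (l := l) (k := k) (B := B) (s := s)
    ⟨rfl, by simpa using hb, rfl, hs, .refl _ _ _, hB⟩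
  rw [runProb_eq_haltProb h] at h1
  refine h1.bind ?_
  rintro c w ⟨c₀, ⟨h2, h3, rfl⟩, h4⟩
  refine .here ⟨?_, ?_, ⟨h4.same, fun a ha => ?_, _, h4.agree⟩, rfl⟩ ?_
  · rw [h4.todo, show c₀.todo = [] from h2, List.nil_append]
  · rw [h4.clock]; omega
  · have := h4.short a ha
    omega
  · split_ifs with h5 h6 h6
    · exact le_rfl
    · exact absurd ⟨_, h5, h4.agree⟩ h6
    · exact zero_le_one
    · exact le_rfl

end RAM

/-! ## Resampling a part of a random object -/

section Lens

variable {Ω Z : Type*}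

/-- `get` reads a part of an object and `put` replaces it. -/
structure IsLens (get : Ω → Z) (put : Z → Ω → Ω) : Prop where
  get_put : ∀ z x, get (put z x) = z
  put_get : ∀ x, put (get x) x = x
  put_put : ∀ z z' x, put z (put z' x) = put z x

variable [Fintype Ω] [Nonempty Ω] [Fintype Z] [Nonempty Z]

/-- The map `(z, x) ↦ (get x, put z x)` is an involution of `Z × Ω`, so overwriting the part by an
independent uniform `z` preserves the uniform distribution. -/
theorem IsLens.expect_put {get : Ω → Z} {put : Z → Ω → Ω} (h : IsLens get put) (φ : Ω → ℝ) :
    𝔼 z, 𝔼 x, φ (put z x) = 𝔼 x, φ x := by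
  have hinv : Function.Involutive fun zx : Z × Ω => (get zx.2, put zx.1 zx.2) := by
    rintro ⟨z, x⟩
    simp [h.get_put, h.put_get, h.put_put]
  have h1 : 𝔼 zx : Z × Ω, φ (put zx.1 zx.2) = 𝔼 zx : Z × Ω, φ zx.2 :=
    Fintype.expect_equiv hinv.toPerm _ _ fun _ => rfl
  rw [← Finset.univ_product_univ, Finset.expect_product, Finset.expect_product] at h1
  simpa using h1

theorem IsLens.expect_get {get : Ω → Z} {put : Z → Ω → Ω} (h : IsLens get put) (φ : Z → ℝ) :
    𝔼 x, φ (get x) = 𝔼 z, φ z := by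
  rw [← h.expect_put]
  simp [h.get_put]

-- Pointwise, `f` is at most the indicator that no part is bad plus the sum over `i` of `f` times
-- the indicator that part `i` is bad. The first expectation factors by independence of the parts;
-- each of the other terms is at most `δ` by resampling the part in question.
open Classical in
theorem expect_le_of_independent_parts {k : ℕ} {get : ℕ → Ω → Z} {put : ℕ → Z → Ω → Ω}
    (h : ∀ i < k, IsLens (get i) (put i))
    (hne : ∀ i < k, ∀ j < k, i ≠ j → ∀ z x, get i (put j z x) = get i x)
    {f : Ω → ℝ} (hf₀ : ∀ x, 0 ≤ f x) (hf₁ : ∀ x, f x ≤ 1) {δ : ℝ} (hδ : 0 ≤ δ) (bad : Z → Prop)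
    (hbad : ∀ z, bad z → ∀ i < k, 𝔼 x, f (put i z x) ≤ δ) :
    𝔼 x, f x ≤ (1 - 𝔼 z, if bad z then 1 else 0) ^ k + k * δ := by
  have hprod : ∀ j ≤ k, 𝔼 x, ∏ i ∈ Finset.range j, (1 - if bad (get i x) then 1 else 0 : ℝ) =
      (1 - 𝔼 z, if bad z then 1 else 0) ^ j := by
    intro j
    induction j with
    | zero => intro _; simp
    | succ j ih =>
      intro hj
      -- Resampling part `j` affects only the last factor, by `hne`, so this factor splits off.
      rw [← (h j (by omega)).expect_put]
      have : ∀ z x, (∏ i ∈ Finset.range (j + 1),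
          (1 - if bad (get i (put j z x)) then 1 else 0 : ℝ)) =
          (1 - if bad z then 1 else 0 : ℝ) *
            ∏ i ∈ Finset.range j, (1 - if bad (get i x) then 1 else 0 : ℝ) := by
        intro z x
        rw [Finset.prod_range_succ, (h j (by omega)).get_put, mul_comm]
        congr 1
        refine Finset.prod_congr rfl fun i hi => ?_
        have := Finset.mem_range.1 hi
        rw [hne i (by omega) j (by omega) (by omega)]
      simp_rw [this, ← Finset.mul_expect, ih (by omega), ← Finset.expect_mul]
      rw [Finset.expect_sub_distrib, Fintype.expect_const, pow_succ, mul_comm]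
  have hsum : ∀ i < k, 𝔼 x, f x * (if bad (get i x) then 1 else 0) ≤ δ := by
    intro i hi
    rw [← (h i hi).expect_put, ← Fintype.expect_const (ι := Z) δ]
    refine Finset.expect_le_expect fun z _ => ?_
    simp_rw [(h i hi).get_put, ← Finset.expect_mul]
    split_ifs with hz
    · simpa using hbad z hz i hi
    · simpa using hδ
  have hpt : ∀ x, f x ≤ ∏ i ∈ Finset.range k, (1 - if bad (get i x) then 1 else 0 : ℝ) +
      ∑ i ∈ Finset.range k, f x * (if bad (get i x) then 1 else 0) := by
    intro x
    have h0 : ∀ i ∈ Finset.range k, 0 ≤ f x * (if bad (get i x) then 1 else 0) := by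
      intro i _
      split_ifs <;> simp [hf₀]
    by_cases hx : ∃ i ∈ Finset.range k, bad (get i x)
    · obtain ⟨i, hi, hix⟩ := hx
      have h1 := Finset.single_le_sum h0 hi
      have h2 : 0 ≤ ∏ i ∈ Finset.range k, (1 - if bad (get i x) then 1 else 0 : ℝ) :=
        Finset.prod_nonneg fun i _ => by split_ifs <;> simp
      simp only [hix, if_true, mul_one] at h1
      linarith
    · push Not at hx
      rw [Finset.prod_congr rfl (g := fun _ => 1) fun i hi => by simp [hx i hi]]
      have := Finset.sum_nonneg h0
      have := hf₁ x
      simp only [Finset.prod_const_one]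
      linarith
  calc 𝔼 x, f x ≤ 𝔼 x, (∏ i ∈ Finset.range k, (1 - if bad (get i x) then 1 else 0 : ℝ) +
      ∑ i ∈ Finset.range k, f x * (if bad (get i x) then 1 else 0)) :=
        Finset.expect_le_expect fun x _ => hpt x
    _ = (1 - 𝔼 z, if bad z then 1 else 0) ^ k +
        ∑ i ∈ Finset.range k, 𝔼 x, f x * (if bad (get i x) then 1 else 0) := by
        rw [Finset.expect_add_distrib, hprod k le_rfl, Finset.expect_sum_comm]
    _ ≤ _ := by
        gcongr
        refine (Finset.sum_le_sum fun i hi => hsum i (Finset.mem_range.1 hi)).trans ?_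
        simp

/-- If `f` has expectation at least `ε`, then most parts `z` are good: put into one of the `k`
places, the expectation of `f` is not too small. -/
theorem expect_bad_le {k : ℕ} {get : ℕ → Ω → Z} {put : ℕ → Z → Ω → Ω}
    (h : ∀ i < k, IsLens (get i) (put i))
    (hne : ∀ i < k, ∀ j < k, i ≠ j → ∀ z x, get i (put j z x) = get i x)
    {f : Ω → ℝ} (hf₀ : ∀ x, 0 ≤ f x) (hf₁ : ∀ x, f x ≤ 1) {ε : ℝ} (hε : 0 < ε)
    (hf : ε ≤ 𝔼 x, f x) (hk : (7 / 8 : ℝ) ^ k ≤ ε / 4) (bad : Z → Prop) [DecidablePred bad]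
    (hbad : ∀ z, bad z → ∀ i < k, 𝔼 x, f (put i z x) ≤ ε / (4 * k)) :
    𝔼 z, (if bad z then 1 else 0 : ℝ) ≤ 1 / 8 := by
  by_contra! hlt
  have h1 := expect_le_of_independent_parts h hne hf₀ hf₁ (by positivity) bad hbad
  have h2 : 𝔼 z, (if bad z then 1 else 0 : ℝ) ≤ 1 := by
    rw [← Fintype.expect_const (ι := Z) (1 : ℝ)]
    exact Finset.expect_le_expect fun z _ => by split_ifs <;> simp
  have h3 : (k : ℝ) * (ε / (4 * k)) ≤ ε / 4 := by
    rcases Nat.eq_zero_or_pos k with rfl | hk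
    · simp; positivity
    · field_simp; exact le_rfl
  have h4 : (1 - 𝔼 z, (if bad z then 1 else 0 : ℝ)) ^ k ≤ (7 / 8) ^ k :=
    pow_le_pow_left₀ (by linarith) (by linarith) k
  -- The two sides differ only in the decidability instance.
  have h5 : 𝔼 z, (if bad z then 1 else 0 : ℝ) = 𝔼 z, @ite ℝ (bad z) (Classical.dec _) 1 0 :=
    Finset.expect_congr rfl fun z _ => by congr
  rw [h5] at h4
  linarith

end Lens

/-! ## Windows of matrices -/

section Window

variable {F : Type*} [Field F] {n m : ℕ}

/-- The `m` rows from row `σ` on. -/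
def getRows (m σ : ℕ) (X : Matrix (Fin n) (Fin n) F) : Fin m → Fin n → F :=
  fun u j => if h : σ + u < n then X ⟨σ + u, h⟩ j else 0

/-- Replace the `m` rows from row `σ` on. -/
def putRows (σ : ℕ) (a : Fin m → Fin n → F) (X : Matrix (Fin n) (Fin n) F) :
    Matrix (Fin n) (Fin n) F :=
  fun t j => if h : σ ≤ t ∧ t < σ + m then a ⟨t - σ, by omega⟩ j else X t j

theorem isLens_rows {σ : ℕ} (hσ : σ + m ≤ n) :
    IsLens (getRows (F := F) (n := n) m σ) (putRows σ) where
  get_put a X := by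
    ext u j
    simp [getRows, putRows, show σ + (u : ℕ) < n by omega]
  put_get X := by
    ext t j
    simp only [getRows, putRows]
    split_ifs with h1 h2
    · congr 1; ext; simp; omega
    · simp at h2; omega
    · rfl
  put_put a b X := by
    ext t j
    simp only [putRows]
    split_ifs <;> rfl

theorem getRows_putRows_of_disjoint {σ τ : ℕ} (h : σ + m ≤ τ ∨ τ + m ≤ σ)
    (a : Fin m → Fin n → F) (X : Matrix (Fin n) (Fin n) F) :
    getRows m σ (putRows τ a X) = getRows m σ X := by
  ext u j
  simp only [getRows, putRows]
  split_ifs with h1 h2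
  · omega
  · rfl
  · rfl

/-- The rows of the first matrix from row `σ` on and the columns of the second matrix from
column `τ` on. -/
def getStrips (m σ τ : ℕ) (X : Matrix (Fin n) (Fin n) F × Matrix (Fin n) (Fin n) F) :
    (Fin m → Fin n → F) × (Fin m → Fin n → F) :=
  (getRows m σ X.1, getRows m τ X.2.transpose)

/-- Replace the rows of the first matrix from row `σ` on and the columns of the second matrix from
column `τ` on. -/
def putStrips (σ τ : ℕ) (z : (Fin m → Fin n → F) × (Fin m → Fin n → F))
    (X : Matrix (Fin n) (Fin n) F × Matrix (Fin n) (Fin n) F) :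
    Matrix (Fin n) (Fin n) F × Matrix (Fin n) (Fin n) F :=
  (putRows σ z.1 X.1, (putRows τ z.2 X.2.transpose).transpose)

theorem isLens_strips {σ τ : ℕ} (hσ : σ + m ≤ n) (hτ : τ + m ≤ n) :
    IsLens (getStrips (F := F) (n := n) m σ τ) (putStrips σ τ) where
  get_put z X := by
    simp [getStrips, putStrips, (isLens_rows (F := F) hσ).get_put, (isLens_rows (F := F) hτ).get_put]
  put_get X := by
    simp [getStrips, putStrips, (isLens_rows (F := F) hσ).put_get, (isLens_rows (F := F) hτ).put_get]
  put_put z z' X := by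
    simp [putStrips, (isLens_rows (F := F) hσ).put_put, (isLens_rows (F := F) hτ).put_put]

variable [Fintype F] [DecidableEq F]

/-- Most splittings of `A` and `B` into two summands have good strips only. -/
theorem half_le_expect_split {σ τ : ℕ} (hσ : σ + m ≤ n) (hτ : τ + m ≤ n)
    (good : (Fin m → Fin n → F) × (Fin m → Fin n → F) → Prop) [DecidablePred good]
    (hgood : 𝔼 z, (if ¬ good z then 1 else 0 : ℝ) ≤ 1 / 8) (A B : Matrix (Fin n) (Fin n) F) :
    1 / 2 ≤ 𝔼 A₁, 𝔼 B₁, (if good (getStrips m σ τ (A₁, B₁)) ∧ good (getStrips m σ τ (A₁, B - B₁)) ∧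
      good (getStrips m σ τ (A - A₁, B₁)) ∧ good (getStrips m σ τ (A - A₁, B - B₁))
        then 1 else 0 : ℝ) := by
  -- As `X ↦ A - X` is a permutation, each of the four pairs of summands is uniform by itself,
  -- although the four are dependent. The union bound then loses `4 * (1/8) = 1/2`.
  have key : ∀ e : Equiv.Perm (Matrix (Fin n) (Fin n) F × Matrix (Fin n) (Fin n) F),
      𝔼 X, (if ¬ good (getStrips m σ τ (e X)) then 1 else 0 : ℝ) ≤ 1 / 8 := by
    intro e
    rw [Fintype.expect_equiv e _
      (fun X => (if ¬ good (getStrips m σ τ X) then 1 else 0 : ℝ)) fun _ => rfl,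
      (isLens_strips hσ hτ).expect_get fun z => (if ¬ good z then 1 else 0 : ℝ)]
    exact hgood
  have h1 : 𝔼 X : Matrix (Fin n) (Fin n) F × Matrix (Fin n) (Fin n) F,
      (if ¬ good (getStrips m σ τ (X.1, X.2)) then 1 else 0 : ℝ) ≤ 1 / 8 := key (Equiv.refl _)
  have h2 := key ((Equiv.refl _).prodCongr (Equiv.subLeft B))
  have h3 := key ((Equiv.subLeft A).prodCongr (Equiv.refl _))
  have h4 := key ((Equiv.subLeft A).prodCongr (Equiv.subLeft B))
  rw [← Finset.expect_product', Finset.univ_product_univ]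
  have h5 : 𝔼 X : Matrix (Fin n) (Fin n) F × Matrix (Fin n) (Fin n) F, (1 : ℝ) = 1 :=
    Fintype.expect_const _
  have h6 : ∀ X : Matrix (Fin n) (Fin n) F × Matrix (Fin n) (Fin n) F, (1 : ℝ) ≤
      (if good (getStrips m σ τ (X.1, X.2)) ∧ good (getStrips m σ τ (X.1, B - X.2)) ∧
      good (getStrips m σ τ (A - X.1, X.2)) ∧ good (getStrips m σ τ (A - X.1, B - X.2))
        then 1 else 0 : ℝ) +
      (if ¬ good (getStrips m σ τ (X.1, X.2)) then 1 else 0 : ℝ) +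
      (if ¬ good (getStrips m σ τ (X.1, B - X.2)) then 1 else 0 : ℝ) +
      (if ¬ good (getStrips m σ τ (A - X.1, X.2)) then 1 else 0 : ℝ) +
      (if ¬ good (getStrips m σ τ (A - X.1, B - X.2)) then 1 else 0 : ℝ) := by
    intro X
    by_cases a : good (getStrips m σ τ (X.1, X.2)) <;>
    by_cases b : good (getStrips m σ τ (X.1, B - X.2)) <;>
    by_cases c : good (getStrips m σ τ (A - X.1, X.2)) <;>
    by_cases d : good (getStrips m σ τ (A - X.1, B - X.2)) <;> simp [a, b, c, d] <;> norm_num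
  have h7 := Finset.expect_le_expect fun X (_ : X ∈ Finset.univ) => h6 X
  rw [h5] at h7
  simp only [Finset.expect_add_distrib] at h7
  simp only [Equiv.refl_apply, Equiv.prodCongr_apply, Prod.map, Equiv.subLeft_apply] at h2 h3 h4
  linarith

/-- Freivalds' check. -/
theorem expect_mulVec_eq_zero_le {D : Matrix (Fin n) (Fin n) F} (hD : D ≠ 0) :
    𝔼 v, (if D.mulVec v = 0 then 1 else 0 : ℝ) ≤ 1 / 2 := by
  -- At most one of `v` and `v + v₀` lies in the kernel, and both are uniform.
  obtain ⟨v₀, hv₀⟩ : ∃ v₀, D.mulVec v₀ ≠ 0 := by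
    by_contra! h
    exact hD (Matrix.ext_of_mulVec_single fun i => by rw [h, Matrix.zero_mulVec])
  have h1 : 𝔼 v, (if D.mulVec (v + v₀) = 0 then 1 else 0 : ℝ) =
      𝔼 v, (if D.mulVec v = 0 then 1 else 0 : ℝ) :=
    Fintype.expect_equiv (Equiv.addRight v₀) _ _ fun _ => rfl
  have h2 : 𝔼 v, ((if D.mulVec v = 0 then 1 else 0 : ℝ) +
      if D.mulVec (v + v₀) = 0 then 1 else 0) ≤ 1 := by
    rw [← Fintype.expect_const (ι := Fin n → F) (1 : ℝ)]
    refine Finset.expect_le_expect fun v _ => ?_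
    rw [Matrix.mulVec_add]
    by_cases h : D.mulVec v = 0
    · simp [h, hv₀]
    · simp only [h, if_false, zero_add]
      split_ifs <;> simp
  rw [Finset.expect_add_distrib, h1] at h2
  linarith

end Window

/-! ## Building blocks of programs -/

namespace RAM

variable {F : Type*} [Field F] [Fintype F] [DecidableEq F]

/-- The instruction does not use randomness. -/
def Instr.IsDet : Instr F → Prop
  | .flip _ => False
  | .sample _ => False
  | _ => True

theorem Instr.IsDet.exec_eq {i : Instr F} (hi : i.IsDet) (coin : F × Bool) (s : State F) :
    i.exec coin s = i.exec (0, false) s := by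
  cases i <;> first | rfl | exact hi.elim

/-- Execute instructions one after the other. -/
def straight : List (Instr F) → Prog F
  | [] => .skip
  | i :: l => .seq (.instr i) (straight l)

/-- The effect of deterministic instructions. -/
def execAll : List (Instr F) → State F → State F
  | [], s => s
  | i :: l, s => execAll l (i.exec (0, false) s)

/-- The time for deterministic instructions. -/
def costAll : List (Instr F) → State F → ℕ
  | [], _ => 1
  | i :: l, s => i.cost s + costAll l (i.exec (0, false) s) + 1

theorem ensures_straight {l : List (Instr F)} (hl : ∀ i ∈ l, i.IsDet) (s : State F) :
    Ensures (straight l) s (costAll l s) fun s' => s' = execAll l s := by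
  induction l generalizing s with
  | nil => exact Ensures.skip rfl
  | cons i l ih =>
    refine Ensures.seq (P := fun s' => s' = i.exec (0, false) s)
      (Ensures.instr fun coin => (hl i (by simp)).exec_eq coin s) ?_
    rintro s' rfl
    exact ih (fun i hi => hl i (by simp [hi])) _

/-- Count the register `r` down to zero, executing `body` each time; the registers `z` and `o` hold
the numbers zero and one. -/
def countdown (z o r : ℕ) (body : Prog F) : Prog F :=
  .loop (.idxLt z r) (.seq (.instr (.idxArith .minus r r o)) body)

/-- The invariant `J j` refers to `j` remaining rounds; the body starts after the counter has been
lowered to `j`. The overhead of a round is `β + 1` for the test, `3 * β + 1` for the decrement and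
one for the sequencing. -/
theorem Achieves.countdown {z o r N β t : ℕ} {body : Prog F} {J : ℕ → State F → ℝ → Prop}
    (h1 : 1 ≤ β) (hβ : ∀ x ≤ N, x.size ≤ β)
    (hJ : ∀ j s w, J j s w → s.idx z = 0 ∧ s.idx o = 1 ∧ s.idx r = j)
    (hbody : ∀ j < N, ∀ s w, J (j + 1) s w →
      Achieves body { s with idx := Function.update s.idx r j } t (J j) w)
    (j : ℕ) (hj : j ≤ N) (s : State F) (w : ℝ) (h : J j s w) :
    Achieves (countdown z o r body) s (j * (t + 4 * β + 3) + β + 1) (J 0) w := by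
  induction j generalizing s w with
  | zero =>
    obtain ⟨hz, ho, hr⟩ := hJ _ _ _ h
    refine (Achieves.loop_false (by simp [Test.holds, hz, hr]) h).mono ?_ fun _ _ h => h
    simp [Test.cost, hz, hr]
  | succ j ih =>
    obtain ⟨hz, ho, hr⟩ := hJ _ _ _ h
    have h2 := hβ j (by omega)
    have h3 := hβ (j + 1) hj
    have hstep : Ensures (.instr (.idxArith .minus r r o)) s (1 + 3 * β) fun s' =>
        s' = { s with idx := Function.update s.idx r j } := by
      refine (Ensures.instr fun _ => ?_).mono ?_ fun _ hs => hs
      · simp [Instr.exec, hr, ho, IdxOp.eval]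
      · simp only [Instr.cost, hr, ho, IdxOp.eval, Nat.add_sub_cancel, Nat.size_one]
        omega
    refine (Achieves.loop_true (by simp [Test.holds, hz, hr])
      (hstep.seq_achieves fun s' hs' => hs' ▸ hbody j (by omega) s w h)
      (fun s' w' h' => ih (by omega) s' w' h')).mono ?_ fun _ _ h => h
    simp only [Test.cost, hz, hr, Nat.size_zero, add_mul, one_mul]
    omega

theorem Ensures.countdown {z o r N β t : ℕ} {body : Prog F} {J : ℕ → State F → Prop}
    (h1 : 1 ≤ β) (hβ : ∀ x ≤ N, x.size ≤ β)
    (hJ : ∀ j s, J j s → s.idx z = 0 ∧ s.idx o = 1 ∧ s.idx r = j)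
    (hbody : ∀ j < N, ∀ s, J (j + 1) s →
      Ensures body { s with idx := Function.update s.idx r j } t (J j))
    (j : ℕ) (hj : j ≤ N) (s : State F) (h : J j s) :
    Ensures (countdown z o r body) s (j * (t + 4 * β + 3) + β + 1) (J 0) := by
  intro v
  exact Achieves.countdown (J := fun j s w => J j s ∧ w = v) h1 hβ (fun j s w h => hJ j s h.1)
    (fun j hj s w h => h.2 ▸ hbody j hj s h.1 w) j hj s v ⟨h, rfl⟩

/-- The memory `s'` arises from `s` by writing `l` into the field array `a`, and possibly changing
field registers and the index registers below `d`. -/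
structure Writes (d a : ℕ) (l : List F) (s s' : State F) : Prop where
  idx : ∀ r, d ≤ r → s'.idx r = s.idx r
  fldArr : s'.fldArr = Function.update s.fldArr a l
  idxArr : s'.idxArr = s.idxArr

theorem Writes.trans {d d' a : ℕ} {l l' : List F} {s s' s'' : State F} (h : Writes d a l s s')
    (h' : Writes d' a l' s' s'') : Writes (max d d') a l' s s'' :=
  ⟨fun r hr => (h'.idx r (by omega)).trans (h.idx r (by omega)),
    by rw [h'.fldArr, h.fldArr, Function.update_idem], h'.idxArr.trans h.idxArr⟩

theorem Writes.mono {d d' a : ℕ} {l : List F} {s s' : State F} (h : Writes d a l s s')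
    (hd : d ≤ d') : Writes d' a l s s' :=
  ⟨fun r hr => h.idx r (by omega), h.fldArr, h.idxArr⟩

theorem Writes.self {d a : ℕ} {l : List F} {s s' : State F} (h : Writes d a l s s') :
    s'.fldArr a = l := by simp [h.fldArr]

theorem Writes.other {d a b : ℕ} {l : List F} {s s' : State F} (h : Writes d a l s s')
    (hb : b ≠ a) : s'.fldArr b = s.fldArr b := by simp [h.fldArr, hb]

theorem Writes.sameFrom {d a : ℕ} {l : List F} {s s' : State F} (h : Writes d a l s s') :
    SameFrom d (a + 1) s s' :=
  ⟨h.idx, fun b hb => h.other (by omega)⟩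

/-- The register `K + 26` holds zero and the register `K + 27` holds one. -/
structure HasUnits (K : ℕ) (s : State F) : Prop where
  zero : s.idx (K + 26) = 0
  one : s.idx (K + 27) = 1

theorem HasUnits.of_idx {K d : ℕ} {s s' : State F} (h : HasUnits K s)
    (hd : ∀ r, d ≤ r → s'.idx r = s.idx r) (hK : d ≤ K + 26 := by omega) : HasUnits K s' :=
  ⟨(hd _ (by omega)).trans h.zero, (hd _ (by omega)).trans h.one⟩

/-- Empty the field array `a`. -/
def clearFld (K a : ℕ) : Prog F :=
  -- A loop runs while a test holds, and emptiness cannot be negated. Register `0` therefore serves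
  -- as a flag that is one until the array is found empty.
  .seq (.instr (.idxMove 0 (K + 27))) (.loop (.idxLt (K + 26) 0)
    (.cond (.fldEmpty a) (.instr (.idxConst 0 0)) (.instr (.fldPop a))))

/-- Empty the index array `a`. -/
def clearIdx (K a : ℕ) : Prog F :=
  .seq (.instr (.idxMove 0 (K + 27))) (.loop (.idxLt (K + 26) 0)
    (.cond (.idxEmpty a) (.instr (.idxConst 0 0)) (.instr (.idxPop a))))

theorem ensures_loop_false {b : Test} {p : Prog F} {s : State F} {Q : State F → Prop}
    (h : b.holds s = false) (hQ : Q s) : Ensures (.loop b p) s (b.cost s) Q :=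
  fun _ => Achieves.loop_false h ⟨hQ, rfl⟩

theorem ensures_loop_true {b : Test} {p : Prog F} {s : State F} {P Q : State F → Prop} {t₁ t₂ : ℕ}
    (h : b.holds s = true) (hp : Ensures p s t₁ P) (hq : ∀ s, P s → Ensures (.loop b p) s t₂ Q) :
    Ensures (.loop b p) s (b.cost s + t₁ + t₂) Q :=
  fun v => Achieves.loop_true h (hp v) fun s _ hs => hs.2 ▸ hq s hs.1 v

theorem ensures_clearFld {K a : ℕ} {s : State F} (hs : HasUnits K s) :
    Ensures (clearFld K a) s (4 * (s.fldArr a).length + 10) (Writes 1 a [] s) := by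
  have loop : ∀ (j : ℕ) (s : State F), HasUnits K s → s.idx 0 = 1 → (s.fldArr a).length = j →
      Ensures (.loop (.idxLt (K + 26) 0)
        (.cond (.fldEmpty a) (.instr (.idxConst 0 0)) (.instr (.fldPop a)))) s (4 * j + 5)
        (Writes 1 a [] s) := by
    intro j
    induction j with
    | zero =>
      intro s hs h0 hj
      have hnil : s.fldArr a = [] := List.length_eq_zero_iff.1 hj
      refine (ensures_loop_true (t₁ := 2) (t₂ := 1)
        (P := fun s' => s' = { s with idx := Function.update s.idx 0 0 })
        (by simp [Test.holds, hs.zero, h0]) ?_ ?_).mono (by simp [Test.cost, hs.zero, h0])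
        fun _ h => h
      · refine (Ensures.cond (t := 1) (fun _ => ?_) fun h => ?_).mono (by simp [Test.cost])
          fun _ h => h
        · exact (Ensures.instr fun _ => rfl).mono (by simp [Instr.cost]) fun _ h => h
        · simp [Test.holds, hnil] at h
      · rintro s' rfl
        have hz := hs.zero
        refine (ensures_loop_false (by simp [Test.holds, hz]) ?_).mono
          (by simp [Test.cost, hz]) fun _ h => h
        exact ⟨fun r hr => by simp [show r ≠ 0 by omega], by simp [← hnil], rfl⟩
    | succ j ih =>
      intro s hs h0 hj
      refine (ensures_loop_true (t₁ := 2) (t₂ := 4 * j + 5)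
        (P := fun s' => s' = { s with fldArr := Function.update s.fldArr a (s.fldArr a).dropLast })
        (by simp [Test.holds, hs.zero, h0]) ?_ ?_).mono (by simp [Test.cost, hs.zero, h0]; omega)
        fun _ h => h
      · refine (Ensures.cond (t := 1) (fun h => ?_) fun h => ?_).mono (by simp [Test.cost])
          fun _ h => h
        · simp only [Test.holds, List.isEmpty_iff] at h
          simp [h] at hj
        · exact (Ensures.instr fun _ => rfl).mono (by simp [Instr.cost]) fun _ h => h
      · rintro s' rfl
        refine (ih { s with fldArr := Function.update s.fldArr a (s.fldArr a).dropLast }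
          ⟨hs.zero, hs.one⟩ h0 (by simp [hj])).mono le_rfl fun s'' h => ?_
        exact ⟨h.idx, by rw [h.fldArr, Function.update_idem], h.idxArr⟩
  refine (Ensures.seq (P := fun s' => s' = { s with idx := Function.update s.idx 0 1 })
    (t₁ := 2) (t₂ := 4 * (s.fldArr a).length + 5) ?_ ?_).mono (by omega) fun _ h => h
  · refine (Ensures.instr fun _ => ?_).mono ?_ fun _ h => h
    · simp [Instr.exec, hs.one]
    · simp [Instr.cost, hs.one]
  · rintro s' rfl
    refine (loop _ _ (hs.of_idx (d := 1) fun r hr => ?_) (by simp) rfl).mono le_rfl fun s'' h => ?_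
    · simp [show r ≠ 0 by omega]
    · exact ⟨fun r hr => by rw [h.idx r hr]; simp [show r ≠ 0 by omega], h.fldArr, h.idxArr⟩

theorem ensures_clearIdx {K a : ℕ} {s : State F} (hs : HasUnits K s) :
    Ensures (clearIdx K a) s (4 * (s.idxArr a).length + 10) fun s' =>
      (∀ r, 1 ≤ r → s'.idx r = s.idx r) ∧ s'.fldArr = s.fldArr ∧
        s'.idxArr = Function.update s.idxArr a [] := by
  have loop : ∀ (j : ℕ) (s : State F), HasUnits K s → s.idx 0 = 1 → (s.idxArr a).length = j →
      Ensures (.loop (.idxLt (K + 26) 0)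
        (.cond (.idxEmpty a) (.instr (.idxConst 0 0)) (.instr (.idxPop a)))) s (4 * j + 5)
        fun s' => (∀ r, 1 ≤ r → s'.idx r = s.idx r) ∧ s'.fldArr = s.fldArr ∧
        s'.idxArr = Function.update s.idxArr a [] := by
    intro j
    induction j with
    | zero =>
      intro s hs h0 hj
      have hnil : s.idxArr a = [] := List.length_eq_zero_iff.1 hj
      refine (ensures_loop_true (t₁ := 2) (t₂ := 1)
        (P := fun s' => s' = { s with idx := Function.update s.idx 0 0 })
        (by simp [Test.holds, hs.zero, h0]) ?_ ?_).mono (by simp [Test.cost, hs.zero, h0])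
        fun _ h => h
      · refine (Ensures.cond (t := 1) (fun _ => ?_) fun h => ?_).mono (by simp [Test.cost])
          fun _ h => h
        · exact (Ensures.instr fun _ => rfl).mono (by simp [Instr.cost]) fun _ h => h
        · simp [Test.holds, hnil] at h
      · rintro s' rfl
        have hz := hs.zero
        refine (ensures_loop_false (by simp [Test.holds, hz]) ?_).mono
          (by simp [Test.cost, hz]) fun _ h => h
        exact ⟨fun r hr => by simp [show r ≠ 0 by omega], rfl, by simp [← hnil]⟩
    | succ j ih =>
      intro s hs h0 hj
      refine (ensures_loop_true (t₁ := 2) (t₂ := 4 * j + 5)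
        (P := fun s' => s' = { s with idxArr := Function.update s.idxArr a (s.idxArr a).dropLast })
        (by simp [Test.holds, hs.zero, h0]) ?_ ?_).mono (by simp [Test.cost, hs.zero, h0]; omega)
        fun _ h => h
      · refine (Ensures.cond (t := 1) (fun h => ?_) fun h => ?_).mono (by simp [Test.cost])
          fun _ h => h
        · simp only [Test.holds, List.isEmpty_iff] at h
          simp [h] at hj
        · exact (Ensures.instr fun _ => rfl).mono (by simp [Instr.cost]) fun _ h => h
      · rintro s' rfl
        refine (ih { s with idxArr := Function.update s.idxArr a (s.idxArr a).dropLast }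
          ⟨hs.zero, hs.one⟩ h0 (by simp [hj])).mono le_rfl fun s'' h => ?_
        exact ⟨h.1, h.2.1, by rw [h.2.2, Function.update_idem]⟩
  refine (Ensures.seq (P := fun s' => s' = { s with idx := Function.update s.idx 0 1 })
    (t₁ := 2) (t₂ := 4 * (s.idxArr a).length + 5) ?_ ?_).mono (by omega) fun _ h => h
  · refine (Ensures.instr fun _ => ?_).mono ?_ fun _ h => h
    · simp [Instr.exec, hs.one]
    · simp [Instr.cost, hs.one]
  · rintro s' rfl
    refine (loop _ _ (hs.of_idx (d := 1) fun r hr => ?_) (by simp) rfl).mono le_rfl fun s'' h => ?_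
    · simp [show r ≠ 0 by omega]
    · exact ⟨fun r hr => by rw [h.1 r hr]; simp [show r ≠ 0 by omega], h.2⟩

/-- Fill the field array `a` with random elements; their number is in the register `cnt`. -/
def fill (K a cnt : ℕ) : Prog F :=
  .seq (clearFld K a) (.seq (.instr (.idxMove 10 cnt))
    (countdown (K + 26) (K + 27) 10 (.seq (.instr (.sample 0)) (.instr (.fldPush a 0)))))

theorem expect_fin_succ {N : ℕ} (φ : (Fin (N + 1) → F) → ℝ) :
    𝔼 x, φ x = 𝔼 y, 𝔼 x, φ (Fin.cons y x) := by
  rw [← Finset.expect_product', Finset.univ_product_univ]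
  exact (Fintype.expect_equiv (Fin.consEquiv fun _ => F) _ _ fun _ => rfl).symm

theorem expect_coin_fst (φ : F → ℝ) : 𝔼 coin : F × Bool, φ coin.1 = 𝔼 y, φ y := by
  rw [← Finset.univ_product_univ, Finset.expect_product]
  simp

/-- For an arbitrary payoff `φ` of the final content, the value carried along is the conditional
expectation of `φ` given the entries drawn so far. It is preserved in the mean by every draw. -/
theorem achieves_fill {K a cnt N β : ℕ} {s : State F} (hs : HasUnits K s) (hcnt : 11 ≤ cnt)
    (hN : s.idx cnt = N) (hβ : ∀ x ≤ N + 1, x.size ≤ β) (φ : (Fin N → F) → ℝ) :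
    Achieves (fill K a cnt) s (4 * (s.fldArr a).length + 20 + 10 * β * (N + 1))
      (fun s' w => ∃ x, Writes 11 a (List.ofFn x) s s' ∧ w = φ x) (𝔼 x, φ x) := by
  -- The payoff is extended to lists so that it can be evaluated at a drawn prefix followed by
  -- entries still to come; the default `0` never matters for lists of length `N`.
  obtain ⟨ψ, hψ⟩ : ∃ ψ : List F → ℝ, ∀ x, φ x = ψ (List.ofFn x) :=
    ⟨fun l => φ fun i => l.getD i 0, fun x => by congr 1; ext i; simp⟩
  simp only [hψ]
  have h1 : Nat.size 1 ≤ β := hβ 1 (by omega)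
  simp only [Nat.size_one] at h1
  let J : ℕ → State F → ℝ → Prop := fun j s' w => ∃ l : List F, l.length + j = N ∧
    Writes 11 a l s s' ∧ s'.idx 10 = j ∧ w = 𝔼 x : Fin j → F, ψ (l ++ List.ofFn x)
  have hunits : ∀ s', (∃ l, Writes 11 a l s s') → HasUnits K s' :=
    fun s' ⟨l, h⟩ => hs.of_idx h.idx
  have loop := Achieves.countdown (z := K + 26) (o := K + 27) (r := 10) (N := N + 1) (β := β)
    (t := 3) (body := .seq (.instr (.sample 0)) (.instr (.fldPush a 0))) (J := J)
    h1 hβ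
    (fun j s' w ⟨l, _, h2, h3, _⟩ => ⟨(hunits s' ⟨l, h2⟩).zero, (hunits s' ⟨l, h2⟩).one, h3⟩) (by
      rintro j hj s' w ⟨l, h2, h3, h4, rfl⟩
      refine (Achieves.seq (t₁ := 1) (t₂ := 1) (P := fun s'' w => ∃ y,
        (s''.fld 0 = y ∧ s''.idx = Function.update s'.idx 10 j ∧ s''.fldArr = s'.fldArr ∧
          s''.idxArr = s'.idxArr) ∧ w = 𝔼 x : Fin j → F, ψ (l ++ y :: List.ofFn x)) ?_ ?_).mono
        (by omega) fun _ _ h => h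
      · refine (Achieves.instr (fun coin => 𝔼 x : Fin j → F, ψ (l ++ coin.1 :: List.ofFn x))
          (fun coin => ⟨coin.1, by simp [Instr.exec], rfl⟩) ?_).mono (by simp [Instr.cost])
          fun _ _ h => h
        rw [expect_fin_succ, expect_coin_fst fun y => 𝔼 x : Fin j → F, ψ (l ++ y :: List.ofFn x)]
        simp [List.ofFn_succ]
      · rintro s'' w ⟨y, ⟨h5, h6, h7, h8⟩, rfl⟩
        refine (Ensures.instr (P := fun s₃ => s₃ = Instr.exec (0, false) s'' (.fldPush a 0))
          fun _ => rfl).achieves ?_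
        rintro s₃ rfl
        refine ⟨l ++ [y], by simp; omega, ⟨?_, ?_, ?_⟩, ?_, by simp⟩
        · intro r hr
          simp only [Instr.exec, h6]
          rw [Function.update_of_ne (by omega), h3.idx r hr]
        · simp [Instr.exec, h7, h5, h3.fldArr]
        · simp [Instr.exec, h8, h3.idxArr]
        · simp [Instr.exec, h6])
  have hcopy : ∀ s', Writes 1 a [] s s' → Achieves (.seq (.instr (.idxMove 10 cnt))
      (countdown (K + 26) (K + 27) 10 (.seq (.instr (.sample 0)) (.instr (.fldPush a 0))))) s'
      (1 + β + (N * (3 + 4 * β + 3) + β + 1) + 1)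
      (fun s' w => ∃ x : Fin N → F, Writes 11 a (List.ofFn x) s s' ∧ w = ψ (List.ofFn x))
      (𝔼 x : Fin N → F, ψ (List.ofFn x)) := by
    intro s' h2
    have h3 : s'.idx cnt = N := (h2.idx _ (by omega)).trans hN
    refine Ensures.seq_achieves
      (P := fun s'' => s'' = { s' with idx := Function.update s'.idx 10 N }) ?_ ?_
    · refine (Ensures.instr fun _ => ?_).mono ?_ fun _ h => h
      · simp [Instr.exec, h3]
      · simpa [Instr.cost, h3] using hβ N (by omega)
    · rintro s'' rfl
      refine (loop N (by omega) { s' with idx := Function.update s'.idx 10 N } (𝔼 x : Fin N → F, ψ (List.ofFn x))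
        ⟨[], by simp, ⟨?_, h2.fldArr, h2.idxArr⟩, by simp, by simp⟩).mono
        le_rfl ?_
      · intro r hr
        simp only
        rw [Function.update_of_ne (by omega), h2.idx r (by omega)]
      · rintro s₃ w ⟨l, h4, h5, -, rfl⟩
        obtain rfl : l.length = N := by omega
        exact ⟨l.get, by simpa using h5, by simp⟩
  refine ((ensures_clearFld hs).seq_achieves hcopy).mono ?_ fun _ _ h => h
  nlinarith [Nat.zero_le (N * β), Nat.mul_le_mul_left N h1]

theorem ensures_fill {K a cnt N β : ℕ} {s : State F} (hs : HasUnits K s) (hcnt : 11 ≤ cnt)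
    (hN : s.idx cnt = N) (hβ : ∀ x ≤ N + 1, x.size ≤ β) :
    Ensures (fill K a cnt) s (4 * (s.fldArr a).length + 20 + 10 * β * (N + 1))
      (fun s' => ∃ x : Fin N → F, Writes 11 a (List.ofFn x) s s') :=
  (achieves_fill hs hcnt hN hβ fun _ => 0).ensures.mono le_rfl fun _ ⟨_, x, h, _⟩ => ⟨x, h⟩

/-! ### Combining windows of matrices -/

/-- The instruction `comb` combines the field registers `0` and `1` into the field register `2`. -/
structure Combines (comb : Instr F) (op : F → F → F) : Prop where
  det : comb.IsDet
  exec : ∀ s : State F, comb.exec (0, false) s =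
    { s with fld := Function.update s.fld 2 (op (s.fld 0) (s.fld 1)) }
  cost : ∀ s : State F, comb.cost s = 1

theorem combines_move : Combines (F := F) (.fldMove 2 1) fun _ y => y :=
  ⟨trivial, fun _ => rfl, fun _ => rfl⟩

theorem combines_plus : Combines (F := F) (.fldArith .plus 2 0 1) fun x y => x + y :=
  ⟨trivial, fun _ => rfl, fun _ => rfl⟩

theorem combines_minus : Combines (F := F) (.fldArith .minus 2 0 1) fun x y => x - y :=
  ⟨trivial, fun _ => rfl, fun _ => rfl⟩

/-- Compute the positions of an entry in two windows. -/
def locate (K s₀ s₁ d₀ d₁ : ℕ) : List (Instr F) :=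
  [.idxArith .plus 0 d₀ 11, .idxArith .times 0 0 (K + 28), .idxArith .plus 0 0 d₁,
    .idxArith .plus 0 0 10, .idxArith .plus 1 s₀ 11, .idxArith .times 1 1 (K + 28),
    .idxArith .plus 1 1 s₁, .idxArith .plus 1 1 10]

/-- Combine one entry of a window of `src` with one entry of a window of `dst`. -/
def transferEntry (K src dst s₀ s₁ d₀ d₁ : ℕ) (comb : Instr F) : Prog F :=
  .seq (straight (locate K s₀ s₁ d₀ d₁))
    (straight [.fldGet 0 dst 0, .fldGet 1 src 1, comb, .fldSet dst 0 2])

/-- Combine a window of the matrix `src` with a window of the matrix `dst`. The corners and the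
size of the windows are in registers. -/
def transfer (K src dst s₀ s₁ d₀ d₁ R C : ℕ) (comb : Instr F) : Prog F :=
  .seq (.instr (.idxMove 11 R)) (countdown (K + 26) (K + 27) 11
    (.seq (.instr (.idxMove 10 C)) (countdown (K + 26) (K + 27) 10
      (transferEntry K src dst s₀ s₁ d₀ d₁ comb))))

/-- The hypotheses of a transfer between windows with corners `(σ₀, σ₁)` and `(δ₀, δ₁)` and size
`ρ × κ` of `n × n` matrices. -/
structure TransferData (K dst s₀ s₁ d₀ d₁ R C n σ₀ σ₁ δ₀ δ₁ ρ κ : ℕ) (s : State F) : Prop where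
  units : HasUnits K s
  dim : s.idx (K + 28) = n
  src₀ : s.idx s₀ = σ₀
  src₁ : s.idx s₁ = σ₁
  dst₀ : s.idx d₀ = δ₀
  dst₁ : s.idx d₁ = δ₁
  rows : s.idx R = ρ
  cols : s.idx C = κ
  names : 12 ≤ s₀ ∧ 12 ≤ s₁ ∧ 12 ≤ d₀ ∧ 12 ≤ d₁ ∧ 12 ≤ R ∧ 12 ≤ C
  length : (s.fldArr dst).length = n * n

theorem TransferData.writes {K dst s₀ s₁ d₀ d₁ R C n σ₀ σ₁ δ₀ δ₁ ρ κ : ℕ} {s s' : State F}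
    {l : List F} (h : TransferData K dst s₀ s₁ d₀ d₁ R C n σ₀ σ₁ δ₀ δ₁ ρ κ s)
    (hs : Writes 12 dst l s s') (hl : l.length = n * n) :
    TransferData K dst s₀ s₁ d₀ d₁ R C n σ₀ σ₁ δ₀ δ₁ ρ κ s' := by
  obtain ⟨h0, h1, h2, h3, h4, h5, h6, h7, h8, h9⟩ := h
  have hn := h8
  obtain ⟨n1, n2, n3, n4, n5, n6⟩ := h8
  exact ⟨h0.of_idx hs.idx, (hs.idx _ (by omega)).trans h1, (hs.idx _ n1).trans h2,
    (hs.idx _ n2).trans h3, (hs.idx _ n3).trans h4, (hs.idx _ n4).trans h5,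
    (hs.idx _ n5).trans h6, (hs.idx _ n6).trans h7, hn, by rw [hs.self, hl]⟩

theorem entry_lt {n i j : ℕ} (hi : i < n) (hj : j < n) : i * n + j < n * n :=
  calc i * n + j < i * n + n := by omega
    _ = (i + 1) * n := by ring
    _ ≤ n * n := Nat.mul_le_mul_right _ hi

theorem entry_inj {n i j i' j' : ℕ} (hj : j < n) (hj' : j' < n) (h : i * n + j = i' * n + j') :
    i = i' ∧ j = j' := by
  have hn : 0 < n := by omega
  have h1 := congrArg (· / n) h
  have h2 := congrArg (· % n) h
  simp only [Nat.mul_comm _ n] at h1 h2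
  simp only [Nat.mul_add_div hn, Nat.div_eq_of_lt hj, Nat.div_eq_of_lt hj',
    Nat.mul_add_mod, Nat.mod_eq_of_lt hj, Nat.mod_eq_of_lt hj'] at h1 h2
  exact ⟨by omega, h2⟩

theorem ensures_transferEntry {K src dst s₀ s₁ d₀ d₁ R C n σ₀ σ₁ δ₀ δ₁ ρ κ u v β : ℕ}
    {comb : Instr F} {op : F → F → F} {s : State F} (hcomb : Combines comb op)
    (hd : TransferData K dst s₀ s₁ d₀ d₁ R C n σ₀ σ₁ δ₀ δ₁ ρ κ s)
    (hβ : ∀ x ≤ (n + 1) ^ 2, x.size ≤ β) (hu : s.idx 11 = u) (hv : s.idx 10 = v)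
    (h₁ : σ₀ + u < n) (h₂ : σ₁ + v < n) (h₃ : δ₀ + u < n) (h₄ : δ₁ + v < n) :
    Ensures (transferEntry K src dst s₀ s₁ d₀ d₁ comb) s (60 * β) fun s' =>
      Writes 10 dst ((s.fldArr dst).set ((δ₀ + u) * n + (δ₁ + v))
        (op ((s.fldArr dst).getD ((δ₀ + u) * n + (δ₁ + v)) 0)
          ((s.fldArr src).getD ((σ₀ + u) * n + (σ₁ + v)) 0))) s s' := by
  obtain ⟨-, g1, g2, g3, g4, g5, -, -, ⟨n1, n2, n3, n4, -, -⟩, -⟩ := hd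
  have hb : ∀ x < n * n, x.size ≤ β := fun x hx => hβ x (by nlinarith)
  have hb' : ∀ x ≤ n, x.size ≤ β := fun x hx => hβ x (by nlinarith)
  have l1 := entry_lt h₁ h₂
  have l2 := entry_lt h₃ h₄
  have e1 := hb ((σ₀ + u) * n + σ₁ + v) (by omega)
  have e2 := hb ((δ₀ + u) * n + δ₁ + v) (by omega)
  have e16 : 1 ≤ β := by simpa using hb' 1 (by omega)
  refine (Ensures.seq (t₁ := 45 * β) (t₂ := 13 * β) (P := fun s' =>
    s'.idx 0 = (δ₀ + u) * n + δ₁ + v ∧ s'.idx 1 = (σ₀ + u) * n + σ₁ + v ∧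
    (∀ r, 10 ≤ r → s'.idx r = s.idx r) ∧ s'.fldArr = s.fldArr ∧ s'.idxArr = s.idxArr) ?_
    ?_).mono (by omega) fun _ h => h
  · refine (ensures_straight (by simp [locate, Instr.IsDet]) s).mono ?_ ?_
    · have e3 := hb ((σ₀ + u) * n) (by omega)
      have e4 := hb ((δ₀ + u) * n) (by omega)
      have e5 := hb ((σ₀ + u) * n + σ₁) (by omega)
      have e6 := hb ((δ₀ + u) * n + δ₁) (by omega)
      have e7 := hb' σ₀ (by omega)
      have e8 := hb' σ₁ (by omega)
      have e9 := hb' δ₀ (by omega)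
      have e10 := hb' δ₁ (by omega)
      have e11 := hb' u (by omega)
      have e12 := hb' v (by omega)
      have e13 := hb' n le_rfl
      have e14 := hb' (σ₀ + u) (by omega)
      have e15 := hb' (δ₀ + u) (by omega)
      clear hb hb' hβ l1 l2
      simp (disch := omega) only [locate, costAll, Instr.cost, Instr.exec, IdxOp.eval,
        Function.update_self, Function.update_of_ne, g1, g2, g3, g4, g5, hu, hv]
      omega
    · rintro s' rfl
      clear hb hb' hβ l1 l2 e1 e2 e16
      refine ⟨?_, ?_, fun r hr => ?_, rfl, rfl⟩ <;>
        simp (disch := omega) only [locate, execAll, Instr.exec, IdxOp.eval, Function.update_self,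
          Function.update_of_ne, g1, g2, g3, g4, g5, hu, hv]
  · rintro s' ⟨h5, h6, h7, h8, h9⟩
    refine (ensures_straight ?_ s').mono ?_ ?_
    · simp only [List.forall_mem_cons]
      exact ⟨trivial, trivial, hcomb.det, trivial, by simp⟩
    · simp only [costAll, hcomb.exec, hcomb.cost]
      simp only [Instr.cost, Instr.exec, h5, h6]
      omega
    · rintro s'' rfl
      simp only [execAll, hcomb.exec]
      refine ⟨fun r hr => ?_, ?_, ?_⟩
      · simp only [Instr.exec, h7 r hr]
      · simp [Instr.exec, h5, h6, h8, ← Nat.add_assoc]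
      · simp only [Instr.exec, h9]

open Classical in
/-- The matrix `l` arises from `l₀` by combining the entries in `D` with entries of `l₁`. -/
def Combined (n : ℕ) (D : ℕ → ℕ → Prop) (target : ℕ → ℕ → F) (l₀ l : List F) : Prop :=
  l.length = n * n ∧ ∀ i < n, ∀ j < n,
    l.getD (i * n + j) 0 = if D i j then target i j else l₀.getD (i * n + j) 0

open Classical in
theorem Combined.congr {n : ℕ} {D D' : ℕ → ℕ → Prop} {target : ℕ → ℕ → F} {l₀ l : List F}
    (h : Combined n D target l₀ l) (hD : ∀ i < n, ∀ j < n, D i j ↔ D' i j) :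
    Combined n D' target l₀ l :=
  ⟨h.1, fun i hi j hj => (h.2 i hi j hj).trans (if_congr (hD i hi j hj) rfl rfl)⟩

open Classical in
theorem Combined.set {n i₀ j₀ : ℕ} {D D' : ℕ → ℕ → Prop} {target : ℕ → ℕ → F} {l₀ l : List F}
    (h : Combined n D target l₀ l) (hi₀ : i₀ < n) (hj₀ : j₀ < n)
    (hD : ∀ i < n, ∀ j < n, D' i j ↔ D i j ∨ (i = i₀ ∧ j = j₀)) :
    Combined n D' target l₀ (l.set (i₀ * n + j₀) (target i₀ j₀)) := by
  refine ⟨by simpa using h.1, fun i hi j hj => ?_⟩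
  have h1 := h.2 i hi j hj
  have h2 := entry_lt hi₀ hj₀
  by_cases hij : i = i₀ ∧ j = j₀
  · obtain ⟨rfl, rfl⟩ := hij
    rw [if_pos ((hD i hi j hj).2 (.inr ⟨rfl, rfl⟩))]
    simp [List.getD_eq_getElem?_getD, h.1, h2]
  · have h3 : i₀ * n + j₀ ≠ i * n + j := fun e => hij (by
      obtain ⟨a, b⟩ := entry_inj hj₀ hj e
      exact ⟨a.symm, b.symm⟩)
    refine Eq.trans ?_ (h1.trans (if_congr (by rw [hD i hi j hj]; simp [hij]) rfl rfl))
    simp [List.getD_eq_getElem?_getD, h3]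

theorem ensures_transfer {K src dst s₀ s₁ d₀ d₁ R C n σ₀ σ₁ δ₀ δ₁ ρ κ β : ℕ}
    {comb : Instr F} {op : F → F → F} {s : State F} (hcomb : Combines comb op)
    (hne : src ≠ dst) (hd : TransferData K dst s₀ s₁ d₀ d₁ R C n σ₀ σ₁ δ₀ δ₁ ρ κ s)
    (hβ : ∀ x ≤ (n + 1) ^ 2, x.size ≤ β)
    (h₁ : σ₀ + ρ ≤ n) (h₂ : σ₁ + κ ≤ n) (h₃ : δ₀ + ρ ≤ n) (h₄ : δ₁ + κ ≤ n) :
    Ensures (transfer K src dst s₀ s₁ d₀ d₁ R C comb) s (80 * β * (n + 1) ^ 2) fun s' =>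
      ∃ l, Writes 12 dst l s s' ∧ Combined n
        (fun i j => (δ₀ ≤ i ∧ i < δ₀ + ρ) ∧ (δ₁ ≤ j ∧ j < δ₁ + κ))
        (fun i j => op ((s.fldArr dst).getD (i * n + j) 0)
          ((s.fldArr src).getD ((σ₀ + (i - δ₀)) * n + (σ₁ + (j - δ₁))) 0)) (s.fldArr dst) l := by
  have hβn : ∀ x ≤ n + 1, x.size ≤ β := fun x hx => hβ x (by nlinarith)
  have hβ1 : 1 ≤ β := by simpa using hβn 1 (by omega)
  set l₀ := s.fldArr dst
  set T : ℕ → ℕ → F := fun i j => op (l₀.getD (i * n + j) 0)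
    ((s.fldArr src).getD ((σ₀ + (i - δ₀)) * n + (σ₁ + (j - δ₁))) 0) with hT
  -- Both counters run downwards, so the finished entries of the window are those in later rows and,
  -- in row `u`, those from column `v` on.
  let D : ℕ → ℕ → ℕ → ℕ → Prop := fun u v i j => i < δ₀ + ρ ∧ (δ₁ ≤ j ∧ j < δ₁ + κ) ∧
    (δ₀ + u < i ∨ (i = δ₀ + u ∧ δ₁ + v ≤ j))
  let J : ℕ → State F → Prop := fun u s' => s'.idx 11 = u ∧ ∃ l, Writes 12 dst l s s' ∧
    Combined n (fun i j => (δ₀ + u ≤ i ∧ i < δ₀ + ρ) ∧ (δ₁ ≤ j ∧ j < δ₁ + κ)) T l₀ l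
  let J' : ℕ → ℕ → State F → Prop := fun u v s' => s'.idx 11 = u ∧ s'.idx 10 = v ∧
    ∃ l, Writes 12 dst l s s' ∧ Combined n (D u v) T l₀ l
  have inner : ∀ u < ρ, ∀ v ≤ κ, ∀ s', J' u v s' →
      Ensures (countdown (K + 26) (K + 27) 10 (transferEntry K src dst s₀ s₁ d₀ d₁ comb))
        s' (v * (60 * β + 4 * β + 3) + β + 1) (J' u 0) := by
    intro u hu v hv
    refine Ensures.countdown (N := κ) (J := J' u) hβ1
      (fun x hx => hβn x (by omega)) ?_ ?_ v (by omega)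
    · rintro v s' ⟨-, h5, l, h6, h7⟩
      have := (hd.writes h6 h7.1).units
      exact ⟨this.zero, this.one, h5⟩
    · rintro v hv s' ⟨h5, h6, l, h7, h8⟩
      set s₁' : State F := { s' with idx := Function.update s'.idx 10 v } with hs₁'
      have h9 : Writes 12 dst l s s₁' :=
        ⟨fun r hr => by simp only [hs₁']; rw [Function.update_of_ne (by omega), h7.idx r hr],
          h7.fldArr, h7.idxArr⟩
      refine (ensures_transferEntry (u := u) (v := v) hcomb (hd.writes h9 h8.1) hβ (by simp [hs₁', h5])
        (by simp [hs₁']) (by omega) (by omega) (by omega) (by omega)).mono le_rfl fun s'' h => ?_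
      refine ⟨?_, ?_, _, (h9.trans h).mono (by omega), ?_⟩
      · rw [h.idx _ (by omega)]; simp [hs₁', h5]
      · rw [h.idx _ (by omega)]; simp [hs₁']
      · rw [h9.self, h9.other hne]
        have h10 : op (l.getD ((δ₀ + u) * n + (δ₁ + v)) 0)
            ((s.fldArr src).getD ((σ₀ + u) * n + (σ₁ + v)) 0) = T (δ₀ + u) (δ₁ + v) := by
          -- The current entry has not been finished yet, so the operation is applied to its
          -- original value.
          rw [h8.2 _ (by omega) _ (by omega), if_neg (by simp only [D]; omega)]
          simp [hT]
        rw [h10]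
        refine h8.set (by omega) (by omega) fun i hi j hj => ?_
        simp only [D]
        omega
  have outer : ∀ u ≤ ρ, ∀ s', J u s' → Ensures (countdown (K + 26) (K + 27) 11
      (.seq (.instr (.idxMove 10 C)) (countdown (K + 26) (K + 27) 10
        (transferEntry K src dst s₀ s₁ d₀ d₁ comb))))
        s' (u * ((1 + β + (κ * (60 * β + 4 * β + 3) + β + 1) + 1) + 4 * β + 3) + β + 1) (J 0) := by
    intro u hu
    refine Ensures.countdown (N := ρ) (J := J) hβ1 (fun x hx => hβn x (by omega)) ?_ ?_ u hu
    · rintro u s' ⟨h5, l, h6, h7⟩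
      have := (hd.writes h6 h7.1).units
      exact ⟨this.zero, this.one, h5⟩
    · rintro u hu s' ⟨h5, l, h7, h8⟩
      set s₁' : State F := { s' with idx := Function.update s'.idx 11 u } with hs₁'
      have h9 : Writes 12 dst l s s₁' :=
        ⟨fun r hr => by simp only [hs₁']; rw [Function.update_of_ne (by omega), h7.idx r hr],
          h7.fldArr, h7.idxArr⟩
      have h10 := (hd.writes h9 h8.1).cols
      have hC := hd.names.2.2.2.2.2
      refine Ensures.seq (P := J' u κ) ((Ensures.instr fun _ => ?_).mono ?_ fun _ h => h)
        fun s'' h => (inner u hu κ le_rfl s'' h).mono le_rfl fun s₃ h => ?_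
      · refine ⟨by simp [Instr.exec, hs₁'], by simp [Instr.exec, h10], l, ⟨?_, h9.fldArr, h9.idxArr⟩,
          h8.congr fun i hi j hj => by simp only [D]; omega⟩
        intro r hr
        simp only [Instr.exec]
        rw [Function.update_of_ne (by omega), h9.idx r hr]
      · simpa [Instr.cost, h10] using hβn κ (by omega)
      · obtain ⟨h11, -, l', h12, h13⟩ := h
        exact ⟨h11, l', h12, h13.congr fun i hi j hj => by simp only [D]; omega⟩
  have hR := hd.names.2.2.2.2.1
  refine (Ensures.seq (P := J ρ) ((Ensures.instr fun _ => ?_).mono (t' := 1 + β) ?_ fun _ h => h)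
    fun s' h => (outer ρ le_rfl s' h)).mono ?_ fun s' ⟨_, l, h5, h6⟩ => ⟨l, h5, ?_⟩
  · refine ⟨by simp [Instr.exec, hd.rows], l₀, ⟨?_, by simp [Instr.exec, l₀], rfl⟩, hd.length,
      fun i _ j _ => by rw [if_neg (by omega)]⟩
    intro r hr
    simp only [Instr.exec]
    rw [Function.update_of_ne (by omega)]
  · simpa [Instr.cost, hd.rows] using hβn ρ (by omega)
  · have hρ : ρ ≤ n := by omega
    have hκ : κ ≤ n := by omega
    calc _ ≤ 1 + β + (n * ((1 + β + (n * (60 * β + 4 * β + 3) + β + 1) + 1) + 4 * β + 3) + β + 1)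
          + 1 := by gcongr
      _ ≤ 80 * β * (n + 1) ^ 2 := by
        nlinarith [Nat.mul_le_mul_left (n * n) hβ1, Nat.mul_le_mul_left n hβ1]
  · exact h6.congr fun i hi j hj => by omega

end RAM

/-! ### Matrices as lists of entries -/

section Entries

variable {F : Type*} {n : ℕ}

theorem matrixEntries_eq_ofFn (M : Matrix (Fin n) (Fin n) F) :
    matrixEntries M = List.ofFn fun t : Fin (n * n) => M t.divNat t.modNat := by
  rw [List.ofFn_mul, matrixEntries]
  congr 2
  ext1 i
  congr 1
  ext1 j
  have hn : 0 < n := j.pos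
  congr 1
  · ext
    simp only [Fin.divNat]
    rw [Nat.mul_comm, Nat.mul_add_div hn, Nat.div_eq_of_lt j.2, Nat.add_zero]
  · ext
    simp only [Fin.modNat]
    rw [Nat.mul_comm, Nat.mul_add_mod, Nat.mod_eq_of_lt j.2]

@[simp]
theorem length_matrixEntries (M : Matrix (Fin n) (Fin n) F) :
    (matrixEntries M).length = n * n := by
  simp [matrixEntries_eq_ofFn]

theorem matrixEntries_injective :
    Function.Injective (matrixEntries : Matrix (Fin n) (Fin n) F → List F) := by
  intro M N h
  rw [matrixEntries_eq_ofFn, matrixEntries_eq_ofFn] at h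
  have h := List.ofFn_injective h
  ext i j
  have := congrFun h (finProdFinEquiv (i, j))
  have h2 := finProdFinEquiv.symm_apply_apply (i, j)
  simp only [finProdFinEquiv_symm_apply, Prod.mk.injEq] at h2
  rwa [h2.1, h2.2] at this

/-- Lists of length `n * n` and matrices. -/
def matrixEquiv (F : Type*) (n : ℕ) : (Fin (n * n) → F) ≃ Matrix (Fin n) (Fin n) F :=
  (finProdFinEquiv.arrowCongr (Equiv.refl F)).symm.trans (Equiv.curry (Fin n) (Fin n) F)

theorem matrixEntries_matrixEquiv (x : Fin (n * n) → F) :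
    matrixEntries (matrixEquiv F n x) = List.ofFn x := by
  rw [matrixEntries_eq_ofFn]
  congr 1
  ext1 t
  change x (finProdFinEquiv (finProdFinEquiv.symm t)) = x t
  rw [Equiv.apply_symm_apply]

/-- Even when a computation has gone wrong, the working array has the right length and so represents
some matrix; this is all that termination arguments and checks need. -/
theorem exists_matrixEntries {l : List F} (hl : l.length = n * n) :
    ∃ M : Matrix (Fin n) (Fin n) F, matrixEntries M = l := by
  refine ⟨matrixEquiv F n fun i => l.get (i.cast hl.symm), ?_⟩
  rw [matrixEntries_matrixEquiv]
  refine List.ext_get (by simp [hl]) fun i h1 h2 => by simp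

theorem getD_matrixEntries [Zero F] (M : Matrix (Fin n) (Fin n) F) (i j : Fin n) :
    (matrixEntries M).getD (i * n + j) 0 = M i j := by
  have h1 : (i : ℕ) * n + j < n * n := RAM.entry_lt i.2 j.2
  have h2 := finProdFinEquiv.symm_apply_apply (i, j)
  simp only [finProdFinEquiv_symm_apply, Prod.mk.injEq] at h2
  have h3 : finProdFinEquiv (i, j) = ⟨i * n + j, h1⟩ := by
    ext; simp [Nat.add_comm, Nat.mul_comm]
  rw [h3] at h2
  rw [matrixEntries_eq_ofFn, List.getD_eq_getElem _ _ (by simpa using h1), List.getElem_ofFn,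
    h2.1, h2.2]

theorem getD_matrixEntries' [Zero F] (M : Matrix (Fin n) (Fin n) F) {i j : ℕ} (hi : i < n)
    (hj : j < n) : (matrixEntries M).getD (i * n + j) 0 = M ⟨i, hi⟩ ⟨j, hj⟩ :=
  getD_matrixEntries M ⟨i, hi⟩ ⟨j, hj⟩

theorem eq_matrixEntries [Zero F] {l : List F} {M : Matrix (Fin n) (Fin n) F}
    (hl : l.length = n * n) (h : ∀ i j : Fin n, l.getD (i * n + j) 0 = M i j) :
    l = matrixEntries M := by
  obtain ⟨N, rfl⟩ := exists_matrixEntries hl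
  congr 1
  ext i j
  rw [← getD_matrixEntries N, h]

theorem getD_ofFn [Zero F] (v : Fin n → F) {i : ℕ} (hi : i < n) :
    (List.ofFn v).getD i 0 = v ⟨i, hi⟩ := by
  rw [List.getD_eq_getElem _ _ (by simpa using hi), List.getElem_ofFn]

end Entries

namespace RAM

variable {F : Type*} [Field F] [Fintype F] [DecidableEq F]

theorem achieves_fillMatrix {K a cnt n β : ℕ} {s : State F} (hs : HasUnits K s) (hcnt : 11 ≤ cnt)
    (hN : s.idx cnt = n * n) (hβ : ∀ x ≤ n * n + 1, x.size ≤ β)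
    (φ : Matrix (Fin n) (Fin n) F → ℝ) :
    Achieves (fill K a cnt) s (4 * (s.fldArr a).length + 20 + 10 * β * (n * n + 1))
      (fun s' w => ∃ X : Matrix (Fin n) (Fin n) F, Writes 11 a (matrixEntries X) s s' ∧ w = φ X)
      (𝔼 X, φ X) := by
  rw [← Fintype.expect_equiv (matrixEquiv F n) (fun x => φ (matrixEquiv F n x)) φ fun _ => rfl]
  refine (achieves_fill hs hcnt hN hβ fun x => φ (matrixEquiv F n x)).mono le_rfl ?_
  rintro s' w ⟨x, h, hw⟩
  exact ⟨_, by rwa [matrixEntries_matrixEquiv], hw⟩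

theorem ensures_fillMatrix {K a cnt n β : ℕ} {s : State F} (hs : HasUnits K s) (hcnt : 11 ≤ cnt)
    (hN : s.idx cnt = n * n) (hβ : ∀ x ≤ n * n + 1, x.size ≤ β) :
    Ensures (fill K a cnt) s (4 * (s.fldArr a).length + 20 + 10 * β * (n * n + 1))
      fun s' => ∃ X : Matrix (Fin n) (Fin n) F, Writes 11 a (matrixEntries X) s s' :=
  (achieves_fillMatrix hs hcnt hN hβ fun _ => 0).ensures.mono le_rfl fun _ ⟨_, X, h, _⟩ => ⟨X, h⟩

theorem ensures_transferMatrix {K src dst s₀ s₁ d₀ d₁ R C n σ₀ σ₁ δ₀ δ₁ ρ κ β : ℕ}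
    {comb : Instr F} {op : F → F → F} {s : State F} (hcomb : Combines comb op)
    (hne : src ≠ dst) (hd : TransferData K dst s₀ s₁ d₀ d₁ R C n σ₀ σ₁ δ₀ δ₁ ρ κ s)
    (hβ : ∀ x ≤ (n + 1) ^ 2, x.size ≤ β)
    (h₁ : σ₀ + ρ ≤ n) (h₂ : σ₁ + κ ≤ n) (h₃ : δ₀ + ρ ≤ n) (h₄ : δ₁ + κ ≤ n)
    {Y : Matrix (Fin n) (Fin n) F} (hY : s.fldArr dst = matrixEntries Y) :
    Ensures (transfer K src dst s₀ s₁ d₀ d₁ R C comb) s (80 * β * (n + 1) ^ 2)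
      (Writes 12 dst (matrixEntries fun i j : Fin n =>
        if (δ₀ ≤ i ∧ i < δ₀ + ρ) ∧ (δ₁ ≤ j ∧ j < δ₁ + κ) then
          op (Y i j) ((s.fldArr src).getD ((σ₀ + (i - δ₀)) * n + (σ₁ + (j - δ₁))) 0)
        else Y i j) s) := by
  refine (ensures_transfer hcomb hne hd hβ h₁ h₂ h₃ h₄).mono le_rfl ?_
  rintro s' ⟨l, h5, h6, h7⟩
  convert h5 using 1
  refine (eq_matrixEntries h6 fun i j => ?_).symm
  rw [h7 i i.2 j j.2, hY]
  split_ifs <;> simp only [getD_matrixEntries]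

/-! ### Matrix-vector products and comparison of vectors -/

/-- Multiply the matrix in the array `M` by the vector in the array `src`. -/
def matVec (K M src dst : ℕ) : Prog F :=
  .seq (.instr (.idxMove 11 (K + 28))) (countdown (K + 26) (K + 27) 11
    (.seq (straight [.fldConst 3 0, .idxMove 10 (K + 28)])
      (.seq (countdown (K + 26) (K + 27) 10
        (straight [.idxArith .times 0 11 (K + 28), .idxArith .plus 0 0 10, .fldGet 0 M 0,
          .fldGet 1 src 10, .fldArith .times 0 0 1, .fldArith .plus 3 3 0]))
        (.instr (.fldSet dst 11 3)))))

theorem ensures_matVec {K M src dst n β : ℕ} {s : State F} (hs : HasUnits K s)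
    (hn : s.idx (K + 28) = n) (hβ : ∀ x ≤ (n + 1) ^ 2, x.size ≤ β) (hM : M ≠ dst)
    (hsrc : src ≠ dst) {A : Matrix (Fin n) (Fin n) F} {v : Fin n → F}
    (hA : s.fldArr M = matrixEntries A) (hv : s.fldArr src = List.ofFn v)
    (hdst : (s.fldArr dst).length = n) :
    Ensures (matVec K M src dst) s (80 * β * (n + 1) ^ 2)
      (Writes 12 dst (List.ofFn (A.mulVec v)) s) := by
  have hβn : ∀ x ≤ n + 1, x.size ≤ β := fun x hx => hβ x (by nlinarith)
  have hβ1 : 1 ≤ β := by simpa using hβn 1 (by omega)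
  let a : ℕ → ℕ → F := fun i t => (matrixEntries A).getD (i * n + t) 0 * (List.ofFn v).getD t 0
  let S : ℕ → State F → Prop := fun u s' => s'.idx 11 = u ∧ ∃ l : List F, l.length = n ∧
    Writes 12 dst l s s' ∧ ∀ i < n, u ≤ i → l.getD i 0 = ∑ t ∈ Finset.range n, a i t
  -- The inner loop visits the columns from the last to the first, so field register `3` holds the
  -- sum over `[j, n)`.
  let J : List F → ℕ → ℕ → State F → Prop := fun l u j s' => s'.idx 10 = j ∧ s'.idx 11 = u ∧
    Writes 12 dst l s s' ∧ s'.fld 3 = ∑ t ∈ Finset.Ico j n, a u t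
  have inner : ∀ l, ∀ u < n, ∀ j ≤ n, ∀ s', J l u j s' → Ensures (countdown (K + 26) (K + 27) 10
        (straight [.idxArith .times 0 11 (K + 28), .idxArith .plus 0 0 10, .fldGet 0 M 0,
          .fldGet 1 src 10, .fldArith .times 0 0 1, .fldArith .plus 3 3 0])) s'
      (j * (30 * β + 4 * β + 3) + β + 1) (J l u 0) := by
    intro l u hu j hj
    refine Ensures.countdown (N := n) (J := J l u) hβ1 (fun x hx => hβn x (by omega)) ?_ ?_ j hj
    · rintro j s' ⟨h1, -, h2, -⟩
      have := hs.of_idx h2.idx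
      exact ⟨this.zero, this.one, h1⟩
    · rintro j hj s' ⟨h1, h2, h3, h4⟩
      have h5 : s'.idx (K + 28) = n := (h3.idx _ (by omega)).trans hn
      have l1 := entry_lt hu hj
      have e0 : ∀ x < n * n, x.size ≤ β := fun x hx => hβ x (by nlinarith)
      have e1 := e0 (u * n + j) l1
      have e2 := e0 (u * n) (by omega)
      have e3 := hβn u (by omega)
      have e4 := hβn j (by omega)
      have e5 := hβn n (by omega)
      refine (ensures_straight (by simp [Instr.IsDet]) _).mono ?_ ?_
      · simp (disch := omega) only [costAll, Instr.cost, Instr.exec, IdxOp.eval,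
          Function.update_self, Function.update_of_ne, h2, h5]
        omega
      · rintro s'' rfl
        refine ⟨?_, ?_, ⟨fun r hr => ?_, ?_, ?_⟩, ?_⟩
        · simp [execAll, Instr.exec]
        · simp [execAll, Instr.exec, h2]
        · simp (disch := omega) only [execAll, Instr.exec, Function.update_of_ne]
          exact h3.idx r hr
        · simp only [execAll, Instr.exec, h3.fldArr]
        · simp only [execAll, Instr.exec, h3.idxArr]
        · rw [← Finset.add_sum_Ioo_eq_sum_Ico hj, ← Finset.Ico_succ_left_eq_Ioo]
          simp [execAll, Instr.exec, h2, h5, h4, IdxOp.eval, FldOp.eval, a, h3.other hM,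
            h3.other hsrc, hA, hv, add_comm]
  have outer : ∀ u ≤ n, ∀ s', S u s' → Ensures (countdown (K + 26) (K + 27) 11
      (.seq (straight [.fldConst 3 0, .idxMove 10 (K + 28)])
      (.seq (countdown (K + 26) (K + 27) 10
        (straight [.idxArith .times 0 11 (K + 28), .idxArith .plus 0 0 10, .fldGet 0 M 0,
          .fldGet 1 src 10, .fldArith .times 0 0 1, .fldArith .plus 3 3 0]))
        (.instr (.fldSet dst 11 3))))) s'
      (u * (((5 + β) + ((n * (30 * β + 4 * β + 3) + β + 1) + (1 + β) + 1) + 1) + 4 * β + 3) + β + 1)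
      (S 0) := by
    intro u hu
    refine Ensures.countdown (N := n) (J := S) hβ1 (fun x hx => hβn x (by omega)) ?_ ?_ u hu
    · rintro u s' ⟨h1, l, -, h2, -⟩
      have := hs.of_idx h2.idx
      exact ⟨this.zero, this.one, h1⟩
    · rintro u hu s' ⟨h1, l, h2, h3, h4⟩
      have h5 : s'.idx (K + 28) = n := (h3.idx _ (by omega)).trans hn
      refine Ensures.seq (P := J l u n) ?_ fun s₁ hs₁ =>
        Ensures.seq (inner l u hu n le_rfl s₁ hs₁) ?_
      · refine (ensures_straight (by simp [Instr.IsDet]) _).mono ?_ ?_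
        · simp (disch := omega) only [costAll, Instr.cost, Instr.exec, Function.update_of_ne, h5]
          have := hβn n (by omega)
          omega
        · rintro s'' rfl
          refine ⟨?_, ?_, ⟨fun r hr => ?_, ?_, ?_⟩, ?_⟩
          · simp (disch := omega) only [execAll, Instr.exec, Function.update_self,
              Function.update_of_ne, h5]
          · simp [execAll, Instr.exec]
          · simp (disch := omega) only [execAll, Instr.exec, Function.update_of_ne]
            exact h3.idx r hr
          · simp only [execAll, Instr.exec, h3.fldArr]
          · simp only [execAll, Instr.exec, h3.idxArr]
          · simp [execAll, Instr.exec]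
      · rintro s₂ ⟨-, h6, h7, h8⟩
        refine (Ensures.instr (P := fun s₃ => s₃ = Instr.exec (0, false) s₂ (.fldSet dst 11 3))
          fun _ => rfl).mono ?_ ?_
        · simpa [Instr.cost, h6] using hβn u (by omega)
        · rintro s₃ rfl
          refine ⟨h6, l.set u (∑ t ∈ Finset.range n, a u t), by simpa using h2,
            ⟨h7.idx, ?_, h7.idxArr⟩, fun i hi hui => ?_⟩
          · simp [Instr.exec, h6, h7.fldArr, h8]
          · by_cases hiu : u = i
            · subst hiu
              simp [List.getD_eq_getElem?_getD, h2, hi]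
            · rw [← h4 i hi (by omega)]
              simp [List.getD_eq_getElem?_getD, hiu]
  refine (Ensures.seq (P := S n) (t₁ := 1 + β) (Ensures.mono (Ensures.instr fun _ => ?_) ?_ fun _ h => h)
    fun s' h => outer n le_rfl s' h).mono ?_ ?_
  · refine ⟨by simp [Instr.exec, hn], s.fldArr dst, hdst, ⟨fun r hr => ?_, ?_, rfl⟩, ?_⟩
    · simp (disch := omega) only [Instr.exec, Function.update_of_ne]
    · simp [Instr.exec]
    · intro i hi hni; omega
  · simpa [Instr.cost, hn] using hβn n (by omega)
  · nlinarith [Nat.mul_le_mul_left (n * n) hβ1, Nat.mul_le_mul_left n hβ1]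
  · rintro s' ⟨-, l, h1, h2, h3⟩
    convert h2 using 1
    refine List.ext_getElem (by simp [h1]) fun i hi _ => ?_
    have hi : i < n := by simpa using hi
    have h4 := h3 i hi (by omega)
    rw [List.getD_eq_getElem _ _ (by omega)] at h4
    rw [h4, List.getElem_ofFn, Matrix.mulVec, dotProduct, Finset.sum_range]
    refine Finset.sum_congr rfl fun t _ => ?_
    simp only [a]
    rw [getD_matrixEntries' A hi t.2, getD_ofFn v t.2]

/-- Set the register `K + 23` to zero if the vectors in `x` and `y` differ. -/
def compare (K x y : ℕ) : Prog F :=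
  .seq (.instr (.idxMove 10 (K + 28))) (countdown (K + 26) (K + 27) 10
    (.seq (straight [.fldGet 0 x 10, .fldGet 1 y 10])
      (.cond (.fldEq 0 1) .skip (.instr (.idxConst (K + 23) 0)))))

theorem ensures_compare {K x y n β : ℕ} {s : State F} (hs : HasUnits K s)
    (hn : s.idx (K + 28) = n) (hβ : ∀ x ≤ (n + 1) ^ 2, x.size ≤ β) {v w : Fin n → F}
    (hx : s.fldArr x = List.ofFn v) (hy : s.fldArr y = List.ofFn w) :
    Ensures (compare K x y) s (20 * β * (n + 1)) fun s' =>
      (∀ r, 11 ≤ r → r ≠ K + 23 → s'.idx r = s.idx r) ∧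
      s'.idx (K + 23) = (if v = w then s.idx (K + 23) else 0) ∧
      s'.fldArr = s.fldArr ∧ s'.idxArr = s.idxArr := by
  have hβn : ∀ x ≤ n + 1, x.size ≤ β := fun x hx => hβ x (by nlinarith)
  have hβ1 : 1 ≤ β := by simpa using hβn 1 (by omega)
  let J : ℕ → State F → Prop := fun j s' => s'.idx 10 = j ∧
    (∀ r, 11 ≤ r → r ≠ K + 23 → s'.idx r = s.idx r) ∧
    s'.idx (K + 23) = (if ∀ i : Fin n, j ≤ i → v i = w i then s.idx (K + 23) else 0) ∧
    s'.fldArr = s.fldArr ∧ s'.idxArr = s.idxArr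
  have loop : ∀ j ≤ n, ∀ s', J j s' → Ensures (countdown (K + 26) (K + 27) 10
    (.seq (straight [.fldGet 0 x 10, .fldGet 1 y 10])
      (.cond (.fldEq 0 1) .skip (.instr (.idxConst (K + 23) 0))))) s'
      (j * (((5 + 2 * β) + (1 + 1) + 1) + 4 * β + 3) + β + 1) (J 0) := by
    refine Ensures.countdown (N := n) (J := J) hβ1 (fun x hx => hβn x (by omega)) ?_ ?_
    · rintro j s' ⟨h1, h2, -⟩
      exact ⟨(h2 _ (by omega) (by omega)).trans hs.zero,
        (h2 _ (by omega) (by omega)).trans hs.one, h1⟩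
    · rintro j hj s' ⟨h1, h2, h3, h4, h5⟩
      refine Ensures.seq (P := fun s₁ => s₁.idx = Function.update s'.idx 10 j ∧
        s₁.fld 0 = v ⟨j, hj⟩ ∧ s₁.fld 1 = w ⟨j, hj⟩ ∧ s₁.fldArr = s.fldArr ∧
        s₁.idxArr = s.idxArr) ((ensures_straight (by simp [Instr.IsDet]) _).mono ?_ ?_) ?_
      · simp only [costAll, Instr.cost, Instr.exec, Function.update_self]
        have := hβn j (by omega)
        omega
      · rintro s₁ rfl
        simp only [execAll, Instr.exec, Function.update_self, h4, h5, hx, hy, and_true, true_and,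
          getD_ofFn _ hj]
        simp
      · rintro s₁ ⟨h6, h7, h8, h9, h10⟩
        have h11 : s₁.idx (K + 23) = s'.idx (K + 23) := by
          rw [h6, Function.update_of_ne (by omega)]
        have h12 : ∀ r, 11 ≤ r → r ≠ K + 23 → s₁.idx r = s.idx r := fun r hr hr' => by
          rw [h6, Function.update_of_ne (by omega), h2 r hr hr']
        have h13 : (∀ i : Fin n, j ≤ i → v i = w i) ↔
            v ⟨j, hj⟩ = w ⟨j, hj⟩ ∧ ∀ i : Fin n, j + 1 ≤ i → v i = w i := by
          constructor
          · exact fun h => ⟨h _ le_rfl, fun i hi => h i (by omega)⟩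
          · rintro ⟨h, h'⟩ i hi
            by_cases hij : j = i
            · subst hij; exact h
            · exact h' i (by omega)
        refine (Ensures.cond (t := 1) (fun h => Ensures.skip ?_) fun h =>
          (Ensures.instr fun _ => ?_).mono (by simp [Instr.cost]) fun _ h => h).mono
            (by simp [Test.cost]) fun _ h => h
        · simp only [Test.holds, h7, h8, decide_eq_true_eq] at h
          refine ⟨by simp [h6], h12, ?_, h9, h10⟩
          rw [h11, h3]
          simp only [h13, h, true_and]
        · simp only [Test.holds, h7, h8, decide_eq_false_iff_not] at h
          refine ⟨by simp [Instr.exec, h6], fun r hr hr' => ?_, ?_, h9, h10⟩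
          · simp [Instr.exec, hr', h12 r hr hr']
          · simp [Instr.exec, h13, h]
  refine (Ensures.seq (P := J n) (t₁ := 1 + β) (Ensures.mono (Ensures.instr fun _ => ?_) ?_ fun _ h => h)
    fun s' h => loop n le_rfl s' h).mono ?_ ?_
  · refine ⟨by simp [Instr.exec, hn], fun r hr hr' => ?_, ?_, rfl, rfl⟩
    · simp (disch := omega) only [Instr.exec, Function.update_of_ne]
    · rw [if_pos fun i hi => absurd i.2 (by omega)]
      simp [Instr.exec]
  · simpa [Instr.cost, hn] using hβn n (by omega)
  · nlinarith [Nat.mul_le_mul_left n hβ1]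
  · rintro s' ⟨-, h1, h2, h3⟩
    refine ⟨h1, ?_, h3⟩
    rw [h2]
    simp [funext_iff]

end RAM

/-! ### The product of hidden strips -/

section Window

variable {F : Type*} [Field F] {n m : ℕ}

theorem putRows_getRows_apply {σ δ : ℕ} (hσ : σ + m ≤ n) (A R : Matrix (Fin n) (Fin n) F)
    (i j : Fin n) : putRows δ (getRows m σ A) R i j =
      if δ ≤ i ∧ i < δ + m then (matrixEntries A).getD ((σ + (i - δ)) * n + j) 0 else R i j := by
  simp only [putRows, getRows]
  split_ifs with h1 h2
  · rw [getD_matrixEntries' A h2 j.2]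
  · omega
  · rfl

/-- An entry of a product involves one row of the left and one column of the right factor. Within
the window at `(δ, δ)` both belong to the hidden strips, so the random filling `R`, `R'` has no
influence. -/
theorem mul_putStrips_apply {σ τ δ : ℕ} (hσ : σ + m ≤ n) (hτ : τ + m ≤ n) (hδ : δ + m ≤ n)
    (A B R R' : Matrix (Fin n) (Fin n) F) {i j : Fin n} (hi : σ ≤ i ∧ i < σ + m)
    (hj : τ ≤ j ∧ j < τ + m) :
    (putRows δ (getRows m σ A) R * (putRows δ (getRows m τ B.transpose) R'.transpose).transpose)
      ⟨δ + (i - σ), by omega⟩ ⟨δ + (j - τ), by omega⟩ = (A * B) i j := by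
  simp only [Matrix.mul_apply, Matrix.transpose_apply]
  refine Finset.sum_congr rfl fun t _ => ?_
  have h1 : putRows δ (getRows m σ A) R ⟨δ + (i - σ), by omega⟩ t = A i t := by
    rw [putRows_getRows_apply hσ, if_pos (by simp; omega),
      getD_matrixEntries' A (by simp; omega) t.2]
    congr 1
    ext; simp; omega
  have h2 : putRows δ (getRows m τ B.transpose) R'.transpose ⟨δ + (j - τ), by omega⟩ t = B t j := by
    rw [putRows_getRows_apply hτ, if_pos (by simp; omega),
      getD_matrixEntries' B.transpose (by simp; omega) t.2, Matrix.transpose_apply]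
    congr 1
    ext; simp; omega
  rw [h1, h2]

end Window

/-! ### One call of the given program on hidden strips -/

namespace RAM

variable {F : Type*} [Field F] [Fintype F] [DecidableEq F]

/-- Numbers that bound the sizes of index registers (`β`) and the time for elementary matrix
operations (`U`). -/
structure Bounds (n k L T β U : ℕ) : Prop where
  size_le : ∀ x ≤ (n + 1) ^ 2 + k + L, x.size ≤ β
  le_unit : β * (n + 1) ^ 2 + T ≤ U

namespace Bounds

variable {n k L T β U : ℕ} (h : Bounds n k L T β U)
include h

theorem size_sq : ∀ x ≤ (n + 1) ^ 2, x.size ≤ β := fun x hx => h.size_le x (by omega)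

theorem one_le : 1 ≤ β := by simpa using h.size_sq 1 (Nat.one_le_pow _ _ (by omega))

theorem mul_le : β * (n + 1) ^ 2 ≤ U := le_trans (by omega) h.le_unit

theorem le : β ≤ U := le_trans (Nat.le_mul_of_pos_right _ (by positivity)) h.mul_le

theorem cells : n * n + T + 1 ≤ U := by
  have := h.one_le
  have := h.le_unit
  nlinarith

theorem fill_le : 4 * (n * n + T) + 20 + 10 * β * (n * n + 1) ≤ 34 * U := by
  have h1 := h.cells
  have h2 := h.mul_le
  have h3 : 10 * β * (n * n + 1) ≤ 10 * (β * (n + 1) ^ 2) := by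
    rw [mul_assoc]; gcongr; nlinarith
  omega

theorem transfer_le : 80 * β * (n + 1) ^ 2 ≤ 80 * U := by
  rw [mul_assoc]
  exact Nat.mul_le_mul_left _ h.mul_le

end Bounds

/-- The persistent part of the memory. -/
structure Env (K n m L T : ℕ) (A B : Matrix (Fin n) (Fin n) F) (s : State F) : Prop where
  -- Index registers: `K + 20` is the place of hiding, `K + 21` and `K + 22` are the corner of the
  -- window, `K + 23` is the verdict of the check, `K + 24` and `K + 25` count checks and attempts.
  -- Field arrays: `K + 24` is the working matrix, `K + 25` to `K + 28` are the summands of `A` and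
  -- `B`, `K + 20` to `K + 23` are vectors for the check. The `T` in the length bounds allows for
  -- the remains of a call.
  units : HasUnits K s
  dim : s.idx (K + 28) = n
  square : s.idx (K + 29) = n * n
  width : s.idx (K + 30) = m
  gap : s.idx (K + 31) = n - m
  rounds : s.idx (K + 32) = L
  left : s.fldArr (K + 29) = matrixEntries A
  right : s.fldArr (K + 30) = matrixEntries B
  work : (s.fldArr (K + 24)).length = n * n
  fldShort : ∀ a, (s.fldArr a).length ≤ n * n + T
  idxShort : ∀ a < K + 20, (s.idxArr a).length ≤ n * n + T

theorem Env.of_same {K n m L T d e : ℕ} {A B : Matrix (Fin n) (Fin n) F} {s s' : State F}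
    (h : Env K n m L T A B s) (hs : SameFrom d e s s') (hw : (s'.fldArr (K + 24)).length = n * n)
    (hf : ∀ a, (s'.fldArr a).length ≤ n * n + T)
    (hi : ∀ a < K + 20, (s'.idxArr a).length ≤ n * n + T)
    (hd : d ≤ K + 26 := by omega) (he : e ≤ K + 29 := by omega) : Env K n m L T A B s' :=
  ⟨h.units.of_idx hs.idx, (hs.idx _ (by omega)).trans h.dim, (hs.idx _ (by omega)).trans h.square,
    (hs.idx _ (by omega)).trans h.width, (hs.idx _ (by omega)).trans h.gap,
    (hs.idx _ (by omega)).trans h.rounds, (hs.arr _ (by omega)).trans h.left,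
    (hs.arr _ (by omega)).trans h.right, hw, hf, hi⟩

theorem Env.writes {K n m L T d a : ℕ} {A B : Matrix (Fin n) (Fin n) F} {s s' : State F}
    {l : List F} (h : Env K n m L T A B s) (hs : Writes d a l s s') (hl : l.length ≤ n * n + T)
    (hw : a = K + 24 → l.length = n * n)
    (hd : d ≤ K + 26 := by omega) (ha : a ≤ K + 28 := by omega) : Env K n m L T A B s' := by
  refine h.of_same hs.sameFrom ?_ (fun b => ?_) (by rw [hs.idxArr]; exact h.idxShort)
  · by_cases hb : K + 24 = a
    · rw [hb, hs.self, hw hb.symm]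
    · rw [hs.other hb, h.work]
  · by_cases hb : b = a
    · rw [hb, hs.self]; exact hl
    · rw [hs.other hb]; exact h.fldShort b

theorem expect_coin_snd (φ : Bool → ℝ) :
    𝔼 coin : F × Bool, φ coin.2 = (φ true + φ false) * (1 / 2) := by
  rw [← Finset.univ_product_univ, Finset.expect_product]
  simp only []
  rw [Fintype.expect_const, Fintype.expect_eq_sum_div_card]
  simp [div_eq_mul_inv]

/-- Choose one of `k` places for strips of matrices at random; the register `K + 20` receives its
first row. -/
def pick (K : ℕ) : ℕ → Prog F
  | 0 => .instr (.idxConst (K + 20) 0)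
  | j + 1 => .seq (.instr (.flip 0)) (.cond (.idxLt (K + 26) 0)
      (straight [.idxConst 0 j, .idxArith .times (K + 20) 0 (K + 30)]) (pick K j))

/-- What `pick` may change. -/
structure Picked (K m k : ℕ) (s s' : State F) : Prop where
  place : ∃ i < k, s'.idx (K + 20) = i * m
  idx : ∀ r, 1 ≤ r → r ≠ K + 20 → s'.idx r = s.idx r
  fldArr : s'.fldArr = s.fldArr
  idxArr : s'.idxArr = s.idxArr

/-- Successive coin flips decide whether to stop at the places from `j - 1` downwards. The choice is
not uniform, but every place has probability at least `(1/2)^j`, and only a positive constant is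
needed. -/
theorem succeeds_pick {K m k β j : ℕ} {s : State F} (hs : HasUnits K s) (hk : 0 < k)
    (hm : s.idx (K + 30) = m) (hβ : ∀ x ≤ k * m + k + m, x.size ≤ β) (hβ1 : 1 ≤ β) (hj : j ≤ k)
    (i : ℕ) (hi : i < j ∨ j = 0 ∧ i = 0) :
    Succeeds (pick K j) s ((j + 1) * (15 * β)) (Picked K m k s)
      (fun s' => s'.idx (K + 20) = i * m) ((1 / 2) ^ j) := by
  classical
  induction j generalizing s i with
  | zero =>
    obtain rfl : i = 0 := by omega
    rw [pow_zero]
    refine Succeeds.of_ensures_good ((Ensures.instr fun _ => ?_).mono ?_ fun _ h => h)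
    · exact ⟨⟨⟨0, hk, by simp [Instr.exec]⟩, fun r _ hr => by simp [Instr.exec, hr], rfl, rfl⟩,
        by simp [Instr.exec]⟩
    · simp [Instr.cost]; omega
  | succ j ih =>
    have hjβ := hβ j (by omega)
    have hmβ := hβ m (by omega)
    have hjmβ := hβ (j * m) (by have := Nat.mul_le_mul_right m (show j ≤ k by omega); omega)
    have hlast : ∀ s' : State F, HasUnits K s' → s'.idx (K + 30) = m →
        Ensures (straight [.idxConst 0 j, .idxArith .times (K + 20) 0 (K + 30)]) s'
          ((j + 1) * (15 * β)) fun s'' => Picked K m k s' s'' ∧ s''.idx (K + 20) = j * m := by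
      intro s' _ hm'
      refine (ensures_straight (by simp [Instr.IsDet]) s').mono ?_ ?_
      · simp (disch := omega) only [costAll, Instr.cost, Instr.exec, IdxOp.eval,
          Function.update_self, Function.update_of_ne, hm']
        nlinarith
      · rintro s'' rfl
        have h1 : (execAll [.idxConst 0 j, .idxArith .times (K + 20) 0 (K + 30)] s').idx (K + 20) =
            j * m := by
          simp [execAll, Instr.exec, hm', IdxOp.eval]
        refine ⟨⟨⟨j, by omega, h1⟩, fun r hr hr' => ?_, rfl, rfl⟩, h1⟩
        simp (disch := omega) only [execAll, Instr.exec, Function.update_of_ne]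
    have hpick : ∀ s' : State F, HasUnits K s' → s'.idx (K + 30) = m →
        Ensures (pick K j) s' ((j + 1) * (15 * β)) (Picked K m k s') := by
      intro s' hu hm'
      rcases Nat.eq_zero_or_pos j with rfl | hj0
      · exact (ih hu hm' (by omega) 0 (by simp)).ensures
      · exact (ih hu hm' (by omega) 0 (by simp [hj0])).ensures
    have hafter : ∀ (s' : State F) (x : Bool),
        s' = { s with idx := Function.update s.idx 0 x.toNat } →
        Succeeds (.cond (.idxLt (K + 26) 0)
          (straight [.idxConst 0 j, .idxArith .times (K + 20) 0 (K + 30)]) (pick K j)) s'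
          (2 + (j + 1) * (15 * β)) (Picked K m k s) (fun s'' => s''.idx (K + 20) = i * m)
          -- Only the bit that keeps place `i` reachable receives credit: stopping now if `i = j`,
          -- going on otherwise.
          (if x = decide (i = j) then (1 / 2) ^ j else 0) := by
      rintro s' x rfl
      have hu : HasUnits K { s with idx := Function.update s.idx 0 x.toNat } :=
        ⟨by simp [hs.zero], by simp [hs.one]⟩
      have hm' : (Function.update s.idx 0 x.toNat) (K + 30) = m := by simp [hm]
      have hpk : ∀ s'', Picked K m k { s with idx := Function.update s.idx 0 x.toNat } s'' →
          Picked K m k s s'' := fun s'' h =>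
        ⟨h.place, fun r hr hr' => (h.idx r hr hr').trans (by simp [show r ≠ 0 by omega]),
          h.fldArr, h.idxArr⟩
      refine Achieves.mono (Achieves.cond (t := (j + 1) * (15 * β)) (fun h => ?_) fun h => ?_)
        (?_ : _ ≤ 2 + (j + 1) * (15 * β)) fun _ _ h => h
      · have hx : x = true := by
          cases x
          · simp [Test.holds, hs.zero] at h
          · rfl
        subst hx
        have h1 := hlast _ hu hm'
        by_cases hij : i = j
        · subst hij
          refine ((Succeeds.of_ensures_good h1).anti ?_).mono le_rfl hpk fun _ _ h => h
          rw [if_pos (by simp)]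
          exact pow_le_one₀ (by norm_num) (by norm_num)
        · exact (Succeeds.of_ensures (h1.mono le_rfl fun _ h => h.1) (by simp [hij])).mono le_rfl
            hpk fun _ _ h => h
      · have hx : x = false := by
          cases x
          · rfl
          · simp [Test.holds, hs.zero] at h
        subst hx
        by_cases hij : i = j
        · exact (Succeeds.of_ensures (hpick _ hu hm') (by simp [hij])).mono le_rfl hpk fun _ _ h => h
        · exact ((ih hu hm' (by omega) i (by omega)).anti (by simp [hij])).mono le_rfl hpk
            fun _ _ h => h
      · cases x <;> simp [Test.cost, hs.zero]
    have hflip : Achieves (.instr (.flip 0)) s 1 (fun s' w => ∃ x : Bool,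
        s' = { s with idx := Function.update s.idx 0 x.toNat } ∧
          w = if x = decide (i = j) then (1 / 2) ^ j else 0) ((1 / 2) ^ (j + 1)) := by
      refine Achieves.instr (fun coin => if coin.2 = decide (i = j) then (1 / 2) ^ j else 0)
        (fun coin => ⟨coin.2, rfl, rfl⟩) ?_
      rw [expect_coin_snd fun x => if x = decide (i = j) then (1 / 2 : ℝ) ^ j else 0, pow_succ]
      by_cases hij : i = j <;> simp [hij]
    refine (hflip.seq fun s' w ⟨x, h1, h2⟩ => h2 ▸ hafter s' x h1).mono ?_ fun _ _ h => h
    nlinarith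

/-- Empty the arrays with names below the given number. -/
def clearAll (K : ℕ) : ℕ → Prog F
  | 0 => .skip
  | b + 1 => .seq (clearAll K b) (.seq (clearFld K b) (clearIdx K b))

/-- The arrays with names below `b` are emptied. -/
structure Cleared (b : ℕ) (s s' : State F) : Prop where
  idx : ∀ r, 1 ≤ r → s'.idx r = s.idx r
  fldArr : s'.fldArr = fun a => if a < b then [] else s.fldArr a
  idxArr : s'.idxArr = fun a => if a < b then [] else s.idxArr a

theorem ensures_clearAll {K b t : ℕ} {s : State F} (hs : HasUnits K s) (ht : ShortBelow b t s) :
    Ensures (clearAll K b) s (b * (8 * t + 22) + 1) (Cleared b s) := by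
  induction b with
  | zero =>
    refine (Ensures.skip (P := Cleared 0 s) ⟨fun _ _ => rfl, by simp, by simp⟩).mono ?_ fun _ h => h
    omega
  | succ b ih =>
    have hb := ht b (by omega)
    refine (Ensures.seq (ih fun a ha => ht a (by omega)) (t₂ := (4 * t + 10) + (4 * t + 10) + 1)
      fun s₁ h₁ => Ensures.seq ((ensures_clearFld (hs.of_idx h₁.idx)).mono ?_ fun _ h => h)
      fun s₂ h₂ => ((ensures_clearIdx ((hs.of_idx h₁.idx).of_idx h₂.idx)).mono ?_ ?_)).mono ?_
      fun _ h => h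
    · rw [h₁.fldArr]; simp; omega
    · rw [h₂.idxArr, h₁.idxArr]; simp; omega
    · rintro s₃ ⟨h₃, h₄, h₅⟩
      refine ⟨fun r hr => (h₃ r hr).trans ((h₂.idx r hr).trans (h₁.idx r hr)), ?_, ?_⟩
      · rw [h₄, h₂.fldArr, h₁.fldArr]
        ext1 a
        by_cases ha : a = b
        · subst ha; simp
        · simp only [ne_eq, ha, not_false_eq_true, Function.update_of_ne]
          exact if_congr (by omega) rfl rfl
      · rw [h₅, h₂.idxArr, h₁.idxArr]
        ext1 a
        by_cases ha : a = b
        · subst ha; simp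
        · simp only [ne_eq, ha, not_false_eq_true, Function.update_of_ne]
          exact if_congr (by omega) rfl rfl
    · rw [add_mul, one_mul]; omega

/-- Set the registers with names below the given number to zero. -/
def resetRegs : ℕ → Prog F
  | 0 => .skip
  | b + 1 => .seq (resetRegs b) (straight [.idxConst b 0, .fldConst b 0])

/-- The registers with names below `b` are set to zero. -/
structure Reset (b : ℕ) (s s' : State F) : Prop where
  idx : s'.idx = fun r => if r < b then 0 else s.idx r
  fld : s'.fld = fun r => if r < b then 0 else s.fld r
  fldArr : s'.fldArr = s.fldArr
  idxArr : s'.idxArr = s.idxArr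

theorem ensures_resetRegs {b : ℕ} {s : State F} :
    Ensures (resetRegs b) s (b * 6 + 1) (Reset b s) := by
  induction b with
  | zero => exact Ensures.skip (P := Reset 0 s) ⟨by simp, by simp, rfl, rfl⟩
  | succ b ih =>
    refine (Ensures.seq ih fun s₁ h₁ => (ensures_straight (by simp [Instr.IsDet]) s₁).mono
      (t' := 5) (by simp [costAll, Instr.cost]) ?_).mono (by omega) fun _ h => h
    rintro s₂ rfl
    refine ⟨?_, ?_, h₁.fldArr, h₁.idxArr⟩
    · ext1 a
      by_cases ha : a = b
      · subst ha; simp [execAll, Instr.exec]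
      · simp only [execAll, Instr.exec, h₁.idx, ne_eq, ha, not_false_eq_true, Function.update_of_ne]
        exact if_congr (by omega) rfl rfl
    · ext1 a
      by_cases ha : a = b
      · subst ha; simp [execAll, Instr.exec]
      · simp only [execAll, Instr.exec, h₁.fld, ne_eq, ha, not_false_eq_true, Function.update_of_ne]
        exact if_congr (by omega) rfl rfl

/-- The probability that the program `p` multiplies the two matrices correctly. -/
noncomputable def mulProb (p : Prog F) {n : ℕ}
    (XY : Matrix (Fin n) (Fin n) F × Matrix (Fin n) (Fin n) F) : ℝ :=
  (haltProb p (pairInput XY.1 XY.2) (outputsMatrix (XY.1 * XY.2))).toReal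

theorem mulProb_nonneg (p : Prog F) {n : ℕ}
    (XY : Matrix (Fin n) (Fin n) F × Matrix (Fin n) (Fin n) F) : 0 ≤ mulProb p XY :=
  ENNReal.toReal_nonneg

theorem mulProb_le_one (p : Prog F) {n : ℕ}
    (XY : Matrix (Fin n) (Fin n) F × Matrix (Fin n) (Fin n) F) : mulProb p XY ≤ 1 :=
  ENNReal.toReal_le_of_le_ofReal zero_le_one (by simpa using haltProb_le_one _ _ _)

/-- Call `p` on the matrices in the arrays `0` and `1` and combine the entries of the product in the
square window at `K + 20` with the window of the working matrix `K + 24` whose corner is in the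
registers `K + 21` and `K + 22`. -/
def invoke (K : ℕ) (p : Prog F) (comb : Instr F) : Prog F :=
  .seq (resetRegs (K + 20)) (.seq (.instr (.idxMove 0 (K + 28))) (.seq p
    (transfer K 2 (K + 24) (K + 20) (K + 20) (K + 21) (K + 22) (K + 30) (K + 30) comb)))

/-- Hide the strips of two matrices in random matrices, and call `p` on these. -/
def query (K : ℕ) (p : Prog F) (src₁ src₂ : ℕ) (comb : Instr F) : Prog F :=
  .seq (clearAll K (K + 20)) (.seq (fill K 0 (K + 29)) (.seq (fill K 1 (K + 29))
    (.seq (transfer K src₁ 0 (K + 21) (K + 26) (K + 20) (K + 26) (K + 30) (K + 28) (.fldMove 2 1))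
      (.seq (transfer K src₂ 1 (K + 26) (K + 22) (K + 26) (K + 20) (K + 28) (K + 30)
        (.fldMove 2 1)) (invoke K p comb)))))

/-- The window of `W` with corner `(σ, τ)` combined with the window of `P`. -/
def window {n : ℕ} (m σ τ : ℕ) (op : F → F → F) (W P : Matrix (Fin n) (Fin n) F) :
    Matrix (Fin n) (Fin n) F := fun i j =>
  if (σ ≤ i ∧ i < σ + m) ∧ (τ ≤ j ∧ j < τ + m) then op (W i j) (P i j) else W i j

/-- The window of the product with corner `(σ, τ)` is computed with a window with corner
`(δ, δ)`. -/
structure Corners (K n m σ τ δ : ℕ) (s : State F) : Prop where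
  row : s.idx (K + 21) = σ
  col : s.idx (K + 22) = τ
  place : s.idx (K + 20) = δ
  row_le : σ + m ≤ n
  col_le : τ + m ≤ n
  place_le : δ + m ≤ n

theorem Corners.of_idx {K n m σ τ δ : ℕ} {s s' : State F} (h : Corners K n m σ τ δ s)
    (hs : ∀ r, K + 20 ≤ r → s'.idx r = s.idx r) : Corners K n m σ τ δ s' :=
  ⟨(hs _ (by omega)).trans h.row, (hs _ (by omega)).trans h.col, (hs _ (by omega)).trans h.place,
    h.row_le, h.col_le, h.place_le⟩

/-- After the reset, the memory agrees with `pairInput X Y` on all names that `p` can mention, so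
`p` behaves as on that input. Everything persistent has names from `K + 20` on and survives; the
arrays below grow by at most `T`. -/
theorem succeeds_invoke {K n m L T k β U σ τ δ : ℕ} {A B X Y W : Matrix (Fin n) (Fin n) F}
    {p : Prog F} {comb : Instr F} {op : F → F → F} {s : State F} (hb : Bounds n k L T β U)
    (hp : p.names ≤ K + 20) (hT : HaltsWithin p (pairInput X Y) T)
    (hs : Env K n m L T A B s) (hc : Corners K n m σ τ δ s) (hcomb : Combines comb op)
    (hX : s.fldArr 0 = matrixEntries X) (hY : s.fldArr 1 = matrixEntries Y)
    (hf : ∀ a, 2 ≤ a → a < K + 20 → s.fldArr a = []) (hi : ∀ a < K + 20, s.idxArr a = [])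
    (hW : s.fldArr (K + 24) = matrixEntries W) :
    Succeeds (invoke K p comb) s ((6 * K + 250) * U)
      (fun s' => SameFrom (K + 20) (K + 25) s s' ∧ Env K n m L T A B s')
      (fun s' => s'.fldArr (K + 24) = matrixEntries (fun i j : Fin n =>
        if (σ ≤ i ∧ i < σ + m) ∧ (τ ≤ j ∧ j < τ + m) then
          op (W i j) ((matrixEntries (X * Y)).getD ((δ + (i - σ)) * n + (δ + (j - τ))) 0)
        else W i j)) (mulProb p (X, Y)) := by
  have hU := hb.cells
  have hβU := hb.le
  have hnβ := hb.size_sq n (by nlinarith)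
  refine (Ensures.seq_succeeds ensures_resetRegs fun s₁ h₁ => Ensures.seq_succeeds (t₁ := 1 + β)
    (t₂ := T + 80 * U + 1)
    (I := fun s₂ => AgreeBelow (K + 20) (pairInput X Y) s₂ ∧ SameFrom (K + 20) 0 s s₂ ∧
      s₂.idxArr = s.idxArr)
    ((Ensures.instr fun _ => ?_).mono ?_ fun _ h => h) fun s₂ ⟨h₂, h₃, h₄⟩ => ?_).mono ?_
    (fun _ h => h) (fun _ _ h => h)
  · refine ⟨⟨?_, ?_, ?_, ?_⟩, ⟨?_, ?_⟩, ?_⟩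
    · intro r hr
      by_cases hr0 : r = 0
      · subst hr0
        simp [Instr.exec, h₁.idx, pairInput, sizeInput, hs.dim]
      · simp [Instr.exec, h₁.idx, pairInput, sizeInput, State.blank, hr0, hr]
    · intro r hr
      simp [Instr.exec, h₁.fld, pairInput, sizeInput, State.blank, hr]
    · intro a ha
      simp [Instr.exec, h₁.idxArr, pairInput, sizeInput, State.blank, hi a ha]
    · intro a ha
      simp only [Instr.exec, h₁.fldArr, pairInput]
      by_cases ha1 : a = 1
      · subst ha1; simp [hY]
      · by_cases ha0 : a = 0
        · subst ha0; simp [hX]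
        · simp [ha1, ha0, hf a (by omega) ha]
    · intro r hr
      simp [Instr.exec, h₁.idx, show r ≠ 0 by omega, show ¬ r < K + 20 by omega]
    · intro a _
      simp [Instr.exec, h₁.fldArr]
    · simp [Instr.exec, h₁.idxArr]
  · simp [Instr.cost, h₁.idx, hs.dim, hnβ]
  · have hshort : ShortBelow (K + 20) (n * n) s₂ := by
      intro a ha
      rw [h₄, hi a ha, h₃.arr a (by omega)]
      refine ⟨by simp, ?_⟩
      by_cases ha1 : a = 1
      · subst ha1; simp [hY]
      · by_cases ha0 : a = 0
        · subst ha0; simp [hX]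
        · simp [hf a (by omega) ha]
    have hrun := hT.succeeds hp h₂ hshort (outputsMatrix (X * Y))
    have hafter : ∀ s₃, (SameFrom (K + 20) (K + 20) s₂ s₃ ∧ ShortBelow (K + 20) (n * n + T) s₃ ∧
        ∃ s₀', AgreeBelow (K + 20) s₀' s₃) →
        Ensures (transfer K 2 (K + 24) (K + 20) (K + 20) (K + 21) (K + 22) (K + 30) (K + 30) comb)
          s₃ (80 * U) fun s₄ => (SameFrom (K + 20) (K + 25) s s₄ ∧ Env K n m L T A B s₄) ∧
            s₄.fldArr (K + 24) = matrixEntries (fun i j : Fin n =>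
              if (σ ≤ i ∧ i < σ + m) ∧ (τ ≤ j ∧ j < τ + m) then
                op (W i j) ((s₃.fldArr 2).getD ((δ + (i - σ)) * n + (δ + (j - τ))) 0)
              else W i j) := by
      rintro s₃ ⟨h₅, h₆, -⟩
      have h₇ : SameFrom (K + 20) (K + 20) s s₃ := (h₃.trans h₅).mono (by simp) (by simp)
      have hs₃ : Env K n m L T A B s₃ := by
        refine hs.of_same h₇ ?_ (fun a => ?_) fun a ha => (h₆ a ha).1
        · rw [h₇.arr _ (by omega), hs.work]
        · by_cases ha : a < K + 20
          · exact (h₆ a ha).2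
          · rw [h₇.arr _ (by omega)]; exact hs.fldShort a
      have hc₃ := hc.of_idx h₇.idx
      refine (ensures_transferMatrix (Y := W) hcomb (by omega) ⟨hs₃.units, hs₃.dim, hc₃.place,
        hc₃.place, hc₃.row, hc₃.col, hs₃.width, hs₃.width, by omega, hs₃.work⟩ hb.size_sq hc.place_le
        hc.place_le hc.row_le hc.col_le (by rw [h₇.arr _ (by omega), hW])).mono hb.transfer_le ?_
      intro s₄ h₈
      refine ⟨⟨(h₇.trans h₈.sameFrom).mono (by omega) (by omega),
        hs₃.writes h₈ ((length_matrixEntries _).le.trans (Nat.le_add_right _ _))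
          fun _ => length_matrixEntries _⟩, h₈.self⟩
    refine (Succeeds.seq hrun (fun s₃ h => (hafter s₃ h).mono le_rfl fun _ h => h.1)
      (fun s₃ h ⟨s₀', h₅, h₆⟩ => Succeeds.of_ensures_good ((hafter s₃ h).mono le_rfl
        fun s₄ h₇ => ⟨h₇.1, ?_⟩)) zero_le_one).anti (by simp [mulProb])
    rw [h₇.2, h₆.fldArr 2 (by omega), h₅]
  · nlinarith

/-- Both matrices are filled with random entries entirely, and the strips are written over them
afterwards. The input of `p` is thus `putStrips` applied to a uniform pair, and averaging over the
filling gives the stated expectation. -/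
theorem succeeds_query {K n m L T k β U σ τ δ src₁ src₂ : ℕ}
    {A B A' B' W : Matrix (Fin n) (Fin n) F}
    {p : Prog F} {comb : Instr F} {op : F → F → F} {s : State F} (hb : Bounds n k L T β U)
    (hp : p.names ≤ K + 20)
    (hT : ∀ X Y : Matrix (Fin n) (Fin n) F, HaltsWithin p (pairInput X Y) T)
    (hs : Env K n m L T A B s) (hc : Corners K n m σ τ δ s) (hcomb : Combines comb op)
    (hsrc₁ : K + 25 ≤ src₁) (hsrc₂ : K + 25 ≤ src₂)
    (hA' : s.fldArr src₁ = matrixEntries A') (hB' : s.fldArr src₂ = matrixEntries B')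
    (hW : s.fldArr (K + 24) = matrixEntries W) :
    Succeeds (query K p src₁ src₂ comb) s ((30 * K + 1200) * U)
      (fun s' => SameFrom (K + 20) (K + 25) s s' ∧ Env K n m L T A B s')
      (fun s' => s'.fldArr (K + 24) = matrixEntries (window m σ τ op W (A' * B')))
      (𝔼 X, mulProb p (putStrips δ δ (getStrips m σ τ (A', B')) X)) := by
  classical
  have hU := hb.cells
  have hm : m ≤ n := by have := hc.row_le; omega
  have hcells : ∀ x ≤ n * n + 1, x.size ≤ β := fun x hx => hb.size_sq x (by nlinarith)
  -- With the filling `R`, `R'` fixed, the remaining randomness is that of `p`.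
  have hrest : ∀ (R R' : Matrix (Fin n) (Fin n) F) (s₃ : State F), Env K n m L T A B s₃ →
      SameFrom (K + 20) (K + 20) s s₃ → s₃.fldArr 0 = matrixEntries R →
      s₃.fldArr 1 = matrixEntries R' → (∀ a, 2 ≤ a → a < K + 20 → s₃.fldArr a = []) →
      (∀ a < K + 20, s₃.idxArr a = []) →
      Succeeds (.seq
        (transfer K src₁ 0 (K + 21) (K + 26) (K + 20) (K + 26) (K + 30) (K + 28) (.fldMove 2 1))
        (.seq (transfer K src₂ 1 (K + 26) (K + 22) (K + 26) (K + 20) (K + 28) (K + 30)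
          (.fldMove 2 1)) (invoke K p comb))) s₃ ((6 * K + 420) * U)
      (fun s' => SameFrom (K + 20) (K + 25) s s' ∧ Env K n m L T A B s')
      (fun s' => s'.fldArr (K + 24) = matrixEntries (window m σ τ op W (A' * B')))
      (mulProb p (putStrips δ δ (getStrips m σ τ (A', B')) (R, R'))) := by
    intro R R' s₃ hs₃ h₃ hR hR' hf hi
    have hc₃ := hc.of_idx h₃.idx
    refine (Ensures.seq_succeeds ((ensures_transferMatrix (src := src₁) (dst := 0) (Y := R)
      combines_move (by omega)
      ⟨hs₃.units, hs₃.dim, hc₃.row, hs₃.units.zero, hc₃.place, hs₃.units.zero, hs₃.width, hs₃.dim,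
        by omega, by simp [hR]⟩ hb.size_sq hc.row_le (by omega) hc.place_le (by omega) hR).mono
          hb.transfer_le fun _ h => h) (fun s₄ h₄ => ?_) (t₂ := 80 * U + (6 * K + 250) * U + 1)).mono (by nlinarith)
          (fun _ h => h) fun _ _ h => h
    have hs₄ : Env K n m L T A B s₄ := hs₃.writes h₄ ((length_matrixEntries _).le.trans (Nat.le_add_right _ _)) (by omega)
    have h₄' : SameFrom (K + 20) (K + 20) s s₄ :=
      (h₃.trans h₄.sameFrom).mono (by omega) (by omega)
    have hc₄ := hc.of_idx h₄'.idx
    have hX : s₄.fldArr 0 = matrixEntries (putRows δ (getRows m σ A') R) := by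
      rw [h₄.self]
      congr 1
      ext i j
      rw [putRows_getRows_apply hc.row_le, h₃.arr _ (by omega), hA']
      simp
    refine (Ensures.seq_succeeds ((ensures_transferMatrix (src := src₂) (dst := 1) (Y := R')
      combines_move (by omega)
      ⟨hs₄.units, hs₄.dim, hs₄.units.zero, hc₄.col, hs₄.units.zero, hc₄.place, hs₄.dim, hs₄.width,
        by omega, by simp [h₄.other, hR']⟩ hb.size_sq (by omega) hc.col_le (by omega) hc.place_le
        (by simp [h₄.other, hR'])).mono hb.transfer_le fun _ h => h) fun s₅ h₅ => ?_)
    have hs₅ : Env K n m L T A B s₅ := hs₄.writes h₅ ((length_matrixEntries _).le.trans (Nat.le_add_right _ _)) (by omega)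
    have h₅' : SameFrom (K + 20) (K + 20) s s₅ :=
      (h₄'.trans h₅.sameFrom).mono (by omega) (by omega)
    have hc₅ := hc.of_idx h₅'.idx
    have hY : s₅.fldArr 1 = matrixEntries
        (putRows δ (getRows m τ B'.transpose) R'.transpose).transpose := by
      rw [h₅.self]
      congr 1
      ext i j
      rw [Matrix.transpose_apply, putRows_getRows_apply hc.col_le, h₄'.arr _ (by omega), hB',
        Matrix.transpose_apply]
      simp only [Nat.zero_le, zero_add, Fin.is_lt, and_self, true_and, Nat.sub_zero]
      split_ifs with h
      · have h6 : τ + (j - δ) < n := by have := hc.col_le; omega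
        rw [getD_matrixEntries' B' i.2 h6, getD_matrixEntries' B'.transpose h6 i.2]
        rfl
      · rfl
    refine (succeeds_invoke (W := W) hb hp (hT _ _) hs₅ hc₅ hcomb (h₅.other (by omega) |>.trans hX) hY
      (fun a ha ha' => ?_) (fun a ha => ?_) ?_).mono le_rfl (fun s₆ h => ?_) fun s₆ _ h => ?_
    · rw [h₅.other (by omega), h₄.other (by omega), hf a ha ha']
    · rw [h₅.idxArr, h₄.idxArr, hi a ha]
    · rw [h₅'.arr _ (by omega), hW]
    · exact ⟨(h₅'.trans h.1).mono (by omega) (by omega), h.2⟩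
    · rw [h]
      congr 1
      ext i j
      simp only [window]
      split_ifs with hij
      · have h7 : δ + (i - σ) < n := by have := hc.place_le; omega
        have h8 : δ + (j - τ) < n := by have := hc.place_le; omega
        rw [getD_matrixEntries' _ h7 h8,
          mul_putStrips_apply hc.row_le hc.col_le hc.place_le A' B' R R' hij.1 hij.2]
      · rfl
  have hshort : ShortBelow (K + 20) (n * n + T) s := fun a ha => ⟨hs.idxShort a ha, hs.fldShort a⟩
  rw [← Finset.univ_product_univ, Finset.expect_product]
  refine Achieves.mono (Ensures.seq_achieves (ensures_clearAll hs.units hshort) fun s₁ h₁ => ?_)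
    (t := (K + 20) * (8 * (n * n + T) + 22) + 1 + (34 * U + (34 * U + (6 * K + 420) * U + 1) + 1) + 1)
    ?_ fun _ _ h => h
  swap
  · have : (K + 20) * (8 * (n * n + T) + 22) ≤ (K + 20) * (22 * U) := Nat.mul_le_mul_left _ (by omega)
    nlinarith
  have h₁' : SameFrom (K + 20) (K + 20) s s₁ :=
    ⟨fun r hr => h₁.idx r (by omega), fun a ha => by rw [h₁.fldArr]; exact if_neg (by omega)⟩
  have hs₁ : Env K n m L T A B s₁ := by
    refine hs.of_same h₁' (by rw [h₁'.arr _ (by omega), hs.work]) (fun a => ?_) fun a ha => ?_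
    · rw [h₁.fldArr]
      dsimp only
      split_ifs
      · simp
      · exact hs.fldShort a
    · simp [h₁.idxArr, ha]
  refine Achieves.seq ((achieves_fillMatrix hs₁.units (by omega) hs₁.square hcells
    fun R => 𝔼 R', mulProb p (putStrips δ δ (getStrips m σ τ (A', B')) (R, R'))).mono
    (by have := hs₁.fldShort 0; have := hb.fill_le; omega) fun _ _ h => h) ?_
  rintro s₂ w ⟨R, h₂, rfl⟩
  have hs₂ : Env K n m L T A B s₂ := hs₁.writes h₂ (by simp) (by omega)
  refine Achieves.seq ((achieves_fillMatrix hs₂.units (by omega) hs₂.square hcells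
    fun R' => mulProb p (putStrips δ δ (getStrips m σ τ (A', B')) (R, R'))).mono
    (by have := hs₂.fldShort 1; have := hb.fill_le; omega) fun _ _ h => h) ?_
  rintro s₃ w ⟨R', h₃, rfl⟩
  have hs₃ : Env K n m L T A B s₃ := hs₂.writes h₃ (by simp) (by omega)
  refine hrest R R' s₃ hs₃ ?_ ?_ h₃.self ?_ ?_
  · exact (h₁'.trans (h₂.sameFrom.trans h₃.sameFrom)).mono (by omega) (by omega)
  · rw [h₃.other (by omega), h₂.self]
  · intro a ha ha'
    rw [h₃.other (by omega), h₂.other (by omega), h₁.fldArr]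
    simp [ha']
  · intro a ha
    rw [h₃.idxArr, h₂.idxArr, h₁.idxArr]
    simp [ha]

/-- Multiply the strips of two matrices by hiding them at a random place. -/
def mulStrips (K k : ℕ) (p : Prog F) (src₁ src₂ : ℕ) (comb : Instr F) : Prog F :=
  .seq (pick K k) (query K p src₁ src₂ comb)

/-- For some of the `k` places, the program `p` multiplies the strips correctly with probability at
least `δ` if they are hidden there. -/
def GoodStrips (p : Prog F) {n m : ℕ} (k : ℕ) (δ : ℝ)
    (z : (Fin m → Fin n → F) × (Fin m → Fin n → F)) : Prop :=
  ∃ i < k, δ ≤ 𝔼 X, mulProb p (putStrips (i * m) (i * m) z X)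

/-- The fixed data of the reduction. -/
structure Setting (p : Prog F) (K n m L T k β U : ℕ) : Prop where
  bounds : Bounds n k L T β U
  names : p.names ≤ K + 20
  halts : ∀ X Y : Matrix (Fin n) (Fin n) F, HaltsWithin p (pairInput X Y) T
  places : 0 < k
  fits : k * m ≤ n

theorem Setting.width_le {p : Prog F} {K n m L T k β U : ℕ} (h : Setting p K n m L T k β U) :
    m ≤ n :=
  (Nat.le_mul_of_pos_left m h.places).trans h.fits

/-- A place that witnesses goodness is hit with probability at least `(1/2)^k`, and from there the
call succeeds with probability at least `δ`. The alternative `v ≤ 0` retains the time bound and the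
invariant when nothing is known about the strips. -/
theorem succeeds_mulStrips {K n m L T k β U σ τ src₁ src₂ : ℕ}
    {A B A' B' W : Matrix (Fin n) (Fin n) F}
    {p : Prog F} {comb : Instr F} {op : F → F → F} {s : State F} {δ v : ℝ}
    (hS : Setting p K n m L T k β U)
    (hs : Env K n m L T A B s) (hrow : s.idx (K + 21) = σ) (hcol : s.idx (K + 22) = τ)
    (hσ : σ + m ≤ n) (hτ : τ + m ≤ n) (hcomb : Combines comb op)
    (hsrc₁ : K + 25 ≤ src₁) (hsrc₂ : K + 25 ≤ src₂)
    (hA' : s.fldArr src₁ = matrixEntries A') (hB' : s.fldArr src₂ = matrixEntries B')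
    (hW : s.fldArr (K + 24) = matrixEntries W)
    (hv : v ≤ 0 ∨ (0 ≤ δ ∧ GoodStrips p k δ (getStrips m σ τ (A', B')) ∧ v = (1 / 2) ^ k * δ)) :
    Succeeds (mulStrips K k p src₁ src₂ comb) s ((30 * K + 15 * k + 1300) * U)
      (fun s' => SameFrom (K + 21) (K + 25) s s' ∧ Env K n m L T A B s')
      (fun s' => s'.fldArr (K + 24) = matrixEntries (window m σ τ op W (A' * B'))) v := by
  obtain ⟨hb, hp, hT, hk, hkm⟩ := hS
  have hm : m ≤ n := (Nat.le_mul_of_pos_left m hk).trans hkm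
  have hU := hb.cells
  have hβU := hb.le
  have key : ∀ i < k, ∀ s', Picked K m k s s' → s'.idx (K + 20) = i * m →
      Succeeds (query K p src₁ src₂ comb) s' ((30 * K + 1200) * U)
      (fun s' => SameFrom (K + 21) (K + 25) s s' ∧ Env K n m L T A B s')
      (fun s' => s'.fldArr (K + 24) = matrixEntries (window m σ τ op W (A' * B')))
      (𝔼 X, mulProb p (putStrips (i * m) (i * m) (getStrips m σ τ (A', B')) X)) := by
    intro i hi s' hs' hi'
    have hsame : SameFrom (K + 21) 0 s s' :=
      ⟨fun r hr => hs'.idx r (by omega) (by omega), fun a _ => by rw [hs'.fldArr]⟩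
    have henv : Env K n m L T A B s' := by
      refine hs.of_same hsame ?_ (fun a => ?_) ?_
      · rw [hs'.fldArr, hs.work]
      · rw [hs'.fldArr]; exact hs.fldShort a
      · rw [hs'.idxArr]; exact hs.idxShort
    have hc : Corners K n m σ τ (i * m) s' := by
      refine ⟨(hsame.idx _ (by omega)).trans hrow, (hsame.idx _ (by omega)).trans hcol, hi', hσ, hτ,
        ?_⟩
      have : (i + 1) * m ≤ k * m := Nat.mul_le_mul_right _ hi
      nlinarith
    refine (succeeds_query (W := W) hb hp hT henv hc hcomb hsrc₁ hsrc₂ (by rw [hs'.fldArr, hA'])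
      (by rw [hs'.fldArr, hB']) (by rw [hs'.fldArr, hW])).mono le_rfl (fun s₂ h => ?_)
      fun _ _ h => h
    exact ⟨(hsame.trans h.1).mono (by omega) (by omega), h.2⟩
  have hpick : ∀ i < k, Succeeds (pick K k) s ((k + 1) * (15 * β)) (Picked K m k s)
      (fun s' => s'.idx (K + 20) = i * m) ((1 / 2) ^ k) := fun i hi =>
    succeeds_pick hs.units hk hs.width (fun x hx => hb.size_le x (by nlinarith)) hb.one_le le_rfl i
      (.inl hi)
  have htime : (k + 1) * (15 * β) + (30 * K + 1200) * U + 1 ≤ (30 * K + 15 * k + 1300) * U := by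
    have : (k + 1) * (15 * β) ≤ (k + 1) * (15 * U) := by gcongr
    nlinarith
  have hsure : ∀ s', Picked K m k s s' → Ensures (query K p src₁ src₂ comb) s'
      ((30 * K + 1200) * U) fun s' => SameFrom (K + 21) (K + 25) s s' ∧ Env K n m L T A B s' := by
    intro s' hs'
    obtain ⟨i, hi, hi'⟩ := hs'.place
    exact (key i hi s' hs' hi').ensures
  rcases hv with hv | ⟨hδ, ⟨i, hi, hgood⟩, rfl⟩
  · exact Succeeds.of_ensures ((Ensures.seq (hpick 0 hk).ensures hsure).mono htime fun _ h => h) hv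
  · exact (Succeeds.seq (hpick i hi) hsure (fun s' hs' hi' =>
      (key i hi s' hs' hi').anti hgood) hδ).mono htime (fun _ h => h) fun _ _ h => h

/-! ### Windows of the product from a random splitting -/

/-- Set the register `r` to the start of the strip with number `g`. -/
def corner (K r g : ℕ) : Prog F :=
  .seq (straight [.idxConst 0 g, .idxArith .times r 0 (K + 30)])
    (.cond (.idxLt (K + 31) r) (.instr (.idxMove r (K + 31))) .skip)

/-- The start is cut off at `n - m`, since the strip with number `k` may protrude beyond the matrix.
Moved back, it overlaps its predecessor, which is harmless. -/
theorem ensures_corner {K n m L T k β U g r : ℕ} {A B : Matrix (Fin n) (Fin n) F} {p : Prog F}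
    {s : State F} (hS : Setting p K n m L T k β U) (hs : Env K n m L T A B s) (hg : g ≤ k)
    (hr : K + 21 ≤ r) (hr' : r < K + 26) :
    Ensures (corner K r g) s (30 * U) fun s' => Env K n m L T A B s' ∧
      s'.idx r = min (g * m) (n - m) ∧ (∀ r', 1 ≤ r' → r' ≠ r → s'.idx r' = s.idx r') ∧
      s'.fldArr = s.fldArr := by
  have hb := hS.bounds
  have hm := hS.width_le
  have hgm : g * m ≤ n := (Nat.mul_le_mul_right m hg).trans hS.fits
  have hU := hb.cells
  have hβU := hb.le
  have e1 := hb.size_le g (by omega)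
  have e2 := hb.size_sq m (by nlinarith)
  have e3 := hb.size_sq (g * m) (by nlinarith)
  have e4 := hb.size_sq (n - m) (by have : n - m ≤ n := by omega
                                    nlinarith)
  refine (Ensures.seq (t₁ := 10 * U) (t₂ := 10 * U) (P := fun s₁ => s₁.idx r = g * m ∧
    (∀ r', 1 ≤ r' → r' ≠ r → s₁.idx r' = s.idx r') ∧ s₁.fldArr = s.fldArr ∧
    s₁.idxArr = s.idxArr) ?_ ?_).mono (by omega) fun _ h => h
  · refine (ensures_straight (by simp [Instr.IsDet]) s).mono ?_ ?_
    · simp (disch := omega) only [costAll, Instr.cost, Instr.exec, IdxOp.eval,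
        Function.update_self, Function.update_of_ne, hs.width]
      omega
    · rintro s' rfl
      refine ⟨?_, fun r' h h' => ?_, rfl, rfl⟩
      · simp (disch := omega) only [execAll, Instr.exec, IdxOp.eval,
          Function.update_self, Function.update_of_ne, hs.width]
      · simp (disch := omega) only [execAll, Instr.exec, Function.update_of_ne]
  · rintro s₁ ⟨h1, h2, h3, h4⟩
    have h5 : s₁.idx (K + 31) = n - m := (h2 _ (by omega) (by omega)).trans hs.gap
    have henv : ∀ s₂ : State F, (∀ r', 1 ≤ r' → r' ≠ r → s₂.idx r' = s.idx r') →
        s₂.fldArr = s.fldArr → s₂.idxArr = s.idxArr → Env K n m L T A B s₂ := by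
      intro s₂ h6 h7 h8
      refine hs.of_same (d := K + 26) (e := 0) ⟨fun r' hr' => h6 r' (by omega) (by omega), fun a _ => ?_⟩
        ?_ ?_ ?_
      · rw [h7]
      · rw [h7, hs.work]
      · rw [h7]; exact hs.fldShort
      · rw [h8]; exact hs.idxShort
    refine (Ensures.cond (t := 1 + β) (fun h => (Ensures.instr fun _ => ?_).mono ?_ fun _ h => h)
      fun h => (Ensures.skip ?_).mono (by omega) fun _ h => h).mono ?_ fun _ h => h
    · simp only [Test.holds, h1, h5, decide_eq_true_eq] at h
      have h6 : ∀ r', 1 ≤ r' → r' ≠ r →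
          Function.update s₁.idx r (s₁.idx (K + 31)) r' = s.idx r' := fun r' h h' => by
        simp [h', h2 r' h h']
      exact ⟨henv _ h6 h3 h4, by simp [Instr.exec, h5]; omega, h6, h3⟩
    · simp [Instr.cost, h5, e4]
    · simp only [Test.holds, h1, h5, decide_eq_false_iff_not] at h
      exact ⟨henv _ h2 h3 h4, by rw [h1]; omega, h2, h3⟩
    · simp only [Test.cost, h1, h5]
      omega

/-- Subtract the matrix `part` from the matrix `whole`. -/
def complement (K whole part dst : ℕ) : Prog F :=
  -- The random filling only gives the array its length, because `transfer` merely overwrites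
  -- existing entries.
  .seq (fill K dst (K + 29)) (.seq
    (transfer K whole dst (K + 26) (K + 26) (K + 26) (K + 26) (K + 28) (K + 28) (.fldMove 2 1))
    (transfer K part dst (K + 26) (K + 26) (K + 26) (K + 26) (K + 28) (K + 28)
      (.fldArith .minus 2 0 1)))

theorem ensures_complement {K n m L T k β U whole part dst : ℕ} {A B X Y : Matrix (Fin n) (Fin n) F}
    {s : State F} (hb : Bounds n k L T β U) (hs : Env K n m L T A B s)
    (hX : s.fldArr whole = matrixEntries X) (hY : s.fldArr part = matrixEntries Y)
    (h1 : whole ≠ dst) (h2 : part ≠ dst) (h3 : K + 24 < dst) (h4 : dst ≤ K + 28) :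
    Ensures (complement K whole part dst) s (200 * U) fun s' => Env K n m L T A B s' ∧
      Writes 12 dst (matrixEntries (X - Y)) s s' := by
  have hU := hb.cells
  have hcells : ∀ x ≤ n * n + 1, x.size ≤ β := fun x hx => hb.size_sq x (by nlinarith)
  have hlen : ∀ M : Matrix (Fin n) (Fin n) F, (matrixEntries M).length ≤ n * n + T :=
    fun M => (length_matrixEntries M).le.trans (Nat.le_add_right _ _)
  refine (Ensures.seq ((ensures_fillMatrix (n := n) hs.units (by omega) hs.square hcells).mono
    (t' := 34 * U) (by have := hs.fldShort dst; have := hb.fill_le; omega) fun _ h => h)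
    (t₂ := 80 * U + 80 * U + 1) ?_).mono (by omega) fun _ h => h
  rintro s₁ ⟨R, g1⟩
  have hs₁ : Env K n m L T A B s₁ := hs.writes g1 (hlen R) (by omega)
  refine Ensures.seq ((ensures_transferMatrix (src := whole) (dst := dst) combines_move h1
    ⟨hs₁.units, hs₁.dim, hs₁.units.zero, hs₁.units.zero, hs₁.units.zero, hs₁.units.zero, hs₁.dim,
      hs₁.dim, by omega, by rw [g1.self]; exact length_matrixEntries _⟩ hb.size_sq (by omega) (by omega) (by omega) (by omega)
      g1.self).mono hb.transfer_le fun _ h => h) fun s₂ g2 => ?_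
  have g3 := (g1.trans g2).mono (d' := 12) (by omega)
  have hs₂ : Env K n m L T A B s₂ := hs₁.writes g2 (hlen _) (by omega)
  refine (ensures_transferMatrix (src := part) (dst := dst) combines_minus h2
    ⟨hs₂.units, hs₂.dim, hs₂.units.zero, hs₂.units.zero, hs₂.units.zero, hs₂.units.zero, hs₂.dim,
      hs₂.dim, by omega, by rw [g2.self]; exact length_matrixEntries _⟩ hb.size_sq (by omega) (by omega) (by omega) (by omega)
      g2.self).mono hb.transfer_le fun s₃ g4 => ?_
  refine ⟨hs₂.writes g4 (hlen _) (by omega), ?_⟩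
  have h := (g3.trans g4).mono (d' := 12) (by omega)
  rw [g2.other h2, g1.other h2, g1.other h1, hX, hY] at h
  refine ⟨h.idx, h.fldArr.trans ?_, h.idxArr⟩
  congr 2
  ext i j
  simp only [Nat.zero_le, zero_add, Fin.is_lt, and_self, Nat.sub_zero, if_true,
    getD_matrixEntries, Matrix.sub_apply]

/-- Compute the window with numbers `g` and `h` of the product of the matrices `K + 29` and
`K + 30`. -/
def block (K k : ℕ) (p : Prog F) (g h : ℕ) : Prog F :=
  .seq (corner K (K + 21) g) (.seq (corner K (K + 22) h) (.seq (fill K (K + 25) (K + 29))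
    (.seq (fill K (K + 27) (K + 29)) (.seq (complement K (K + 29) (K + 25) (K + 26))
      (.seq (complement K (K + 30) (K + 27) (K + 28))
        (.seq (mulStrips K k p (K + 25) (K + 27) (.fldMove 2 1))
          (.seq (mulStrips K k p (K + 25) (K + 28) (.fldArith .plus 2 0 1))
            (.seq (mulStrips K k p (K + 26) (K + 27) (.fldArith .plus 2 0 1))
              (mulStrips K k p (K + 26) (K + 28) (.fldArith .plus 2 0 1))))))))))

/-- The product of the two sums expands into four products. The first one overwrites the window, so
its old content is irrelevant, and the other three are added. -/
theorem window_split {n m σ τ : ℕ} (A B A₁ B₁ W : Matrix (Fin n) (Fin n) F) :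
    window m σ τ (fun x y => x + y) (window m σ τ (fun x y => x + y)
      (window m σ τ (fun x y => x + y) (window m σ τ (fun _ y => y) W (A₁ * B₁)) (A₁ * (B - B₁)))
        ((A - A₁) * B₁)) ((A - A₁) * (B - B₁)) = window m σ τ (fun _ y => y) W (A * B) := by
  have h : A * B = A₁ * B₁ + A₁ * (B - B₁) + (A - A₁) * B₁ + (A - A₁) * (B - B₁) := by
    rw [Matrix.mul_sub, Matrix.mul_sub, Matrix.sub_mul, Matrix.sub_mul]
    abel
  ext i j
  rw [h]
  simp only [window]
  split_ifs <;> simp [Matrix.add_apply]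

/-- The four products of summands give the window of the product. -/
theorem succeeds_fourStrips {K n m L T k β U σ τ : ℕ} {A B A₁ B₁ W : Matrix (Fin n) (Fin n) F}
    {p : Prog F} {s : State F} {δ v : ℝ} (hS : Setting p K n m L T k β U)
    (hs : Env K n m L T A B s) (hrow : s.idx (K + 21) = σ) (hcol : s.idx (K + 22) = τ)
    (hσ : σ + m ≤ n) (hτ : τ + m ≤ n)
    (hA₁ : s.fldArr (K + 25) = matrixEntries A₁) (hA₂ : s.fldArr (K + 26) = matrixEntries (A - A₁))
    (hB₁ : s.fldArr (K + 27) = matrixEntries B₁) (hB₂ : s.fldArr (K + 28) = matrixEntries (B - B₁))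
    (hW : s.fldArr (K + 24) = matrixEntries W)
    (hv : v ≤ 0 ∨ (0 ≤ δ ∧ (GoodStrips p k δ (getStrips m σ τ (A₁, B₁)) ∧
      GoodStrips p k δ (getStrips m σ τ (A₁, B - B₁)) ∧
      GoodStrips p k δ (getStrips m σ τ (A - A₁, B₁)) ∧
      GoodStrips p k δ (getStrips m σ τ (A - A₁, B - B₁))) ∧ v = ((1 / 2) ^ k * δ) ^ 4)) :
    Succeeds (.seq (mulStrips K k p (K + 25) (K + 27) (.fldMove 2 1))
          (.seq (mulStrips K k p (K + 25) (K + 28) (.fldArith .plus 2 0 1))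
            (.seq (mulStrips K k p (K + 26) (K + 27) (.fldArith .plus 2 0 1))
              (mulStrips K k p (K + 26) (K + 28) (.fldArith .plus 2 0 1))))) s
      (4 * ((30 * K + 15 * k + 1301) * U))
      (fun s' => SameFrom (K + 21) (K + 25) s s' ∧ Env K n m L T A B s')
      (fun s' => s'.fldArr (K + 24) = matrixEntries (window m σ τ (fun _ y => y) W (A * B))) v := by
  set t := (30 * K + 15 * k + 1300) * U with ht
  have hU := hS.bounds.cells
  have htime : t + (t + (t + t + 1) + 1) + 1 ≤ 4 * ((30 * K + 15 * k + 1301) * U) := by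
    have : (30 * K + 15 * k + 1301) * U = t + U := by rw [ht]; ring
    omega
  let Q : State F → Prop := fun s' => SameFrom (K + 21) (K + 25) s s' ∧ Env K n m L T A B s'
  have step : ∀ (a b : ℕ) (A' B' : Matrix (Fin n) (Fin n) F) (comb : Instr F) (op : F → F → F),
      K + 25 ≤ a → K + 25 ≤ b → Combines comb op → s.fldArr a = matrixEntries A' →
      s.fldArr b = matrixEntries B' → ∀ (W' : Matrix (Fin n) (Fin n) F) (v : ℝ),
      (v ≤ 0 ∨ (0 ≤ δ ∧ GoodStrips p k δ (getStrips m σ τ (A', B')) ∧ v = (1 / 2) ^ k * δ)) →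
      ∀ s', Q s' → s'.fldArr (K + 24) = matrixEntries W' → Succeeds (mulStrips K k p a b comb) s' t Q
        (fun s' => s'.fldArr (K + 24) = matrixEntries (window m σ τ op W' (A' * B'))) v := by
    intro a b A' B' comb op ha hb hcomb hA' hB' W' v hv s' hs' hW'
    refine (succeeds_mulStrips hS hs'.2 ((hs'.1.idx _ (by omega)).trans hrow)
      ((hs'.1.idx _ (by omega)).trans hcol) hσ hτ hcomb ha hb ((hs'.1.arr _ ha).trans hA')
      ((hs'.1.arr _ hb).trans hB') hW' hv).mono le_rfl (fun s₂ h => ?_) fun _ _ h => h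
    exact ⟨(hs'.1.trans h.1).mono (by omega) (by omega), h.2⟩
  have sure : ∀ (a b : ℕ) (A' B' : Matrix (Fin n) (Fin n) F) (comb : Instr F) (op : F → F → F),
      K + 25 ≤ a → K + 25 ≤ b → Combines comb op → s.fldArr a = matrixEntries A' →
      s.fldArr b = matrixEntries B' → ∀ s', Q s' → Ensures (mulStrips K k p a b comb) s' t Q := by
    intro a b A' B' comb op ha hb hcomb hA' hB' s' hs'
    obtain ⟨W', hW'⟩ := exists_matrixEntries hs'.2.work
    exact (step a b A' B' comb op ha hb hcomb hA' hB' W' 0 (.inl le_rfl) s' hs' hW'.symm).ensures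
  have hQ : Q s := ⟨.refl _ _ _, hs⟩
  have e1 := sure (K + 25) (K + 27) _ _ _ _ (by omega) (by omega) combines_move hA₁ hB₁
  have e2 := sure (K + 25) (K + 28) _ _ _ _ (by omega) (by omega) combines_plus hA₁ hB₂
  have e3 := sure (K + 26) (K + 27) _ _ _ _ (by omega) (by omega) combines_plus hA₂ hB₁
  have e4 := sure (K + 26) (K + 28) _ _ _ _ (by omega) (by omega) combines_plus hA₂ hB₂
  have e34 := fun s' h => Ensures.seq (e3 s' h) e4
  have e234 := fun s' h => Ensures.seq (e2 s' h) e34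
  rcases hv with hv | ⟨hδ, ⟨g1, g2, g3, g4⟩, rfl⟩
  · exact Succeeds.of_ensures ((Ensures.seq (e1 s hQ) e234).mono htime fun _ h => h) hv
  · have hρ : 0 ≤ (1 / 2 : ℝ) ^ k * δ := by positivity
    have f1 := step (K + 25) (K + 27) _ _ _ _ (by omega) (by omega) combines_move hA₁ hB₁ W _
      (.inr ⟨hδ, g1, rfl⟩) s hQ hW
    refine ((Succeeds.seq f1 e234 (fun s₁ q1 w1 => Succeeds.seq
      (step (K + 25) (K + 28) _ _ _ _ (by omega) (by omega) combines_plus hA₁ hB₂ _ _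
        (.inr ⟨hδ, g2, rfl⟩) s₁ q1 w1) e34 (fun s₂ q2 w2 => Succeeds.seq
      (step (K + 26) (K + 27) _ _ _ _ (by omega) (by omega) combines_plus hA₂ hB₁ _ _
        (.inr ⟨hδ, g3, rfl⟩) s₂ q2 w2) e4 (fun s₃ q3 w3 =>
      (step (K + 26) (K + 28) _ _ _ _ (by omega) (by omega) combines_plus hA₂ hB₂ _ _
        (.inr ⟨hδ, g4, rfl⟩) s₃ q3 w3)) hρ) (by positivity)) (by positivity)).anti
        (le_of_eq (by ring))).mono htime (fun _ h => h) fun s₄ _ h => ?_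
    rw [h, window_split]

-- The value is averaged over the splitting: a splitting with four good pairs of strips contributes
-- `((1/2)^k * δ)^4`, any other one contributes zero. By `half_le_expect_split`, at least half of
-- the splittings are of the first kind.
open Classical in
theorem succeeds_block {K n m L T k β U g h : ℕ} {A B W : Matrix (Fin n) (Fin n) F}
    {p : Prog F} {s : State F} {δ v : ℝ} (hS : Setting p K n m L T k β U)
    (hs : Env K n m L T A B s) (hg : g ≤ k) (hh : h ≤ k) (hW : s.fldArr (K + 24) = matrixEntries W)
    (hv : v ≤ 0 ∨ (0 ≤ δ ∧ 𝔼 z : (Fin m → Fin n → F) × (Fin m → Fin n → F),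
      (if ¬ GoodStrips p k δ z then 1 else 0 : ℝ) ≤ 1 / 8 ∧
      v = 1 / 2 * ((1 / 2) ^ k * δ) ^ 4)) :
    Succeeds (block K k p g h) s ((120 * K + 60 * k + 6000) * U)
      (fun s' => SameFrom (K + 23) (K + 29) s s' ∧ Env K n m L T A B s')
      (fun s' => s'.fldArr (K + 24) = matrixEntries
        (window m (min (g * m) (n - m)) (min (h * m) (n - m)) (fun _ y => y) W (A * B))) v := by
  have hb := hS.bounds
  have hm := hS.width_le
  have hU := hb.cells
  have hcells : ∀ x ≤ n * n + 1, x.size ≤ β := fun x hx => hb.size_sq x (by nlinarith)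
  have hlen : ∀ M : Matrix (Fin n) (Fin n) F, (matrixEntries M).length ≤ n * n + T :=
    fun M => (length_matrixEntries M).le.trans (Nat.le_add_right _ _)
  have hσ : min (g * m) (n - m) + m ≤ n := by omega
  have hτ : min (h * m) (n - m) + m ≤ n := by omega
  generalize hσ' : min (g * m) (n - m) = σ at *
  generalize hτ' : min (h * m) (n - m) = τ at *
  set ρ : ℝ := ((1 / 2) ^ k * δ) ^ 4 with hρdef
  have hρ : 0 ≤ ρ := by positivity
  let ok : Matrix (Fin n) (Fin n) F → Matrix (Fin n) (Fin n) F → Prop := fun A₁ B₁ =>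
    0 ≤ δ ∧ GoodStrips p k δ (getStrips m σ τ (A₁, B₁)) ∧
      GoodStrips p k δ (getStrips m σ τ (A₁, B - B₁)) ∧
      GoodStrips p k δ (getStrips m σ τ (A - A₁, B₁)) ∧
      GoodStrips p k δ (getStrips m σ τ (A - A₁, B - B₁))
  have hval : v ≤ 𝔼 A₁, 𝔼 B₁, (if ok A₁ B₁ then ρ else 0) := by
    rcases hv with hv | ⟨hδ, hbad, rfl⟩
    · exact hv.trans (Finset.expect_nonneg fun A₁ _ => Finset.expect_nonneg fun B₁ _ => by
        split_ifs <;> simp [hρ])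
    · have h1 := half_le_expect_split hσ hτ (GoodStrips p k δ) hbad A B
      refine (mul_le_mul_of_nonneg_right h1 hρ).trans (le_of_eq ?_)
      simp only [Finset.expect_mul, ite_mul, one_mul, zero_mul, ok, hδ, true_and]
  let t := 4 * ((30 * K + 15 * k + 1301) * U)
  refine Achieves.mono (Ensures.seq_achieves (ensures_corner hS hs hg (r := K + 21) le_rfl (by omega))
    (t₂ := 30 * U + (34 * U + (34 * U + (200 * U + (200 * U + t + 1) + 1) + 1) + 1) + 1)
    ?_) ?_ fun _ _ h => h
  swap
  · simp only [t]; nlinarith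
  rintro s₁ ⟨hs₁, h1, h2, h3⟩
  refine Ensures.seq_achieves (ensures_corner hS hs₁ hh (r := K + 22) (by omega) (by omega)) ?_
  rintro s₂ ⟨hs₂, h4, h5, h6⟩
  have hrow : s₂.idx (K + 21) = σ := (h5 _ (by omega) (by omega)).trans (h1.trans hσ')
  have hcol : s₂.idx (K + 22) = τ := h4.trans hτ'
  have hsame₂ : SameFrom (K + 23) 0 s s₂ :=
    ⟨fun r hr => (h5 r (by omega) (by omega)).trans (h2 r (by omega) (by omega)),
      fun a _ => by rw [h6, h3]⟩
  refine Achieves.anti ?_ hval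
  refine Achieves.seq ((achieves_fillMatrix hs₂.units (by omega) hs₂.square hcells
    fun A₁ => 𝔼 B₁, (if ok A₁ B₁ then ρ else 0)).mono
    (by have := hs₂.fldShort (K + 25); have := hb.fill_le; omega) fun _ _ h => h) ?_
  rintro s₃ w ⟨A₁, h7, rfl⟩
  have hs₃ : Env K n m L T A B s₃ := hs₂.writes h7 (hlen _) (by omega)
  refine Achieves.seq ((achieves_fillMatrix hs₃.units (by omega) hs₃.square hcells
    fun B₁ => if ok A₁ B₁ then ρ else 0).mono
    (by have := hs₃.fldShort (K + 27); have := hb.fill_le; omega) fun _ _ h => h) ?_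
  rintro s₄ w ⟨B₁, h8, rfl⟩
  have hs₄ : Env K n m L T A B s₄ := hs₃.writes h8 (hlen _) (by omega)
  refine Ensures.seq_achieves (ensures_complement hb hs₄ hs₄.left
    (by rw [h8.other (by omega), h7.self]) (by omega) (by omega) (by omega) (by omega)) ?_
  rintro s₅ ⟨hs₅, h9⟩
  refine Ensures.seq_achieves (ensures_complement hb hs₅ hs₅.right
    (by rw [h9.other (by omega), h8.self]) (by omega) (by omega) (by omega) (by omega)) ?_
  rintro s₆ ⟨hs₆, h10⟩
  have hidx : ∀ r, 12 ≤ r → s₆.idx r = s₂.idx r := fun r hr => by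
    rw [h10.idx r hr, h9.idx r hr, h8.idx r (by omega), h7.idx r (by omega)]
  have hfour := succeeds_fourStrips (W := W) (A₁ := A₁) (B₁ := B₁) (δ := δ)
    (v := if ok A₁ B₁ then ρ else 0) hS hs₆
    ((hidx _ (by omega)).trans hrow) ((hidx _ (by omega)).trans hcol) hσ hτ
    (by rw [h10.other (by omega), h9.other (by omega), h8.other (by omega), h7.self])
    (by rw [h10.other (by omega), h9.self])
    (by rw [h10.other (by omega), h9.other (by omega), h8.self])
    h10.self
    (by rw [h10.other (by omega), h9.other (by omega), h8.other (by omega), h7.other (by omega),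
      h6, h3, hW]) (by
      split_ifs with hok
      · exact .inr ⟨hok.1, hok.2, rfl⟩
      · exact .inl le_rfl)
  refine hfour.mono le_rfl (fun s₇ h => ⟨⟨fun r hr => ?_, fun a ha => ?_⟩, h.2⟩) fun _ _ h => h
  · rw [h.1.idx r (by omega), hidx r (by omega), hsame₂.idx r hr]
  · rw [h.1.arr a (by omega), h10.other (by omega), h9.other (by omega), h8.other (by omega),
      h7.other (by omega), hsame₂.arr a (by omega)]

/-- Compute the windows with the given numbers. -/
def blocks (K k : ℕ) (p : Prog F) : List (ℕ × ℕ) → Prog F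
  | [] => .skip
  | gh :: l => .seq (block K k p gh.1 gh.2) (blocks K k p l)

/-- The entry `(i, j)` belongs to the window with numbers `gh`. -/
def InWindow (n m : ℕ) (gh : ℕ × ℕ) (i j : ℕ) : Prop :=
  (min (gh.1 * m) (n - m) ≤ i ∧ i < min (gh.1 * m) (n - m) + m) ∧
    (min (gh.2 * m) (n - m) ≤ j ∧ j < min (gh.2 * m) (n - m) + m)

/-- The window number is `i / m`. Moving a start back to `n - m` keeps `i` in the window, because
that window ends exactly at `n`. -/
theorem exists_window {n m k : ℕ} (hm : m ≤ n) (hn : n ≤ (k + 1) * m) {i : ℕ} (hi : i < n) :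
    ∃ g ≤ k, min (g * m) (n - m) ≤ i ∧ i < min (g * m) (n - m) + m := by
  have hm0 : 0 < m := by
    rcases Nat.eq_zero_or_pos m with rfl | h
    · omega
    · exact h
  refine ⟨i / m, ?_, ?_⟩
  · exact Nat.lt_succ_iff.1 (Nat.div_lt_of_lt_mul (by rw [mul_comm]; exact hi.trans_le hn))
  · have h1 : i / m * m ≤ i := Nat.div_mul_le_self i m
    have h2 : i < i / m * m + m := Nat.lt_div_mul_add hm0
    omega

/-- The numbers of all windows. -/
def allWindows (k : ℕ) : List (ℕ × ℕ) := (List.range (k + 1)) ×ˢ (List.range (k + 1))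

theorem exists_inWindow {n m k : ℕ} (hm : m ≤ n) (hn : n ≤ (k + 1) * m) (i j : Fin n) :
    ∃ gh ∈ allWindows k, InWindow n m gh i j := by
  obtain ⟨g, hg, hg'⟩ := exists_window hm hn i.2
  obtain ⟨h, hh, hh'⟩ := exists_window hm hn j.2
  exact ⟨(g, h), by simp [allWindows]; omega, hg', hh'⟩

/-- The time for the computation of a window. -/
def blockTime (K k U : ℕ) : ℕ := (120 * K + 60 * k + 6000) * U

/-- The probability that the computation of a window succeeds. -/
noncomputable def blockProb (k : ℕ) (δ : ℝ) : ℝ := 1 / 2 * ((1 / 2) ^ k * δ) ^ 4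

theorem blockProb_nonneg (k : ℕ) (δ : ℝ) : 0 ≤ blockProb k δ := by
  have h : 0 ≤ ((1 / 2) ^ k * δ) ^ 4 := by positivity
  exact mul_nonneg (by norm_num) h

-- Overlaps are harmless: a successful window replaces its entries by correct ones and leaves the
-- others alone, so an entry that is correct once remains so. Tracking entries that are correct at
-- the start makes the induction over the list work.
open Classical in
theorem succeeds_blocks {K n m L T k β U : ℕ} {A B : Matrix (Fin n) (Fin n) F}
    {p : Prog F} {δ v : ℝ} (hS : Setting p K n m L T k β U) (l : List (ℕ × ℕ))
    (hl : ∀ gh ∈ l, gh.1 ≤ k ∧ gh.2 ≤ k) {W : Matrix (Fin n) (Fin n) F} {s : State F}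
    (hs : Env K n m L T A B s) (hW : s.fldArr (K + 24) = matrixEntries W)
    (hv : v ≤ 0 ∨ (0 ≤ δ ∧ 𝔼 z : (Fin m → Fin n → F) × (Fin m → Fin n → F),
      (if ¬ GoodStrips p k δ z then 1 else 0 : ℝ) ≤ 1 / 8 ∧ v = blockProb k δ ^ l.length)) :
    Succeeds (blocks K k p l) s (l.length * (blockTime K k U + 1) + 1)
      (fun s' => SameFrom (K + 23) (K + 29) s s' ∧ Env K n m L T A B s')
      (fun s' => ∃ W' : Matrix (Fin n) (Fin n) F, s'.fldArr (K + 24) = matrixEntries W' ∧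
        ∀ i j, (W i j = (A * B) i j ∨ ∃ gh ∈ l, InWindow n m gh i j) → W' i j = (A * B) i j) v := by
  induction l generalizing W s v with
  | nil =>
    have h : Ensures (.skip : Prog F) s 1 fun s' =>
        (SameFrom (K + 23) (K + 29) s s' ∧ Env K n m L T A B s') ∧
        ∃ W' : Matrix (Fin n) (Fin n) F, s'.fldArr (K + 24) = matrixEntries W' ∧
        ∀ i j, (W i j = (A * B) i j ∨ ∃ gh ∈ ([] : List (ℕ × ℕ)), InWindow n m gh i j) →
          W' i j = (A * B) i j :=
      Ensures.skip ⟨⟨.refl _ _ _, hs⟩, W, hW, fun i j h => h.resolve_right (by simp)⟩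
    refine ((Succeeds.of_ensures_good h).anti ?_).mono (by simp) (fun _ h => h) fun _ _ h => h
    rcases hv with hv | ⟨-, -, rfl⟩
    · linarith
    · simp
  | cons gh l ih =>
    have hgh := hl gh (by simp)
    have hl' : ∀ gh ∈ l, gh.1 ≤ k ∧ gh.2 ≤ k := fun gh h => hl gh (by simp [h])
    have htime : blockTime K k U + (l.length * (blockTime K k U + 1) + 1) + 1 ≤
        (gh :: l).length * (blockTime K k U + 1) + 1 := by
      simp only [List.length_cons]; nlinarith
    have hsame : ∀ s₁, SameFrom (K + 23) (K + 29) s s₁ → ∀ s₂,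
        SameFrom (K + 23) (K + 29) s₁ s₂ ∧ Env K n m L T A B s₂ →
        SameFrom (K + 23) (K + 29) s s₂ ∧ Env K n m L T A B s₂ := fun s₁ h₁ s₂ h₂ =>
      ⟨(h₁.trans h₂.1).mono (by omega) (by omega), h₂.2⟩
    have hsure : ∀ s₁, SameFrom (K + 23) (K + 29) s s₁ ∧ Env K n m L T A B s₁ →
        Ensures (blocks K k p l) s₁ (l.length * (blockTime K k U + 1) + 1) fun s₂ =>
          SameFrom (K + 23) (K + 29) s s₂ ∧ Env K n m L T A B s₂ := by
      rintro s₁ ⟨h₁, h₂⟩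
      obtain ⟨W₁, hW₁⟩ := exists_matrixEntries h₂.work
      exact (ih hl' h₂ hW₁.symm (.inl le_rfl)).ensures.mono le_rfl (hsame s₁ h₁)
    rcases hv with hv | ⟨hδ, hbad, rfl⟩
    · refine Succeeds.of_ensures ((Ensures.seq (succeeds_block hS hs hgh.1 hgh.2 hW (δ := δ)
        (.inl (le_refl 0))).ensures hsure).mono htime fun _ h => h) hv
    · refine ((Succeeds.seq (succeeds_block hS hs hgh.1 hgh.2 hW (.inr ⟨hδ, hbad, rfl⟩)) hsure
        (fun s₁ h₁ hW₁ => (ih hl' h₁.2 hW₁ (.inr ⟨hδ, hbad, rfl⟩)).mono le_rfl (hsame s₁ h₁.1)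
          fun _ _ h => h) (pow_nonneg (blockProb_nonneg k δ) _)).anti ?_).mono htime (fun _ h => h) ?_
      · rw [List.length_cons, pow_succ', blockProb]
      · rintro s₂ - ⟨W', hW', h⟩
        refine ⟨W', hW', fun i j hij => h i j ?_⟩
        simp only [window]
        split_ifs with hw
        · exact .inl rfl
        · rcases hij with hij | ⟨gh', hgh', hij⟩
          · exact .inl hij
          · rcases List.mem_cons.1 hgh' with rfl | hgh'
            · exact absurd hij hw
            · exact .inr ⟨gh', hgh', hij⟩

/-! ### A complete attempt -/

/-- Try to compute the product of the matrices `K + 29` and `K + 30` in the array `K + 24`: by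
guessing if the dimension is less than `n₀`. -/
def attempt (K k n₀ : ℕ) (p : Prog F) : Prog F :=
  .seq (fill K (K + 24) (K + 29)) (.seq (.instr (.idxConst 0 n₀))
    (.cond (.idxLt (K + 28) 0) .skip (blocks K k p (allWindows k))))

/-- The time for an attempt. -/
def attemptTime (K k n₀ U : ℕ) : ℕ := (k + 1) ^ 2 * (blockTime K k U + 1) + (2 * n₀ + 60) * U

theorem size_le_self (n : ℕ) : n.size ≤ n := Nat.size_le.2 Nat.lt_two_pow_self

theorem length_allWindows (k : ℕ) : (allWindows k).length = (k + 1) ^ 2 := by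
  simp [allWindows, List.length_product, sq]

-- Below `n₀` the initial random filling is itself the guess and hits the product with probability
-- `|F|^(-n²)`. From `n₀` on its content does not matter, because the windows cover the matrix.
open Classical in
theorem succeeds_attempt {K n m L T k β U n₀ : ℕ} {A B : Matrix (Fin n) (Fin n) F}
    {p : Prog F} {δ v : ℝ} (hS : Setting p K n m L T k β U) {s : State F}
    (hs : Env K n m L T A B s)
    (hv : (n < n₀ ∧ v ≤ (1 / Fintype.card F : ℝ) ^ (n * n)) ∨
      (n₀ ≤ n ∧ (0 ≤ δ ∧ 𝔼 z : (Fin m → Fin n → F) × (Fin m → Fin n → F),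
      (if ¬ GoodStrips p k δ z then 1 else 0 : ℝ) ≤ 1 / 8) ∧ n ≤ (k + 1) * m ∧
        v ≤ blockProb k δ ^ ((k + 1) ^ 2))) :
    Succeeds (attempt K k n₀ p) s (attemptTime K k n₀ U)
      (fun s' => SameFrom (K + 23) (K + 29) s s' ∧ Env K n m L T A B s')
      (fun s' => s'.fldArr (K + 24) = matrixEntries (A * B)) v := by
  have hb := hS.bounds
  have hU := hb.cells
  have hU' := hb.le
  have hcells : ∀ x ≤ n * n + 1, x.size ≤ β := fun x hx => hb.size_sq x (by nlinarith)
  have hlen : ∀ M : Matrix (Fin n) (Fin n) F, (matrixEntries M).length ≤ n * n + T :=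
    fun M => (length_matrixEntries M).le.trans (Nat.le_add_right _ _)
  have hn₀ := size_le_self n₀
  have hnβ : n.size ≤ β := hb.size_sq n (by nlinarith)
  have hfill : 4 * (s.fldArr (K + 24)).length + 20 + 10 * β * (n * n + 1) ≤ 34 * U := by
    have := hs.fldShort (K + 24); have := hb.fill_le; omega
  have hblocks : ∀ gh ∈ allWindows k, gh.1 ≤ k ∧ gh.2 ≤ k := by
    rintro ⟨g, h⟩ hgh
    simp [allWindows] at hgh
    omega
  set t := (k + 1) ^ 2 * (blockTime K k U + 1) + 1 with ht
  have htime : 34 * U + ((1 + n₀.size) + ((1 + n.size + n₀.size) + t) + 1) + 1 ≤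
      attemptTime K k n₀ U := by
    have : n₀ ≤ n₀ * U := Nat.le_mul_of_pos_right _ (by omega)
    simp only [attemptTime, ht]
    rw [add_mul (2 * n₀), mul_assoc 2]
    omega
  let Q : State F → Prop := fun s' => SameFrom (K + 23) (K + 29) s s' ∧ Env K n m L T A B s'
  have hconst : ∀ X : Matrix (Fin n) (Fin n) F, ∀ s₁ : State F, Writes 11 (K + 24) (matrixEntries X) s s₁ →
      Ensures (.instr (.idxConst 0 n₀)) s₁ (1 + n₀.size) fun s₂ => Q s₂ ∧ s₂.idx 0 = n₀ ∧
        s₂.fldArr (K + 24) = matrixEntries X := by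
    intro X s₁ h₁
    refine (Ensures.instr fun coin => ?_).mono (by simp [Instr.cost]) fun _ h => h
    have h₂ : Writes 11 (K + 24) (matrixEntries X) s (Instr.exec coin s₁ (.idxConst 0 n₀)) :=
      ⟨fun r hr => by simp [Instr.exec, show r ≠ 0 by omega, h₁.idx r hr], h₁.fldArr, h₁.idxArr⟩
    exact ⟨⟨h₂.sameFrom.mono (by omega) (by omega), hs.writes h₂ (hlen X) (by simp)⟩,
      by simp [Instr.exec], h₂.self⟩
  rcases hv with ⟨hn, hv⟩ | ⟨hn, ⟨hδ, hbad⟩, hcover, hv⟩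
  · refine Achieves.anti (Achieves.mono (Achieves.seq ((achieves_fillMatrix hs.units (by omega) hs.square hcells
      fun X => if X = A * B then 1 else 0).mono hfill fun _ _ h => h)
      (t₂ := (1 + n₀.size) + ((1 + n.size + n₀.size) + t) + 1) ?_) htime fun _ _ h => h) ?_
    · rintro s₁ w ⟨X, h₁, rfl⟩
      refine Ensures.seq_achieves (hconst X s₁ h₁) ?_
      rintro s₂ ⟨h₂, h₃, h₄⟩
      have h₅ : X = A * B ↔ s₂.fldArr (K + 24) = matrixEntries (A * B) := by
        rw [h₄, matrixEntries_injective.eq_iff]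
      refine (Achieves.cond (t := t) (fun _ => (Achieves.skip ⟨h₂, by by_cases hX : X = A * B <;> simp [hX, ← h₅]⟩).mono (by omega)
        fun _ _ h => h) fun h => absurd h ?_).mono ?_ fun _ _ h => h
      · simp [Test.holds, h₂.2.dim, h₃, hn]
      · simp [Test.cost, h₂.2.dim, h₃]
    · refine hv.trans (le_of_eq ?_)
      have hcard : Fintype.card (Matrix (Fin n) (Fin n) F) = Fintype.card F ^ (n * n) := by
        rw [← Fintype.card_congr (matrixEquiv F n)]; simp
      rw [Fintype.expect_eq_sum_div_card, Finset.sum_ite_eq', if_pos (Finset.mem_univ _), hcard]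
      simp
  · refine Achieves.mono (Ensures.seq_achieves ((ensures_fillMatrix hs.units (by omega) hs.square
      hcells).mono hfill fun _ h => h) (t₂ := (1 + n₀.size) + ((1 + n.size + n₀.size) + t) + 1) ?_)
      htime fun _ _ h => h
    rintro s₁ ⟨X, h₁⟩
    refine Ensures.seq_achieves (hconst X s₁ h₁) ?_
    rintro s₂ ⟨h₂, h₃, h₄⟩
    refine (Achieves.cond (t := t) (fun h => ?_) fun h => ?_).mono ?_ fun _ _ h => h
    · simp [Test.holds, h₂.2.dim, h₃] at h; omega
    · refine ((succeeds_blocks hS _ hblocks h₂.2 h₄ (.inr ⟨hδ, hbad, rfl⟩)).anti ?_).mono ?_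
        (fun s₃ h => ⟨(h₂.1.trans h.1).mono (by omega) (by omega), h.2⟩) ?_
      · rwa [length_allWindows]
      · rw [length_allWindows]
      · rintro s₃ - ⟨W', hW', h⟩
        rw [hW']
        congr 1
        ext i j
        exact h i j (.inr (exists_inWindow hS.width_le hcover i j))
    · simp [Test.cost, h₂.2.dim, h₃]

/-! ### Verification by Freivalds' check -/

/-- Compare the product of the matrices `K + 29` and `K + 30` with the matrix `K + 24` at a random
vector; set the register `K + 23` to zero if they differ. -/
def probe (K : ℕ) : Prog F :=
  .seq (fill K (K + 20) (K + 28)) (.seq (fill K (K + 21) (K + 28)) (.seq (fill K (K + 22) (K + 28))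
    (.seq (fill K (K + 23) (K + 28)) (.seq (matVec K (K + 30) (K + 20) (K + 21))
      (.seq (matVec K (K + 29) (K + 21) (K + 22)) (.seq (matVec K (K + 24) (K + 20) (K + 23))
        (compare K (K + 22) (K + 23))))))))

/-- Only the first of the four fillings supplies the random vector; the other three provide arrays
of length `n` for `B v`, `A (B v)` and `W v`. -/
theorem achieves_probe {K n m k L T β U : ℕ} {A B W : Matrix (Fin n) (Fin n) F} {s : State F}
    (hb : Bounds n k L T β U) (hs : Env K n m L T A B s) (hW : s.fldArr (K + 24) = matrixEntries W)
    (φ : (Fin n → F) → ℝ) :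
    Achieves (probe K) s (500 * U) (fun s' w => SameFrom (K + 24) (K + 24) s s' ∧
      Env K n m L T A B s' ∧ ∃ v, s'.idx (K + 23) = (if (A * B - W).mulVec v = 0 then
        s.idx (K + 23) else 0) ∧ w = φ v) (𝔼 v, φ v) := by
  have hU := hb.cells
  have hnn : n ≤ n * n := Nat.le_mul_self n
  have hcells : ∀ x ≤ n + 1, x.size ≤ β := fun x hx => hb.size_sq x (by nlinarith)
  have htrans : 80 * β * (n + 1) ^ 2 ≤ 80 * U := hb.transfer_le
  have hfill : ∀ s' : State F, Env K n m L T A B s' → ∀ a,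
      4 * (s'.fldArr a).length + 20 + 10 * β * (n + 1) ≤ 34 * U := by
    intro s' hs' a
    have h1 := hs'.fldShort a
    have h2 := hb.fill_le
    have h3 : 10 * β * (n + 1) ≤ 10 * β * (n * n + 1) := by gcongr
    omega
  have hlen : ∀ v : Fin n → F, (List.ofFn v).length ≤ n * n + T := fun v => by simp; omega
  refine Achieves.mono (Achieves.seq ((achieves_fill hs.units (by omega) hs.dim hcells φ).mono
    (hfill s hs _) fun _ _ h => h) (t₂ := 34 * U + (34 * U + (34 * U + (80 * U + (80 * U + (80 * U +
      20 * U + 1) + 1) + 1) + 1) + 1) + 1) ?_) (by omega) fun _ _ h => h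
  rintro s₁ w ⟨v, g1, rfl⟩
  have hs₁ := hs.writes g1 (hlen _) (by omega)
  refine Ensures.seq_achieves ((ensures_fill hs₁.units (by omega) hs₁.dim hcells).mono
    (hfill s₁ hs₁ _) fun _ h => h) ?_
  rintro s₂ ⟨v₂, g2⟩
  have hs₂ := hs₁.writes g2 (hlen _) (by omega)
  refine Ensures.seq_achieves ((ensures_fill hs₂.units (by omega) hs₂.dim hcells).mono
    (hfill s₂ hs₂ _) fun _ h => h) ?_
  rintro s₃ ⟨v₃, g3⟩
  have hs₃ := hs₂.writes g3 (hlen _) (by omega)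
  refine Ensures.seq_achieves ((ensures_fill hs₃.units (by omega) hs₃.dim hcells).mono
    (hfill s₃ hs₃ _) fun _ h => h) ?_
  rintro s₄ ⟨v₄, g4⟩
  have hs₄ := hs₃.writes g4 (hlen _) (by omega)
  have e4 : s₄.fldArr (K + 20) = List.ofFn v := by
    rw [g4.other (by omega), g3.other (by omega), g2.other (by omega), g1.self]
  refine Ensures.seq_achieves ((ensures_matVec hs₄.units hs₄.dim hb.size_sq (by omega) (by omega)
    hs₄.right e4 (by rw [g4.other (by omega), g3.other (by omega), g2.self]; simp)).mono htrans
    fun _ h => h) fun s₅ g5 => ?_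
  have hs₅ := hs₄.writes g5 (hlen _) (by omega)
  refine Ensures.seq_achieves ((ensures_matVec hs₅.units hs₅.dim hb.size_sq (by omega) (by omega)
    hs₅.left g5.self (by rw [g5.other (by omega), g4.other (by omega), g3.self]; simp)).mono htrans
    fun _ h => h) fun s₆ g6 => ?_
  have hs₆ := hs₅.writes g6 (hlen _) (by omega)
  refine Ensures.seq_achieves ((ensures_matVec (A := W) hs₆.units hs₆.dim hb.size_sq (by omega)
    (by omega) ?_ (by rw [g6.other (by omega), g5.other (by omega), e4])
    (by rw [g6.other (by omega), g5.other (by omega), g4.self]; simp)).mono htrans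
    fun _ h => h) fun s₇ g7 => ?_
  · rw [g6.other (by omega), g5.other (by omega), g4.other (by omega), g3.other (by omega),
      g2.other (by omega), g1.other (by omega), hW]
  have hs₇ := hs₆.writes g7 (hlen _) (by omega)
  refine ((ensures_compare hs₇.units hs₇.dim hb.size_sq (by rw [g7.other (by omega), g6.self])
    g7.self).mono ?_ fun _ h => h).achieves ?_
  · have h1 := hb.mul_le
    have h2 : 20 * β * (n + 1) ≤ 20 * (β * (n + 1) ^ 2) := by
      rw [mul_assoc]; gcongr; nlinarith
    omega
  rintro s₈ ⟨h1, h2, h3, h4⟩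
  have hidx : ∀ r, 12 ≤ r → s₇.idx r = s.idx r := fun r hr => by
    rw [g7.idx r hr, g6.idx r hr, g5.idx r hr, g4.idx r (by omega), g3.idx r (by omega),
      g2.idx r (by omega), g1.idx r (by omega)]
  have harr : ∀ a, K + 24 ≤ a → s₇.fldArr a = s.fldArr a := fun a ha => by
    rw [g7.other (by omega), g6.other (by omega), g5.other (by omega), g4.other (by omega),
      g3.other (by omega), g2.other (by omega), g1.other (by omega)]
  refine ⟨⟨fun r hr => (h1 r (by omega) (by omega)).trans (hidx r (by omega)), fun a ha => by
    rw [h3, harr a ha]⟩, hs₇.of_same (d := K + 24) (e := 0) ⟨fun r hr => h1 r (by omega) (by omega),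
      fun a _ => by rw [h3]⟩ (by rw [h3, hs₇.work]) (by rw [h3]; exact hs₇.fldShort)
      (by rw [h4]; exact hs₇.idxShort), v, ?_, rfl⟩
  rw [h2, hidx _ (by omega)]
  refine if_congr ?_ rfl rfl
  rw [Matrix.sub_mulVec, sub_eq_zero, Matrix.mulVec_mulVec]

/-- Check the product of the matrices `K + 29` and `K + 30` in the array `K + 24`; the register
`K + 23` receives one if no error is found and zero otherwise. -/
def verify (K : ℕ) : Prog F :=
  .seq (straight [.idxMove (K + 23) (K + 27), .idxMove (K + 24) (K + 32)])
    (countdown (K + 26) (K + 27) (K + 24) (probe K))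

/-- The time for checking a product. -/
def verifyTime (L U : ℕ) : ℕ := L * (507 * U) + 10 * U

/-- Here `f j x` is the payoff expected with `j` probes to go and current verdict `x`. The
hypotheses say that the mean of the payoff does not drop in a round: verdict `0` is absorbing, and
verdict `1` survives exactly if the vector is in the kernel. Different choices of `f` give the error
bound and the sure facts. -/
theorem verify_aux {K n m k L T β U : ℕ} {A B W : Matrix (Fin n) (Fin n) F} {s : State F}
    (hb : Bounds n k L T β U) (hs : Env K n m L T A B s) (hW : s.fldArr (K + 24) = matrixEntries W)
    (f : ℕ → ℕ → ℝ) (hf0 : ∀ j, f (j + 1) 0 ≤ f j 0)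
    (hf1 : ∀ j, f (j + 1) 1 ≤ 𝔼 v, f j (if (A * B - W).mulVec v = 0 then 1 else 0)) :
    Achieves (verify K) s (verifyTime L U) (fun s' w => (SameFrom (K + 25) (K + 24) s s' ∧
      Env K n m L T A B s') ∧ (s'.idx (K + 23) = 0 ∨ s'.idx (K + 23) = 1) ∧
      (W = A * B → s'.idx (K + 23) = 1) ∧ w = f 0 (s'.idx (K + 23))) (f L 1) := by
  have hU := hb.cells
  have hβU := hb.le
  have hLβ : ∀ x ≤ L, x.size ≤ β := fun x hx => hb.size_le x (by omega)
  let I : State F → Prop := fun s' => (SameFrom (K + 25) (K + 24) s s' ∧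
      Env K n m L T A B s') ∧ (s'.idx (K + 23) = 0 ∨ s'.idx (K + 23) = 1) ∧
      (W = A * B → s'.idx (K + 23) = 1)
  let J : ℕ → State F → ℝ → Prop := fun j s' w => I s' ∧ s'.idx (K + 24) = j ∧
    w = f j (s'.idx (K + 23))
  refine Achieves.mono (Ensures.seq_achieves (ensures_straight (by simp [Instr.IsDet]) s)
    (R := J 0) (t₂ := L * (500 * U + 4 * β + 3) + β + 1) ?_) ?_ ?_
  · rintro s₁ rfl
    have h0 : J L (execAll [.idxMove (K + 23) (K + 27), .idxMove (K + 24) (K + 32)] s) (f L 1) := by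
      have h1 : SameFrom (K + 25) 0 s
          (execAll [.idxMove (K + 23) (K + 27), .idxMove (K + 24) (K + 32)] s) :=
        ⟨fun r hr => by
          simp (disch := omega) only [execAll, Instr.exec, Function.update_of_ne], fun a _ => rfl⟩
      have h2 : (execAll [.idxMove (K + 23) (K + 27), .idxMove (K + 24) (K + 32)] s).idx (K + 23) =
          1 := by
        simp [execAll, Instr.exec, hs.units.one]
      refine ⟨⟨⟨h1.mono le_rfl (by omega), hs.of_same h1 hs.work hs.fldShort hs.idxShort⟩, .inr h2,
        fun _ => h2⟩, ?_, by rw [h2]⟩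
      simp [execAll, Instr.exec, hs.rounds]
    refine Achieves.countdown (J := J) hb.one_le hLβ (fun j s' w h => ⟨h.1.1.2.units.zero,
      h.1.1.2.units.one, h.2.1⟩) ?_ L le_rfl _ _ h0
    rintro j hj s' w ⟨⟨⟨h1, h2⟩, h3, h4⟩, h5, rfl⟩
    set s₂ : State F := { s' with idx := Function.update s'.idx (K + 24) j } with hs₂
    have e1 : SameFrom (K + 25) 0 s' s₂ :=
      ⟨fun r hr => by simp [hs₂, show r ≠ K + 24 by omega], fun a _ => rfl⟩
    have e2 : Env K n m L T A B s₂ := h2.of_same e1 h2.work h2.fldShort h2.idxShort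
    have e3 : s₂.idx (K + 23) = s'.idx (K + 23) := by simp [hs₂]
    have e4 : s₂.idx (K + 24) = j := by simp [hs₂]
    have e5 : s₂.fldArr (K + 24) = matrixEntries W := by rw [← hW, ← h1.arr _ le_rfl]
    refine ((achieves_probe hb e2 e5 fun v =>
      f j (if (A * B - W).mulVec v = 0 then s'.idx (K + 23) else 0)).mono le_rfl ?_).anti ?_
    · rintro s₃ w ⟨g1, g2, v, g3, rfl⟩
      rw [e3] at g3
      refine ⟨⟨⟨((h1.trans e1).trans g1).mono (by omega) (by omega),
        g2⟩, ?_, ?_⟩, (g1.idx _ le_rfl).trans e4, by rw [g3]⟩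
      · rw [g3]; split_ifs
        · exact h3
        · exact .inl rfl
      · intro hWAB
        rw [g3, if_pos (by simp [hWAB]), h4 hWAB]
    · rcases h3 with h3 | h3
      · simp only [h3, ite_self]
        simpa using hf0 j
      · simp only [h3]; exact hf1 j
  · simp only [costAll, Instr.cost, Instr.exec, verifyTime]
    have h1 : L * (500 * U + 4 * β + 3) ≤ L * (507 * U) := by gcongr; omega
    have h2 := hLβ L le_rfl
    simp (disch := omega) only [Function.update_of_ne, hs.rounds, hs.units.one, Nat.size_one]
    omega
  · rintro s' w ⟨⟨h1, h2, h3⟩, -, h4⟩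
    exact ⟨h1, h2, h3, h4⟩

/-- What holds after checking. -/
structure Checked (K n m L T : ℕ) (A B W : Matrix (Fin n) (Fin n) F) (s s' : State F) : Prop where
  same : SameFrom (K + 25) (K + 24) s s'
  env : Env K n m L T A B s'
  bit : s'.idx (K + 23) = 0 ∨ s'.idx (K + 23) = 1
  accepts : W = A * B → s'.idx (K + 23) = 1

theorem succeeds_verify {K n m k L T β U : ℕ} {A B W : Matrix (Fin n) (Fin n) F} {s : State F}
    (hb : Bounds n k L T β U) (hs : Env K n m L T A B s)
    (hW : s.fldArr (K + 24) = matrixEntries W) (hne : W ≠ A * B) :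
    Succeeds (verify K) s (verifyTime L U) (Checked K n m L T A B W s)
      (fun s' => s'.idx (K + 23) = 0) (1 - (1 / 2) ^ L) := by
  classical
  -- A wrong product still accepted is detected in the next `j` probes with probability at least `1
  -- - (1/2)^j`.
  have h := verify_aux hb hs hW (fun j x => if x = 0 then 1 else 1 - (1 / 2) ^ j) (by simp) (by
    intro j
    have h1 := expect_mulVec_eq_zero_le (sub_ne_zero.2 hne.symm)
    have h2 : (𝔼 v, if (if (A * B - W).mulVec v = 0 then 1 else 0) = 0 then (1 : ℝ)
        else 1 - (1 / 2) ^ j) =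
        1 - (𝔼 v, if (A * B - W).mulVec v = 0 then (1 : ℝ) else 0) * (1 / 2) ^ j := by
      rw [Finset.expect_mul, ← Fintype.expect_const (ι := Fin n → F) (1 : ℝ),
        ← Finset.expect_sub_distrib, Fintype.expect_const]
      refine Finset.expect_congr rfl fun v _ => ?_
      split_ifs <;> simp_all
    rw [h2, if_neg one_ne_zero, pow_succ]
    have : (0 : ℝ) < (1 / 2) ^ j := by positivity
    nlinarith)
  refine Achieves.mono (h.anti (by simp)) le_rfl ?_
  rintro s' w ⟨h1, h2, h3, h4⟩
  refine ⟨⟨h1.1, h1.2, h2, h3⟩, ?_⟩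
  rw [h4]
  rcases h2 with h2 | h2 <;> simp [h2]

theorem ensures_verify {K n m k L T β U : ℕ} {A B W : Matrix (Fin n) (Fin n) F} {s : State F}
    (hb : Bounds n k L T β U) (hs : Env K n m L T A B s)
    (hW : s.fldArr (K + 24) = matrixEntries W) :
    Ensures (verify K) s (verifyTime L U) (Checked K n m L T A B W s) :=
  (verify_aux hb hs hW (fun _ _ => 0) (by simp) (by simp)).ensures.mono le_rfl
    fun _ ⟨_, h1, h2, h3, _⟩ => ⟨h1.1, h1.2, h2, h3⟩

/-! ### Repetition until acceptance -/

theorem Attains.add_const {G : Config F → ℝ → Prop} {c : Config F} {v : ℝ} (h : Attains G c v)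
    (x : ℝ) : Attains (fun c w => ∃ w', G c w' ∧ w = w' + x) c (v + x) := by
  induction h with
  | here hg hv => exact .here ⟨_, hg, rfl⟩ (by linarith)
  | step u hc _ hv ih =>
    refine .step (fun coin => u coin + x) hc ih ?_
    rw [Finset.expect_add_distrib, Fintype.expect_const]
    linarith

theorem Achieves.add_const {p : Prog F} {s : State F} {t : ℕ} {P : State F → ℝ → Prop} {v : ℝ}
    (h : Achieves p s t P v) (x : ℝ) :
    Achieves p s t (fun s w => ∃ w', P s w' ∧ w = w' + x) (v + x) :=
  fun l k => ((h l k).add_const x).mono fun _ _ ⟨w', hc, hw⟩ => ⟨hc.1, hc.2.1, w', hc.2.2, hw⟩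

open Classical in
theorem Succeeds.of_le {p : Prog F} {s : State F} {t : ℕ} {I G : State F → Prop} {v : ℝ}
    (h : Achieves p s t (fun s' w => I s' ∧ w ≤ if G s' then 1 else 0) v) :
    Succeeds p s t I G v := fun l k => by
  refine (h l k).bind ?_
  rintro c w ⟨h1, h2, h3, h4⟩
  exact .here ⟨h1, h2, h3, rfl⟩ h4

/-- A lower bound for the probability that one of `j` attempts with success probability `γ`
succeeds if a check with error probability `η` ends the attempts. -/
def retryProb (γ η : ℝ) : ℕ → ℝ
  | 0 => 0
  -- This is `γ * 1 + (1 - γ) * (1 - η) * retryProb γ η j`: a correct result is always accepted, a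
  -- wrong one is detected with probability `1 - η` and leaves `j` attempts. The form affine in the
  -- indicator of success suits `Achieves.scale` and `Achieves.add_const`.
  | j + 1 => γ * (1 - (1 - η) * retryProb γ η j) + (1 - η) * retryProb γ η j

theorem retryProb_mem {γ η : ℝ} (hγ : 0 ≤ γ) (hγ' : γ ≤ 1) (hη : 0 ≤ η) (hη' : η ≤ 1) (j : ℕ) :
    0 ≤ retryProb γ η j ∧ retryProb γ η j ≤ 1 := by
  induction j with
  | zero => simp [retryProb]
  | succ j ih =>
    have h1 : 0 ≤ (1 - η) * retryProb γ η j := mul_nonneg (by linarith) ih.1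
    have h2 : (1 - η) * retryProb γ η j ≤ 1 := mul_le_one₀ (by linarith) ih.1 ih.2
    simp only [retryProb]
    constructor <;> nlinarith

/-- The process can fail only if all `j` attempts are wrong or one of at most `j` checks is
deceived. The induction uses the exact recursion for the failure probability. -/
theorem one_sub_retryProb_le {γ η : ℝ} (hγ : 0 ≤ γ) (hγ' : γ ≤ 1) (hη : 0 ≤ η) (hη' : η ≤ 1)
    (j : ℕ) : 1 - retryProb γ η j ≤ (1 - γ) ^ j + j * η := by
  induction j with
  | zero => simp [retryProb]
  | succ j ih =>
    obtain ⟨h1, h2⟩ := retryProb_mem hγ hγ' hη hη' j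
    have h3 : 1 - retryProb γ η (j + 1) =
        (1 - γ) * (1 - retryProb γ η j) + (1 - γ) * (retryProb γ η j * η) := by
      simp only [retryProb]; ring
    have h4 := mul_le_mul_of_nonneg_left ih (by linarith : 0 ≤ 1 - γ)
    have h5 : (1 - γ) * (retryProb γ η j * η) ≤ η := by
      have : retryProb γ η j * η ≤ η := mul_le_of_le_one_left hη h2
      have h6 : 0 ≤ retryProb γ η j * η := mul_nonneg h1 hη
      nlinarith
    have h7 : (1 - γ) * (j * η) ≤ j * η := mul_le_of_le_one_left (by positivity) (by linarith)
    rw [h3, pow_succ]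
    push_cast
    nlinarith

/-- Repeat the program `q` until its result is accepted. -/
def retry (K : ℕ) (q : Prog F) : Prog F :=
  .seq (straight [.idxMove (K + 25) (K + 32), .idxMove (K + 23) (K + 26)])
    (countdown (K + 26) (K + 27) (K + 25)
      (.cond (.idxLt (K + 23) (K + 27)) (.seq q (verify K)) .skip))

/-- The time for the repetitions of a program with running time `t`. -/
def retryTime (L t U : ℕ) : ℕ := L * (t + verifyTime L U + 15 * U) + 10 * U

/-- Verdict `0` means that nothing has been accepted yet; the value is then the probability of
success with the remaining attempts. Once the verdict is `1`, the later rounds are skipped and the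
value is the indicator of a correct result. -/
theorem succeeds_retry {K n m k L T β U t : ℕ} {A B : Matrix (Fin n) (Fin n) F} {q : Prog F}
    {γ : ℝ} (hγ : 0 ≤ γ) (hγ' : γ ≤ 1) (hb : Bounds n k L T β U)
    (hq : ∀ s, Env K n m L T A B s → Succeeds q s t
      (fun s' => SameFrom (K + 23) (K + 29) s s' ∧ Env K n m L T A B s')
      (fun s' => s'.fldArr (K + 24) = matrixEntries (A * B)) γ)
    {s : State F} (hs : Env K n m L T A B s) :
    Succeeds (retry K q) s (retryTime L t U) (Env K n m L T A B)
      (fun s' => s'.fldArr (K + 24) = matrixEntries (A * B)) (retryProb γ ((1 / 2) ^ L) L) := by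
  classical
  have hU := hb.cells
  have hβU := hb.le
  have hLβ : ∀ x ≤ L, x.size ≤ β := fun x hx => hb.size_le x (by omega)
  have hη : (0 : ℝ) ≤ (1 / 2) ^ L := by positivity
  have hη' : ((1 / 2 : ℝ)) ^ L ≤ 1 := pow_le_one₀ (by norm_num) (by norm_num)
  set η : ℝ := (1 / 2) ^ L with hηdef
  let u := retryProb γ η
  let val : ℕ → State F → ℝ := fun j s' => if s'.idx (K + 23) = 0 then u j else
    if s'.fldArr (K + 24) = matrixEntries (A * B) then 1 else 0
  let J : ℕ → State F → ℝ → Prop := fun j s' w => Env K n m L T A B s' ∧ s'.idx (K + 25) = j ∧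
    (s'.idx (K + 23) = 0 ∨ s'.idx (K + 23) = 1) ∧ w = val j s'
  refine Succeeds.of_le (Achieves.mono (Ensures.seq_achieves
    (ensures_straight (by simp [Instr.IsDet]) s) (R := J 0)
    (t₂ := L * ((t + verifyTime L U + 5) + 4 * β + 3) + β + 1) ?_) ?_ ?_)
  · rintro s₁ rfl
    have h0 : J L (execAll [.idxMove (K + 25) (K + 32), .idxMove (K + 23) (K + 26)] s) (u L) := by
      have h1 : SameFrom (K + 26) 0 s
          (execAll [.idxMove (K + 25) (K + 32), .idxMove (K + 23) (K + 26)] s) :=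
        ⟨fun r hr => by
          simp (disch := omega) only [execAll, Instr.exec, Function.update_of_ne], fun a _ => rfl⟩
      have h2 : (execAll [.idxMove (K + 25) (K + 32), .idxMove (K + 23) (K + 26)] s).idx (K + 23) =
          0 := by
        simp [execAll, Instr.exec, hs.units.zero]
      refine ⟨hs.of_same h1 hs.work hs.fldShort hs.idxShort, ?_, .inl h2, by simp only [val, h2,
        if_true]⟩
      simp [execAll, Instr.exec, hs.rounds]
    refine Achieves.countdown (J := J) hb.one_le hLβ (fun j s' w h => ⟨h.1.units.zero,
      h.1.units.one, h.2.1⟩) ?_ L le_rfl _ _ h0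
    rintro j hj s' w ⟨h2, h5, h3, rfl⟩
    set s₂ : State F := { s' with idx := Function.update s'.idx (K + 25) j } with hs₂
    have e1 : SameFrom (K + 26) 0 s' s₂ :=
      ⟨fun r hr => by simp [hs₂, show r ≠ K + 25 by omega], fun a _ => rfl⟩
    have e2 : Env K n m L T A B s₂ := h2.of_same e1 h2.work h2.fldShort h2.idxShort
    have e3 : s₂.idx (K + 23) = s'.idx (K + 23) := by simp [hs₂]
    have e4 : s₂.idx (K + 25) = j := by simp [hs₂]
    refine (Achieves.cond (t := t + verifyTime L U + 1) (fun h => ?_) fun h => ?_).mono ?_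
      fun _ _ h => h
    · have e5 : s'.idx (K + 23) = 0 := by
        simp only [Test.holds, e2.units.one, decide_eq_true_eq, e3] at h
        omega
      have e6 : val (j + 1) s' = γ * (1 - (1 - η) * u j) + (1 - η) * u j := by
        simp only [val, e5, if_true, u, retryProb]
      obtain ⟨hu0, hu1⟩ : 0 ≤ u j ∧ u j ≤ 1 := retryProb_mem hγ hγ' hη hη' j
      have hr1 : (1 - η) * u j ≤ 1 := mul_le_one₀ (by linarith) hu0 hu1
      rw [e6]
      -- The payoff after the attempt is `1` for a correct result and `(1 - η) * u j` for a wrong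
      -- one, an affine function of the indicator of success.
      refine Achieves.seq ((Achieves.scale (hq s₂ e2) (sub_nonneg.2 hr1)).add_const _) ?_
      rintro s₃ w ⟨w₁, ⟨w₂, ⟨⟨g1, g2⟩, rfl⟩, rfl⟩, rfl⟩
      obtain ⟨W, hW⟩ := exists_matrixEntries g2.work
      have e7 : s₃.idx (K + 25) = j := (g1.idx _ (by omega)).trans e4
      by_cases hWAB : W = A * B
      · rw [if_pos (show s₃.fldArr (K + 24) = _ by rw [← hW, hWAB])]
        refine (ensures_verify hb g2 hW.symm).achieves fun s₄ h => ?_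
        have e8 : s₄.fldArr (K + 24) = matrixEntries (A * B) := by
          rw [h.same.arr _ le_rfl, ← hW, hWAB]
        refine ⟨h.env, (h.same.idx _ le_rfl).trans e7, h.bit, ?_⟩
        simp only [val, h.accepts hWAB, one_ne_zero, if_false, e8, if_true]
        ring
      · rw [if_neg (show s₃.fldArr (K + 24) ≠ _ by
          rw [← hW, Ne, matrixEntries_injective.eq_iff]; exact hWAB)]
        refine Achieves.mono ((Achieves.scale (succeeds_verify hb g2 hW.symm hWAB) hu0).anti
          (le_of_eq (by ring))) le_rfl ?_
        rintro s₄ w ⟨w', ⟨h, rfl⟩, rfl⟩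
        have e8 : s₄.fldArr (K + 24) ≠ matrixEntries (A * B) := by
          rw [h.same.arr _ le_rfl, ← hW, Ne, matrixEntries_injective.eq_iff]; exact hWAB
        refine ⟨h.env, (h.same.idx _ le_rfl).trans e7, h.bit, ?_⟩
        rcases h.bit with hbit | hbit <;> simp [val, hbit, e8]
    · have e5 : s'.idx (K + 23) = 1 := by
        simp only [Test.holds, e2.units.one, decide_eq_false_iff_not, e3] at h
        omega
      refine (Achieves.skip ⟨e2, e4, by rw [e3]; exact h3, ?_⟩).mono (by omega) fun _ _ h => h
      simp only [val, e3, e5, one_ne_zero, if_false]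
      rfl
    · simp only [Test.cost, e2.units.one, e3, Nat.size_one]
      have : (s'.idx (K + 23)).size ≤ 1 := by rcases h3 with h3 | h3 <;> simp [h3]
      omega
  · simp only [costAll, Instr.cost, Instr.exec, retryTime]
    have h1 : L * (t + verifyTime L U + 5 + 4 * β + 3) ≤ L * (t + verifyTime L U + 15 * U) :=
      Nat.mul_le_mul_left _ (by omega)
    have h2 := hLβ L le_rfl
    simp (disch := omega) only [Function.update_of_ne, hs.rounds, hs.units.zero, Nat.size_zero]
    omega
  · rintro s' w ⟨h1, -, h2, rfl⟩
    refine ⟨h1, ?_⟩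
    simp only [val]
    rcases h2 with h2 | h2
    -- If nothing was accepted in the end, the value is `u 0 = 0`, even though the array might be
    -- correct by luck; hence only an inequality.
    · simp only [h2, if_true, u, retryProb]; split_ifs <;> simp
    · by_cases hg : s'.fldArr (K + 24) = matrixEntries (A * B) <;> simp [h2, hg]

/-! ### Preparation and the whole program -/

/-- Copy the matrix `src` to the array `dst`. -/
def copy (K src dst : ℕ) : Prog F :=
  .seq (fill K dst (K + 29))
    (transfer K src dst (K + 26) (K + 26) (K + 26) (K + 26) (K + 28) (K + 28) (.fldMove 2 1))

theorem ensures_copy {K n k L T β U src dst : ℕ} {X : Matrix (Fin n) (Fin n) F} {s : State F}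
    (hb : Bounds n k L T β U) (hu : HasUnits K s) (hdim : s.idx (K + 28) = n)
    (hsq : s.idx (K + 29) = n * n) (hX : s.fldArr src = matrixEntries X) (hne : src ≠ dst)
    (hshort : (s.fldArr dst).length ≤ n * n + T) :
    Ensures (copy K src dst) s (115 * U) (Writes 12 dst (matrixEntries X) s) := by
  have hU := hb.cells
  have hcells : ∀ x ≤ n * n + 1, x.size ≤ β := fun x hx => hb.size_sq x (by nlinarith)
  refine (Ensures.seq ((ensures_fillMatrix (n := n) hu (by omega) hsq hcells).mono
    (t' := 34 * U) (by have := hb.fill_le; omega) fun _ h => h)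
    (t₂ := 80 * U) ?_).mono (by omega) fun _ h => h
  rintro s₁ ⟨R, g1⟩
  have hu₁ := hu.of_idx g1.idx
  have hdim₁ : s₁.idx (K + 28) = n := (g1.idx _ (by omega)).trans hdim
  refine (ensures_transferMatrix (src := src) (dst := dst) combines_move hne
    ⟨hu₁, hdim₁, hu₁.zero, hu₁.zero, hu₁.zero, hu₁.zero, hdim₁, hdim₁, by omega,
      by rw [g1.self]; exact length_matrixEntries _⟩ hb.size_sq (by omega) (by omega) (by omega)
      (by omega) g1.self).mono hb.transfer_le fun s₂ g2 => ?_
  have h := (g1.trans g2).mono (d' := 12) (by omega)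
  rw [g1.other hne, hX] at h
  refine ⟨h.idx, h.fldArr.trans ?_, h.idxArr⟩
  congr 2
  ext i j
  simp only [Nat.zero_le, zero_add, Fin.is_lt, and_self, Nat.sub_zero, if_true,
    getD_matrixEntries]

theorem size_eq_size_half {x : ℕ} (hx : 0 < x) : x.size = (x / 2).size + 1 := by
  have h := Nat.size_bit (b := x.bodd) (n := x.div2) (by rw [Nat.bit_bodd_div2]; omega)
  rwa [Nat.bit_bodd_div2, Nat.div2_val] at h

/-- Add `c` times the bit length of the register `0` to the register `K + 32`. -/
def addSize (K c : ℕ) : Prog F :=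
  .seq (straight [.idxMove 1 0, .idxConst 2 2, .idxConst 3 c])
    (.loop (.idxLt (K + 26) 1) (straight [.idxArith .quot 1 1 2,
      .idxArith .plus (K + 32) (K + 32) 3]))

/-- This provides the logarithmic number of rounds. Register `1` is halved until it vanishes, and
the content of `K + 32` plus `c` times the bit length of register `1` is invariant. -/
theorem ensures_addSize {K c β n : ℕ} {s : State F} (hK : s.idx (K + 26) = 0)
    (hn : s.idx 0 = n) (hL : s.idx (K + 32) = 0) (hβ : ∀ x ≤ n + c + 2 + c * n.size, x.size ≤ β)
    (h1 : 1 ≤ β) :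
    Ensures (addSize K c) s ((n.size + 1) * (20 * β)) fun s' => s'.idx (K + 32) = c * n.size ∧
      (∀ r, 4 ≤ r → r ≠ K + 32 → s'.idx r = s.idx r) ∧ s'.idx 0 = n ∧ s'.fldArr = s.fldArr ∧
      s'.idxArr = s.idxArr := by
  let J : ℕ → State F → Prop := fun x s' => x ≤ n ∧ s'.idx 1 = x ∧
    s'.idx (K + 32) + c * x.size = c * n.size ∧ s'.idx 2 = 2 ∧ s'.idx 3 = c ∧
    (∀ r, 4 ≤ r → r ≠ K + 32 → s'.idx r = s.idx r) ∧ s'.idx 0 = n ∧ s'.fldArr = s.fldArr ∧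
      s'.idxArr = s.idxArr
  have e2 := hβ 2 (by omega)
  have ec := hβ c (by omega)
  have loop : ∀ y x, x.size = y → ∀ s', J x s' → Ensures (.loop (.idxLt (K + 26) 1)
      (straight [.idxArith .quot 1 1 2, .idxArith .plus (K + 32) (K + 32) 3])) s'
      (y * (15 * β) + β + 1) (J 0) := by
    intro y
    induction y with
    | zero =>
      intro x hx s' h
      obtain rfl : x = 0 := Nat.size_eq_zero.1 hx
      obtain ⟨-, hx1, -, -, -, hr, -⟩ := id h
      have h0 : s'.idx (K + 26) = 0 := (hr _ (by omega) (by omega)).trans hK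
      refine (ensures_loop_false (by simp [Test.holds, h0, hx1]) h).mono ?_ fun _ h => h
      simp [Test.cost, h0, hx1]
    | succ y ih =>
      intro x hx s' ⟨hxn, hx1, hx2, hx3, hx4, hr, hx5, hx6, hx7⟩
      have h0 : s'.idx (K + 26) = 0 := (hr _ (by omega) (by omega)).trans hK
      have hx0 : 0 < x := by
        rcases Nat.eq_zero_or_pos x with rfl | h
        · simp at hx
        · exact h
      have hs := size_eq_size_half hx0
      have hxβ := hβ x (by omega)
      have hxβ' := hβ (x / 2) (by omega)
      have hc := hβ (s'.idx (K + 32)) (by omega)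
      have hc' := hβ (s'.idx (K + 32) + c) (by rw [hs, mul_add] at hx2; omega)
      refine (ensures_loop_true (t₁ := 10 * β) (by simpa [Test.holds, h0, hx1] using hx0)
        ((ensures_straight (by simp [Instr.IsDet]) s').mono ?_ (Q := J (x / 2)) ?_)
        (ih (x / 2) (by omega))).mono ?_ fun _ h => h
      · simp (disch := omega) only [costAll, Instr.cost, Instr.exec, Function.update_of_ne, hx1,
          hx3, hx4, IdxOp.eval]
        omega
      · rintro s₂ rfl
        refine ⟨by omega, ?_, ?_, ?_, ?_, fun r hr1 hr2 => ?_, ?_, hx6, hx7⟩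
        · simp (disch := omega) only [execAll, Instr.exec, Function.update_of_ne,
            Function.update_self, hx1, hx3, IdxOp.eval]
        · simp (disch := omega) only [execAll, Instr.exec, Function.update_of_ne,
            Function.update_self, hx1, hx3, hx4, IdxOp.eval]
          rw [hs, mul_add] at hx2
          omega
        · simp (disch := omega) only [execAll, Instr.exec, Function.update_of_ne, hx3]
        · simp (disch := omega) only [execAll, Instr.exec, Function.update_of_ne, hx4]
        · simp (disch := omega) only [execAll, Instr.exec, Function.update_of_ne, hr]
        · simp (disch := omega) only [execAll, Instr.exec, Function.update_of_ne, hx5]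
      · simp only [Test.cost, h0, hx1, Nat.size_zero]
        rw [add_mul y]
        omega
  have en := hβ n (by omega)
  refine (Ensures.seq (P := J n) (t₁ := 10 * β) ((ensures_straight (by simp [Instr.IsDet]) s).mono ?_ ?_)
    (loop n.size n rfl)).mono ?_ ?_
  · simp (disch := omega) only [costAll, Instr.cost, hn]
    omega
  · rintro s₂ rfl
    refine ⟨le_rfl, ?_, ?_, ?_, ?_, fun r hr1 hr2 => ?_, ?_, rfl, rfl⟩
    · simp (disch := omega) only [execAll, Instr.exec, Function.update_of_ne,
        Function.update_self, hn]
    · simp (disch := omega) only [execAll, Instr.exec, Function.update_of_ne, hL, zero_add]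
    · simp (disch := omega) only [execAll, Instr.exec, Function.update_of_ne, Function.update_self]
    · simp (disch := omega) only [execAll, Instr.exec, Function.update_self]
    · simp (disch := omega) only [execAll, Instr.exec, Function.update_of_ne]
    · simp (disch := omega) only [execAll, Instr.exec, Function.update_of_ne, hn]
  · nlinarith
  · rintro s₃ ⟨-, -, h1, -, -, h2, h3, h4, h5⟩
    exact ⟨by simpa using h1, h2, h3, h4, h5⟩

/-- Prepare the persistent part of the memory. -/
def setup (K k c : ℕ) : Prog F :=
  .seq (straight [.idxMove (K + 28) 0, .idxConst (K + 27) 1, .idxArith .times (K + 29) 0 0,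
    .idxConst 1 k, .idxArith .quot (K + 30) 0 1, .idxArith .minus (K + 31) 0 (K + 30)])
    (.seq (addSize K c) (.seq (copy K 0 (K + 29)) (.seq (copy K 1 (K + 30))
      (fill K (K + 24) (K + 29)))))

theorem ensures_setup {K n k c T β U : ℕ} (A B : Matrix (Fin n) (Fin n) F) (hc : 0 < c)
    (hb : Bounds n k (c * n.size) T β U) (hcβ : ∀ x ≤ n + c + 2 + c * n.size, x.size ≤ β) :
    Ensures (setup K k c) (pairInput A B) ((c * n.size + 20) * (20 * U))
      (Env K n (n / k) (c * n.size) T A B) := by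
  have hU := hb.cells
  have hβU := hb.le
  have hβ1 := hb.one_le
  have hcells : ∀ x ≤ n * n + 1, x.size ≤ β := fun x hx => hb.size_sq x (by nlinarith)
  have en := hb.size_sq n (by nlinarith)
  have en2 := hb.size_sq (n * n) (by nlinarith)
  have ek := hb.size_le k (by omega)
  have em := hb.size_sq (n / k) (by have := Nat.div_le_self n k; nlinarith)
  have eg := hb.size_sq (n - n / k) (by have := Nat.sub_le n (n / k); nlinarith)
  set s : State F := pairInput A B with hs
  have hn : s.idx 0 = n := by simp [hs, pairInput, sizeInput]
  have hz : ∀ r, 1 ≤ r → s.idx r = 0 := fun r hr => by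
    simp [hs, pairInput, sizeInput, show r ≠ 0 by omega]
  have ha0 : s.fldArr 0 = matrixEntries A := by simp [hs, pairInput]
  have ha1 : s.fldArr 1 = matrixEntries B := by simp [hs, pairInput]
  have ha2 : ∀ a, 2 ≤ a → s.fldArr a = [] := fun a ha => by
    simp [hs, pairInput, show a ≠ 0 by omega, show a ≠ 1 by omega]
  have hai : ∀ a, s.idxArr a = [] := fun a => by simp [hs, pairInput, sizeInput, State.blank]
  let R : State F → Prop := fun s' => HasUnits K s' ∧ s'.idx (K + 28) = n ∧
    s'.idx (K + 29) = n * n ∧ s'.idx (K + 30) = n / k ∧ s'.idx (K + 31) = n - n / k ∧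
    s'.idxArr = s.idxArr
  have hR : ∀ {s₁ s₂ : State F} {d a : ℕ} {l : List F}, R s₁ → Writes d a l s₁ s₂ → d ≤ 12 → R s₂ := by
    rintro s₁ s₂ d a l ⟨h1, h2, h3, h4, h5, h6⟩ hw hd
    exact ⟨h1.of_idx hw.idx, (hw.idx _ (by omega)).trans h2, (hw.idx _ (by omega)).trans h3,
      (hw.idx _ (by omega)).trans h4, (hw.idx _ (by omega)).trans h5, hw.idxArr.trans h6⟩
  refine (Ensures.seq (P := fun s₁ => R s₁ ∧ s₁.idx 0 = n ∧ s₁.idx (K + 32) = 0 ∧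
    s₁.fldArr = s.fldArr) (t₁ := 40 * U)
    ((ensures_straight (by simp [Instr.IsDet]) s).mono ?_ ?_)
    (t₂ := (n.size + 1) * (20 * β) + (115 * U + (115 * U + 34 * U + 1) + 1) + 1) ?_).mono ?_
    fun _ h => h
  · simp (disch := omega) only [costAll, Instr.cost, Instr.exec, Function.update_of_ne,
      Function.update_self, hn, IdxOp.eval, Nat.size_one]
    omega
  · rintro s₁ rfl
    refine ⟨⟨⟨?_, ?_⟩, ?_, ?_, ?_, ?_, rfl⟩, ?_, ?_, rfl⟩
    · simp (disch := omega) only [execAll, Instr.exec, Function.update_of_ne, hz]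
    all_goals simp (disch := omega) only [execAll, Instr.exec, Function.update_of_ne,
      Function.update_self, hn, hz, IdxOp.eval]
  · rintro s₁ ⟨⟨h1, h2, h3, h4, h5, h6⟩, h7, h8, h9⟩
    refine Ensures.seq (ensures_addSize h1.zero h7 h8 hcβ hβ1) ?_
    rintro s₂ ⟨g1, g2, -, g3, g4⟩
    have hR₂ : R s₂ := ⟨⟨(g2 _ (by omega) (by omega)).trans h1.zero,
      (g2 _ (by omega) (by omega)).trans h1.one⟩, (g2 _ (by omega) (by omega)).trans h2,
      (g2 _ (by omega) (by omega)).trans h3, (g2 _ (by omega) (by omega)).trans h4,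
      (g2 _ (by omega) (by omega)).trans h5, g4.trans h6⟩
    have harr : s₂.fldArr = s.fldArr := g3.trans h9
    refine Ensures.seq (ensures_copy (X := A) hb hR₂.1 hR₂.2.1 hR₂.2.2.1 (by rw [harr, ha0])
      (by omega) (by rw [harr, ha2 _ (by omega)]; simp)) fun s₃ w1 => ?_
    have hR₃ := hR hR₂ w1 le_rfl
    refine Ensures.seq (ensures_copy (X := B) hb hR₃.1 hR₃.2.1 hR₃.2.2.1
      (by rw [w1.other (by omega), harr, ha1])
      (by omega) (by rw [w1.other (by omega), harr, ha2 _ (by omega)]; simp)) fun s₄ w2 => ?_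
    have hR₄ := hR hR₃ w2 le_rfl
    refine (ensures_fillMatrix (n := n) hR₄.1 (by omega) hR₄.2.2.1 hcells).mono ?_ ?_
    · have := hb.fill_le
      rw [w2.other (by omega), w1.other (by omega), harr, ha2 _ (by omega)]
      simp only [List.length_nil]
      omega
    · rintro s₅ ⟨X, w3⟩
      have hR₅ := hR hR₄ w3 (by omega)
      refine ⟨hR₅.1, hR₅.2.1, hR₅.2.2.1, hR₅.2.2.2.1, hR₅.2.2.2.2.1, ?_, ?_, ?_, ?_, fun a => ?_,
        fun a _ => ?_⟩
      · rw [w3.idx _ (by omega), w2.idx _ (by omega), w1.idx _ (by omega), g1]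
      · rw [w3.other (by omega), w2.other (by omega), w1.self]
      · rw [w3.other (by omega), w2.self]
      · rw [w3.self, length_matrixEntries]
      · refine le_trans ?_ (Nat.le_add_right (n * n) T)
        rw [w3.fldArr, w2.fldArr, w1.fldArr, harr]
        simp only [Function.update_apply]
        split_ifs
        · simp
        · simp
        · simp
        · rcases Nat.lt_or_ge a 2 with ha | ha
          · interval_cases a
            · simp [ha0]
            · simp [ha1]
          · simp [ha2 a ha]
      · rw [hR₅.2.2.2.2.2, hai]; simp
  · have h1 : n.size ≤ c * n.size := Nat.le_mul_of_pos_left _ hc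
    have h2 : (n.size + 1) * (20 * β) ≤ (c * n.size + 1) * (20 * U) := by gcongr
    rw [add_mul (c * n.size)] at h2 ⊢
    omega

/-- Multiply the matrices in the arrays `0` and `1`. -/
def solve (K k c n₀ : ℕ) (p : Prog F) : Prog F :=
  .seq (setup K k c) (.seq (retry K (attempt K k n₀ p)) (copy K (K + 24) 2))

/-- The running time of `solve`. -/
def solveTime (K k c n₀ n U : ℕ) : ℕ :=
  (c * n.size + 20) * (20 * U) + (retryTime (c * n.size) (attemptTime K k n₀ U) U + 115 * U + 1) + 1

open Classical in
theorem solve_spec {K n k c T β U n₀ : ℕ} {p : Prog F} {γ δ : ℝ} (A B : Matrix (Fin n) (Fin n) F)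
    (hc : 0 < c) (hS : Setting p K n (n / k) (c * n.size) T k β U)
    (hcβ : ∀ x ≤ n + c + 2 + c * n.size, x.size ≤ β) (hγ : 0 ≤ γ) (hγ' : γ ≤ 1)
    (hv : (n < n₀ ∧ γ ≤ (1 / Fintype.card F : ℝ) ^ (n * n)) ∨
      (n₀ ≤ n ∧ (0 ≤ δ ∧ 𝔼 z : (Fin (n / k) → Fin n → F) × (Fin (n / k) → Fin n → F),
      (if ¬ GoodStrips p k δ z then 1 else 0 : ℝ) ≤ 1 / 8) ∧ n ≤ (k + 1) * (n / k) ∧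
        γ ≤ blockProb k δ ^ ((k + 1) ^ 2))) :
    HaltsWithin (solve K k c n₀ p) (pairInput A B) (solveTime K k c n₀ n U) ∧
      retryProb γ ((1 / 2) ^ (c * n.size)) (c * n.size) ≤
        (haltProb (solve K k c n₀ p) (pairInput A B) (outputsMatrix (A * B))).toReal := by
  have hb := hS.bounds
  refine Achieves.haltsWithin (Ensures.seq_achieves (ensures_setup A B hc hb hcβ)
    fun s hs => Achieves.seq (succeeds_retry hγ hγ' hb
      (fun s hs => succeeds_attempt hS hs hv) hs) ?_)
  rintro s₁ w ⟨h1, rfl⟩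
  obtain ⟨W, hW⟩ := exists_matrixEntries h1.work
  refine (ensures_copy (X := W) hb h1.units h1.dim h1.square hW.symm (by omega)
    (h1.fldShort 2)).achieves fun s₂ h2 => le_of_eq ?_
  have h3 : s₂ ∈ outputsMatrix (A * B) ↔ s₁.fldArr (K + 24) = matrixEntries (A * B) := by
    rw [← hW, ← h2.self]; rfl
  by_cases h4 : s₁.fldArr (K + 24) = matrixEntries (A * B) <;> simp [h4, h3]

/-! ### A quadratic lower bound for the given running time -/

theorem Instr.length_exec_le (i : Instr F) (coin : F × Bool) (s : State F) (a : ℕ) :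
    ((i.exec coin s).fldArr a).length ≤ (s.fldArr a).length + 1 := by
  cases i <;> simp only [Instr.exec, Function.update_apply] <;> (try split_ifs with h) <;>
    (try subst h) <;> simp <;> omega

theorem Config.length_next_le (c : Config F) (coin : F × Bool) (a : ℕ) :
    ((c.next coin).state.fldArr a).length + c.clock ≤
      (c.state.fldArr a).length + (c.next coin).clock := by
  obtain ⟨todo, s, k⟩ := c
  match todo with
  | [] => simp [Config.next]
  | .skip :: l => simp [Config.next]
  | .instr i :: l =>
    have h1 := i.cost_pos s
    have h2 := i.length_exec_le coin s a
    simp only [Config.next]; omega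
  | .seq p q :: l => simp [Config.next]
  | .cond b p q :: l => simp [Config.next]
  | .loop b p :: l => simp [Config.next]

theorem length_le_of_mem_support_run {t : ℕ} {c c' : Config F} (h : c' ∈ (run t c).support)
    (a : ℕ) : (c'.state.fldArr a).length + c.clock ≤ (c.state.fldArr a).length + c'.clock := by
  induction t generalizing c with
  | zero =>
    simp only [run, PMF.support_pure, Set.mem_singleton_iff] at h
    rw [h]
  | succ t ih =>
    obtain ⟨coin, h⟩ := mem_support_run_succ.1 h
    have h1 := ih h
    have h2 := c.length_next_le coin a
    omega

/-- Some run fills the initially empty array `2` with `n * n` entries, and an array grows no faster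
than the clock. This is what makes quadratic overhead affordable. -/
theorem sq_le_of_mulProb_pos {n t : ℕ} {p : Prog F} {A B : Matrix (Fin n) (Fin n) F}
    (h : HaltsWithin p (pairInput A B) t) (hpos : 0 < mulProb p (A, B)) : n * n ≤ t := by
  rw [mulProb, ← runProb_eq_haltProb h, runProb] at hpos
  have h1 : (run t ⟨[p], pairInput A B, 0⟩).toOuterMeasure
      {c | c.Halted ∧ c.state ∈ outputsMatrix (A * B)} ≠ 0 := fun h0 => by
    simp [h0] at hpos
  rw [Ne, PMF.toOuterMeasure_apply_eq_zero_iff, Set.not_disjoint_iff] at h1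
  obtain ⟨c, hc, -, hc'⟩ := h1
  have h2 := length_le_of_mem_support_run hc 2
  have h3 : c.state.fldArr 2 = matrixEntries (A * B) := hc'
  rw [h3, length_matrixEntries] at h2
  have h4 := (h c hc).2
  simp [pairInput] at h2
  omega

theorem expectation_uniform {α : Type*} [Fintype α] [Nonempty α] (f : α → ℝ) :
    expectation (PMF.uniformOfFintype α) f = 𝔼 a, f a := by
  rw [expectation, Fintype.expect_eq_sum_div_card, Finset.sum_div]
  refine Finset.sum_congr rfl fun a _ => ?_
  simp [PMF.uniformOfFintype_apply, div_eq_inv_mul]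

/-! ### Choice of the constants -/

open Classical in
theorem expect_not_goodStrips_le {n k : ℕ} {p : Prog F} {ε : ℝ} (hε : 0 < ε)
    (hp : ε ≤ 𝔼 X : Matrix (Fin n) (Fin n) F × Matrix (Fin n) (Fin n) F, mulProb p X)
    (hk : (7 / 8 : ℝ) ^ k ≤ ε / 4) :
    𝔼 z : (Fin (n / k) → Fin n → F) × (Fin (n / k) → Fin n → F),
      (if ¬ GoodStrips p k (ε / (4 * k)) z then 1 else 0 : ℝ) ≤ 1 / 8 := by
  set m := n / k
  have hfit : ∀ i < k, i * m + m ≤ n := fun i hi => by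
    have h1 : (i + 1) * m ≤ k * m := Nat.mul_le_mul_right m hi
    have h2 : k * m ≤ n := Nat.mul_div_le n k
    rw [add_mul] at h1
    omega
  refine expect_bad_le (get := fun i => getStrips m (i * m) (i * m))
    (put := fun i => putStrips (i * m) (i * m)) (fun i hi => isLens_strips (hfit i hi) (hfit i hi))
    (fun i hi j hj hij z X => ?_) (mulProb_nonneg p) (mulProb_le_one p) hε hp hk _
    fun z hz i hi => ?_
  · have h : i * m + m ≤ j * m ∨ j * m + m ≤ i * m := by
      rcases lt_or_gt_of_ne hij with h | h
      · have := Nat.mul_le_mul_right m (Nat.succ_le_of_lt h)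
        rw [Nat.succ_mul] at this
        exact .inl this
      · have := Nat.mul_le_mul_right m (Nat.succ_le_of_lt h)
        rw [Nat.succ_mul] at this
        exact .inr this
    simp [getStrips, putStrips, getRows_putRows_of_disjoint h]
  · by_contra! hlt
    exact hz ⟨i, hi, hlt.le⟩

/-- With `s` the bit length of `n`, one has `n ≤ 2^s`, so it suffices to make each of the two error
terms in `one_sub_retryProb_le` at most `(1/2)^(c * s + 1)`. -/
theorem exists_retryProb_ge {γ : ℝ} (hγ : 0 < γ) (hγ' : γ ≤ 1) (c : ℕ) :
    ∃ d, 0 < d ∧ ∀ n : ℕ, 1 ≤ n →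
      1 - 1 / (n : ℝ) ^ c ≤ retryProb γ ((1 / 2) ^ (d * n.size)) (d * n.size) := by
  obtain ⟨e, he⟩ := exists_pow_lt_of_lt_one (show (0 : ℝ) < (1 / 2) ^ (c + 1) by positivity)
    (show 1 - γ < 1 by linarith)
  -- The summand `e` serves repeated failure of the attempts, and `c + 2` serves deceived checks.
  -- The number of rounds is `2 * d * s`, so that half of the exponent can absorb the factor `2 * d
  -- * s ≤ 2 * 2^(d * s)`.
  set d := e + c + 2 with hd
  refine ⟨2 * d, by omega, fun n hn => ?_⟩
  set s := n.size with hs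
  have hs1 : 1 ≤ s := Nat.size_pos.2 hn
  have hns : (n : ℝ) ≤ 2 ^ s := by exact_mod_cast (Nat.lt_size_self n).le
  have hn0 : (0 : ℝ) < n := by exact_mod_cast hn
  have h1 := one_sub_retryProb_le hγ.le hγ' (η := (1 / 2) ^ (2 * d * s)) (by positivity)
    (pow_le_one₀ (by norm_num) (by norm_num)) (2 * d * s)
  have h2 : (1 / 2 : ℝ) ^ (c * s) ≤ 1 / (n : ℝ) ^ c := by
    rw [one_div_pow, mul_comm, pow_mul]
    exact one_div_le_one_div_of_le (by positivity) (pow_le_pow_left₀ hn0.le hns c)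
  have hsplit : (1 / 2 : ℝ) ^ (c * s) = (1 / 2) ^ (c * s + 1) + (1 / 2) ^ (c * s + 1) := by
    rw [pow_succ]; ring
  have h3 : (1 - γ) ^ (2 * d * s) ≤ (1 / 2) ^ (c * s + 1) :=
    calc (1 - γ) ^ (2 * d * s) ≤ (1 - γ) ^ (e * s) :=
          pow_le_pow_of_le_one (by linarith) (by linarith) (by gcongr; omega)
      _ = ((1 - γ) ^ e) ^ s := pow_mul _ _ _
      _ ≤ ((1 / 2) ^ (c + 1)) ^ s := pow_le_pow_left₀ (pow_nonneg (by linarith) _) he.le _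
      _ = (1 / 2) ^ ((c + 1) * s) := (pow_mul _ _ _).symm
      _ ≤ (1 / 2) ^ (c * s + 1) :=
          pow_le_pow_of_le_one (by norm_num) (by norm_num) (by rw [add_mul]; omega)
  have h4 : ((2 * d * s : ℕ) : ℝ) * (1 / 2) ^ (2 * d * s) ≤ (1 / 2) ^ (c * s + 1) := by
    have h5 : ((2 * d * s : ℕ) : ℝ) ≤ 2 * 2 ^ (d * s) := by
      have : d * s ≤ 2 ^ (d * s) := Nat.lt_two_pow_self.le
      rw [mul_assoc]
      exact_mod_cast Nat.mul_le_mul_left 2 this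
    calc ((2 * d * s : ℕ) : ℝ) * (1 / 2) ^ (2 * d * s)
        ≤ 2 * 2 ^ (d * s) * (1 / 2) ^ (2 * d * s) := by gcongr
      _ = 2 * (1 / 2) ^ (d * s) := by
          rw [mul_assoc 2 d s, two_mul (d * s), pow_add, ← mul_assoc, mul_assoc 2, ← mul_pow]
          norm_num
      _ ≤ 2 * (1 / 2) ^ (c * s + 2) := by
          refine mul_le_mul_of_nonneg_left
            (pow_le_pow_of_le_one (by norm_num) (by norm_num) ?_) (by norm_num)
          rw [hd, add_mul, add_mul]
          omega
      _ = (1 / 2) ^ (c * s + 1) := by rw [pow_succ (1 / 2 : ℝ) (c * s + 1)]; ring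
  linarith

end RAM

/-! ### Asymptotics of the running time -/

namespace RAM

theorem size_mul_le (a b : ℕ) : (a * b).size ≤ a.size + b.size := by
  rw [Nat.size_le, pow_add]
  exact Nat.mul_lt_mul'' (Nat.lt_size_self a) (Nat.lt_size_self b)

/-- A bound for the bit lengths of index registers. -/
def sizeBound (k c n : ℕ) : ℕ := Nat.size ((n + 1) ^ 2 + k + c * n.size + c + 2)

theorem sizeBound_le {k c n : ℕ} (hn : 1 ≤ n) :
    sizeBound k c n ≤ (Nat.size (6 + k + 2 * c) + 2) * n.size := by
  have h1 : (n + 1) ^ 2 + k + c * n.size + c + 2 ≤ (6 + k + 2 * c) * (n * n) := by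
    have h2 := Nat.mul_le_mul_left c ((size_le_self n).trans (Nat.le_mul_self n))
    have h3 : 1 ≤ n * n := Nat.mul_pos hn hn
    have h4 := Nat.le_mul_self n
    have h5 := Nat.mul_le_mul_left k h3
    have h6 := Nat.mul_le_mul_left c h3
    nlinarith
  have h2 : 1 ≤ n.size := Nat.size_pos.2 hn
  have h3 := Nat.mul_le_mul_left (Nat.size (6 + k + 2 * c)) h2
  calc sizeBound k c n ≤ Nat.size ((6 + k + 2 * c) * (n * n)) := Nat.size_le_size h1
    _ ≤ Nat.size (6 + k + 2 * c) + (n.size + n.size) :=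
        (size_mul_le _ _).trans (Nat.add_le_add_left (size_mul_le _ _) _)
    _ ≤ _ := by rw [add_mul]; omega

/-- There are up to `c * n.size` attempts, each followed by `c * n.size` probes, which gives the
square of `n.size`; a call, a probe and a matrix operation each take time `O(U)`. -/
theorem solveTime_le (K k c n₀ : ℕ) : ∃ M, ∀ n U : ℕ, 1 ≤ n → 1 ≤ U →
    solveTime K k c n₀ n U ≤ M * (n.size ^ 2 * U) := by
  refine ⟨20 * c + 400 + (c * ((k + 1) ^ 2 * (120 * K + 60 * k + 6001) + (2 * n₀ + 60) + 25) +
    507 * c ^ 2) + 127, fun n U hn hU => ?_⟩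
  have hs : 1 ≤ n.size := Nat.size_pos.2 hn
  simp only [solveTime, retryTime, verifyTime]
  generalize n.size = s at hs ⊢
  set b := 120 * K + 60 * k + 6000 with hb
  have h1 : attemptTime K k n₀ U ≤ ((k + 1) ^ 2 * (b + 1) + (2 * n₀ + 60)) * U := by
    rw [attemptTime, blockTime, ← hb, add_mul ((k + 1) ^ 2 * (b + 1)), mul_assoc ((k + 1) ^ 2)]
    gcongr
    rw [add_mul b]
    omega
  set a := (k + 1) ^ 2 * (b + 1) + (2 * n₀ + 60) with ha
  have h2 : U ≤ s ^ 2 * U := Nat.le_mul_of_pos_left _ (by positivity)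
  have h3 : s * U ≤ s ^ 2 * U := by gcongr; nlinarith
  set X := s ^ 2 * U with hX
  have h4 : (c * s + 20) * (20 * U) ≤ (20 * c + 400) * X :=
    calc (c * s + 20) * (20 * U) = 20 * c * (s * U) + 400 * U := by ring
      _ ≤ 20 * c * X + 400 * X := by gcongr
      _ = _ := by ring
  have h5 : c * s * (attemptTime K k n₀ U + (c * s * (507 * U) + 10 * U) + 15 * U) ≤
      (c * (a + 25) + 507 * c ^ 2) * X :=
    calc c * s * (attemptTime K k n₀ U + (c * s * (507 * U) + 10 * U) + 15 * U)
        ≤ c * s * (a * U + (c * s * (507 * U) + 10 * U) + 15 * U) := by gcongr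
      _ = c * (a + 25) * (s * U) + 507 * c ^ 2 * X := by rw [hX]; ring
      _ ≤ c * (a + 25) * X + 507 * c ^ 2 * X := by gcongr
      _ = _ := by ring
  have h6 : 10 * U + 115 * U + 1 + 1 ≤ 127 * X := by omega
  calc _ ≤ (20 * c + 400) * X + (c * (a + 25) + 507 * c ^ 2) * X + 127 * X := by
        omega
    _ = _ := by rw [ha]; ring

/-- The bit length is at most `1 + log n / log 2`; for `n ≥ 3` the summand `1` is at most `log n`,
and `1 + 1 / log 2 < 3`. -/
theorem size_le_log {n : ℕ} (hn : 3 ≤ n) : (n.size : ℝ) ≤ 3 * Real.log n := by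
  have hn0 : (0 : ℝ) < n := by exact_mod_cast (by omega : 0 < n)
  have h1 : 1 ≤ n.size := Nat.size_pos.2 (by omega)
  have h2 : 2 ^ (n.size - 1) ≤ n := Nat.lt_size.1 (by omega)
  have h3 : ((n.size - 1 : ℕ) : ℝ) * Real.log 2 ≤ Real.log n := by
    rw [← Real.log_pow]
    exact Real.log_le_log (by positivity) (by exact_mod_cast h2)
  have h4 : 1 ≤ Real.log n := by
    rw [Real.le_log_iff_exp_le hn0]
    have h5 : (3 : ℝ) ≤ n := by exact_mod_cast hn
    linarith [Real.exp_one_lt_d9]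
  have h5 := Real.log_two_gt_d9
  rw [Nat.cast_sub h1, Nat.cast_one] at h3
  have h6 : (0 : ℝ) ≤ (n.size : ℝ) - 1 := by
    have : (1 : ℝ) ≤ n.size := by exact_mod_cast h1
    linarith
  nlinarith

/-- The exponent three consists of the two factors in `solveTime_le` and one for the bit lengths in
`sizeBound`. The term `(n + 1)^2` is at most `4 * T n` by the quadratic lower bound. -/
theorem softO_solveTime (K k c n₀ : ℕ) {T : ℕ → ℕ} (hT : ∀ᶠ n in atTop, n * n ≤ T n) :
    SoftO (fun n => solveTime K k c n₀ n (sizeBound k c n * (n + 1) ^ 2 + T n)) T := by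
  obtain ⟨M, hM⟩ := solveTime_le K k c n₀
  set N := Nat.size (6 + k + 2 * c) + 2 with hN
  refine ⟨3, IsBigO.of_bound (M * (4 * N + 1) * 27 : ℕ) ?_⟩
  filter_upwards [hT, eventually_ge_atTop 3] with n h1 hn
  have hs : 1 ≤ n.size := Nat.size_pos.2 (by omega)
  have hT1 : 1 ≤ T n := le_trans (by nlinarith) h1
  have h2 : sizeBound k c n * (n + 1) ^ 2 + T n ≤ (4 * N + 1) * (n.size * T n) := by
    have h3 : (n + 1) ^ 2 ≤ 4 * T n := by nlinarith
    have h4 : T n ≤ n.size * T n := Nat.le_mul_of_pos_left _ hs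
    calc sizeBound k c n * (n + 1) ^ 2 + T n
        ≤ N * n.size * (4 * T n) + n.size * T n := by
          gcongr
          exact sizeBound_le (by omega)
      _ = _ := by ring
  have h3 : solveTime K k c n₀ n (sizeBound k c n * (n + 1) ^ 2 + T n) ≤
      M * (4 * N + 1) * (n.size ^ 3 * T n) :=
    calc _ ≤ M * (n.size ^ 2 * (sizeBound k c n * (n + 1) ^ 2 + T n)) :=
          hM n _ (by omega) (by omega)
      _ ≤ M * (n.size ^ 2 * ((4 * N + 1) * (n.size * T n))) := by gcongr
      _ = _ := by ring
  have hlog := size_le_log hn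
  have hlog0 : 0 ≤ Real.log n := Real.log_natCast_nonneg n
  rw [Real.norm_of_nonneg (Nat.cast_nonneg _), Real.norm_of_nonneg (by positivity)]
  calc ((solveTime K k c n₀ n (sizeBound k c n * (n + 1) ^ 2 + T n) : ℕ) : ℝ)
      ≤ ((M * (4 * N + 1) * (n.size ^ 3 * T n) : ℕ) : ℝ) := by exact_mod_cast h3
    _ = (M * (4 * N + 1) : ℕ) * ((n.size : ℝ) ^ 3 * T n) := by push_cast; ring
    _ ≤ (M * (4 * N + 1) : ℕ) * ((3 * Real.log n) ^ 3 * T n) := by gcongr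
    _ = _ := by push_cast; ring

end RAM

/-! ### Conclusion -/

/-- The reduction hides strips of the matrices in random matrices and multiplies these with the
given algorithm. It does not use the trapdoored matrix family. -/
theorem mainTheorem5 {F : Type*} [Field F] [Fintype F] [DecidableEq F]
    (htrap : ∃ D : (n : ℕ) → PMF (Matrix (Fin n) (Fin n) F × Circuit F), IsTrapdooredFamily D)
    (ε : ℝ) (hε : 0 < ε)
    (p : RAM.Prog F) (T : ℕ → ℕ)
    (hT : ∀ n (A B : Matrix (Fin n) (Fin n) F), RAM.HaltsWithin p (pairInput A B) (T n))
    (hp : ∀ᶠ n : ℕ in atTop,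
      ε ≤ expectation
        (PMF.uniformOfFintype (Matrix (Fin n) (Fin n) F × Matrix (Fin n) (Fin n) F))
        (fun AB => (RAM.haltProb p (pairInput AB.1 AB.2) (outputsMatrix (AB.1 * AB.2))).toReal))
    (c : ℕ) :
    ∃ (q : RAM.Prog F) (T' : ℕ → ℕ),
      SoftO T' T ∧
      (∀ n (A B : Matrix (Fin n) (Fin n) F), RAM.HaltsWithin q (pairInput A B) (T' n)) ∧
      ∀ n, 1 ≤ n → ∀ A B : Matrix (Fin n) (Fin n) F,
        1 - 1 / (n : ℝ) ^ c ≤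
          (RAM.haltProb q (pairInput A B) (outputsMatrix (A * B))).toReal := by
  classical
  obtain ⟨n₁, hn₁⟩ := eventually_atTop.1 hp
  have hp' : ∀ n ≥ n₁, ε ≤ 𝔼 X : Matrix (Fin n) (Fin n) F × Matrix (Fin n) (Fin n) F,
      RAM.mulProb p X := fun n hn => by
    rw [← RAM.expectation_uniform]; exact hn₁ n hn
  have hTn : ∀ᶠ n in atTop, n * n ≤ T n := by
    filter_upwards [eventually_ge_atTop n₁] with n hn
    -- Positive average success gives one pair with positive success probability, which suffices for
    -- the lower bound on `T n`.
    obtain ⟨X, -, hX⟩ := Finset.exists_lt_of_lt_expect Finset.univ_nonempty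
      (hε.trans_le (hp' n hn))
    exact RAM.sq_le_of_mulProb_pos (hT n X.1 X.2) hX
  obtain ⟨k, hk, hk0⟩ : ∃ k, (7 / 8 : ℝ) ^ k ≤ ε / 4 ∧ 0 < k := by
    obtain ⟨k, hk⟩ := exists_pow_lt_of_lt_one (show 0 < ε / 4 by positivity)
      (show (7 / 8 : ℝ) < 1 by norm_num)
    exact ⟨k + 1, (pow_le_pow_of_le_one (by norm_num) (by norm_num) (Nat.le_succ k)).trans hk.le,
      k.succ_pos⟩
  -- From `k ^ 2` on, the quotient `n / k` is at least `k` and so exceeds the remainder; hence `k +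
  -- 1` strips of width `n / k` cover all rows.
  set n₀ := max n₁ (k ^ 2) with hn₀
  set δ : ℝ := ε / (4 * k) with hδ
  have hδ0 : 0 < δ := by positivity
  have hcard : (0 : ℝ) < 1 / Fintype.card F := by
    have : 0 < Fintype.card F := Fintype.card_pos
    positivity
  have hcard' : (1 : ℝ) / Fintype.card F ≤ 1 := by
    have : (1 : ℝ) ≤ Fintype.card F := by exact_mod_cast (Fintype.card_pos : 0 < Fintype.card F)
    exact (div_le_one (by linarith)).2 this
  -- One constant for every dimension: the first term bounds the guessing probability for all `n <
  -- n₀`, the second the probability that all windows succeed.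
  set γ : ℝ := min ((1 / Fintype.card F : ℝ) ^ (n₀ * n₀)) (RAM.blockProb k δ ^ ((k + 1) ^ 2))
    with hγ
  have hγ0 : 0 < γ := by
    have : 0 < RAM.blockProb k δ := by rw [RAM.blockProb]; positivity
    exact lt_min (by positivity) (by positivity)
  have hγ1 : γ ≤ 1 := (min_le_left _ _).trans (pow_le_one₀ hcard.le hcard')
  obtain ⟨d, hd, hprob⟩ := RAM.exists_retryProb_ge hγ0 hγ1 c
  have key : ∀ n (A B : Matrix (Fin n) (Fin n) F), _ := fun n A B =>
    RAM.solve_spec (K := p.names) (k := k) (c := d) (T := T n) (β := RAM.sizeBound k d n)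
      (U := RAM.sizeBound k d n * (n + 1) ^ 2 + T n) (n₀ := n₀) (p := p) (γ := γ) (δ := δ) A B hd
      ⟨⟨fun x hx => Nat.size_le_size (by omega), le_rfl⟩, by omega, hT n, hk0,
        Nat.mul_div_le n k⟩
      (fun x hx => Nat.size_le_size (hx.trans (by nlinarith))) hγ0.le hγ1 (by
        rcases lt_or_ge n n₀ with hn | hn
        · refine .inl ⟨hn, (min_le_left _ _).trans ?_⟩
          exact pow_le_pow_of_le_one hcard.le hcard' (Nat.mul_le_mul hn.le hn.le)
        · refine .inr ⟨hn, ⟨hδ0.le, RAM.expect_not_goodStrips_le hε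
            (hp' n ((le_max_left _ _).trans hn)) hk⟩, ?_, min_le_right _ _⟩
          have h1 : k ^ 2 ≤ n := (le_max_right _ _).trans hn
          have h2 : k ≤ n / k := (Nat.le_div_iff_mul_le hk0).2 (by rw [← sq]; exact h1)
          have h3 := Nat.div_add_mod n k
          have h4 := Nat.mod_lt n hk0
          rw [add_mul]
          omega)
  refine ⟨RAM.solve p.names k d n₀ p, _, RAM.softO_solveTime p.names k d n₀ hTn,
    fun n A B => (key n A B).1, fun n hn A B => (hprob n hn).trans (key n A B).2⟩
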